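/- **Theorem (fourth moment bounds).** Let $\mathbf G=\{G_i : i\ge 1\}$ be i.i.d. standard Gaussian random variables, let $H_k$ be the Hermite polynomials ($H_0=1$, $H_{k+1}(x)=xH_k(x)-H_k'(x)$), and for a multi-index $q=(q_i)_{i\ge1}$ of nonnegative integers with $|q|=\sum_i q_i<\infty$ put $\Phi(q)=\prod_i H_{q_i}(G_i)$. Let $\mathfrak H$ be a real separable infinite-dimensional Hilbert space with orthonormal basis $\{e_j: j\ge1\}$, let $\mathfrak H^{\otimes d}$ be its $d$-th Hilbert tensor power, let $\mathfrak H^{\odot d}\subset\mathfrak H^{\otimes d}$ be the subspace of symmetric tensors, and let $\tilde e(q)\in\mathfrak H^{\odot |q|}$ be the symmetrization of $\bigotimes_i e_i^{\otimes q_i}$. For $h=\sum_{|q|=d}c_q\,\tilde e(q)\in\mathfrak H^{\odot d}$ the element $I_d(h)$ of the $d$-th Wiener chaos of $\mathbf G$ is $I_d(h)=\sum_{|q|=d}c_q\,\Phi(q)$ (convergence in $L^2$). For $h=\sum a(j_1,\dots,j_d)\,e_{j_1}\otimes\cdots\otimes e_{j_d}$ and $1\le r\le d-1$, let $h\otimes_r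 h\in\mathfrak H^{\otimes 2(d-r)}$ be the contraction with coefficients $$(j_1,\dots,j_{2d-2r})\mapsto\sum_{i_1,\dots,i_r\ge1}a(i_1,\dots,i_r,j_1,\dots,j_{d-r})\,a(i_1,\dots,i_r,j_{d-r+1},\dots,j_{2d-2r}),$$ and let $h\,\widetilde\otimes_r\,h$ be its symmetrization. Fix $d\ge2$, let $F=I_d(h)$ with $h\in\mathfrak H^{\odot d}$ and $E[F^2]=1$, and let $Z\sim\mathcal N(0,1)$. Then $E[F^4]<\infty$. Put $$T_1(F)=\sqrt{d^2\sum_{r=1}^{d-1}(r-1)!^2\binom{d-1}{r-1}^4(2d-2r)!\,\|h\,\widetilde\otimes_r\,h\|^2_{\mathfrak H^{\otimes2(d-r)}}},\qquad T_2(F)=\sqrt{\frac{d-1}{3d}\,\bigl|E[F^4]-3\bigr|}.$$ Then $T_1(F)\le T_2(F)$. Moreover $$d_{\mathrm{TV}}(F,Z)\le 2\,T_1(F),\qquad d_{\mathrm W}(F,Z)\le T_1(F),$$ where $d_{\mathrm{TV}}(F,Z)=\sup_A|P(F\in A)-P(Z\in A)|$ over Borel sets $A\subset\mathbb R$ and $d_{\mathrm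 W}(F,Z)=\sup_f|E[f(F)]-E[f(Z)]|$ over $1$-Lipschitz $f:\mathbb R\to\mathbb R$. Finally, for every three times differentiable $\varphi:\mathbb R\to\mathbb R$ with $\|\varphi'''\|_\infty=\sup_x|\varphi'''(x)|<\infty$, the random variables $\varphi(F)$ and $\varphi(Z)$ are integrable and $$|E[\varphi(F)]-E[\varphi(Z)]|\le C_*\,T_1(F),$$ $$C_*=4\sqrt2\,\bigl(1+5^{3d/2}\bigr)\max\Bigl\{\tfrac32|\varphi''(0)|+\tfrac{\|\varphi'''\|_\infty}{3}\,\tfrac{2\sqrt2}{\sqrt\pi}\,;\ 2|\varphi'(0)|+\tfrac13\|\varphi'''\|_\infty\Bigr\}.$$ -/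

import Mathlib

open MeasureTheory ProbabilityTheory Filter Topology
open scoped ENNReal NNReal TensorProduct

noncomputable section

namespace WienerChaos

/-! ### Hilbert tensor powers of a real Hilbert space -/

section TensorPower

variable {𝔥 : Type*} [NormedAddCommGroup 𝔥] [InnerProductSpace ℝ 𝔥] {n : ℕ}

/-- The algebraic `n`-th tensor power of `𝔥`. It is a type synonym of Mathlib's `⨂`, so that it can
carry the Hilbert (semi)norm instead of the projective seminorm. -/
def AlgTensorPower (𝔥 : Type*) [NormedAddCommGroup 𝔥] [InnerProductSpace ℝ 𝔥] (n : ℕ) : Type _ :=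
  ⨂[ℝ] _ : Fin n, 𝔥

instance : AddCommGroup (AlgTensorPower 𝔥 n) :=
  inferInstanceAs (AddCommGroup (⨂[ℝ] _ : Fin n, 𝔥))

instance : Module ℝ (AlgTensorPower 𝔥 n) :=
  inferInstanceAs (Module ℝ (⨂[ℝ] _ : Fin n, 𝔥))

/-- The elementary tensor `x₁ ⊗ ⋯ ⊗ xₙ` in the algebraic tensor power. -/
def algTprod : MultilinearMap ℝ (fun _ : Fin n => 𝔥) (AlgTensorPower 𝔥 n) :=
  PiTensorProduct.tprod ℝ

/-- The bilinear form on the algebraic tensor power with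
`⟪x₁ ⊗ ⋯ ⊗ xₙ, y₁ ⊗ ⋯ ⊗ yₙ⟫ = ∏ i, ⟪xᵢ, yᵢ⟫`. -/
def algInner : AlgTensorPower 𝔥 n →ₗ[ℝ] AlgTensorPower 𝔥 n →ₗ[ℝ] ℝ :=
  (PiTensorProduct.dualDistrib (R := ℝ) (M := fun _ : Fin n => 𝔥)).comp
    (PiTensorProduct.map (fun _ : Fin n => innerₗ 𝔥))

theorem algInner_tprod (x y : Fin n → 𝔥) :
    algInner (algTprod x) (algTprod y) = ∏ i, inner ℝ (x i) (y i) := by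
  have h := PiTensorProduct.dualDistrib_apply (R := ℝ) (M := fun _ : Fin n => 𝔥)
    (fun i => innerₗ 𝔥 (x i)) y
  have h' := PiTensorProduct.map_tprod (R := ℝ) (fun _ : Fin n => innerₗ 𝔥) x
  rw [← h'] at h
  exact h

theorem exists_eq_sum_algTprod (t : AlgTensorPower 𝔥 n) :
    ∃ (m : ℕ) (c : Fin m → ℝ) (x : Fin m → Fin n → 𝔥), t = ∑ k, c k • algTprod (x k) := by
  refine PiTensorProduct.induction_on (motive := fun t : (⨂[ℝ] _ : Fin n, 𝔥) =>
    ∃ (m : ℕ) (c : Fin m → ℝ) (x : Fin m → Fin n → 𝔥),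
      t = ∑ k, c k • PiTensorProduct.tprod ℝ (x k)) t ?_ ?_
  · intro c x
    exact ⟨1, fun _ => c, fun _ => x, by simp⟩
  · rintro a b ⟨m, c, x, rfl⟩ ⟨m', c', y, rfl⟩
    exact ⟨m + m', Fin.append c c', Fin.append x y, by simp [Fin.sum_univ_add]⟩

theorem algInner_symm (s t : AlgTensorPower 𝔥 n) : algInner s t = algInner t s := by
  obtain ⟨m, c, x, rfl⟩ := exists_eq_sum_algTprod s
  obtain ⟨m', c', y, rfl⟩ := exists_eq_sum_algTprod t
  simp only [map_sum, map_smul, LinearMap.sum_apply, LinearMap.smul_apply, algInner_tprod,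
    smul_eq_mul, Finset.mul_sum]
  rw [Finset.sum_comm]
  refine Finset.sum_congr rfl fun k _ => Finset.sum_congr rfl fun l _ => ?_
  simp only [real_inner_comm]
  ring

theorem posSemidef_prod_inner (n : ℕ) {m : ℕ} (x : Fin m → Fin n → 𝔥) :
    (Matrix.of fun k l => ∏ i, (inner ℝ (x k i) (x l i) : ℝ)).PosSemidef := by
  induction n with
  | zero =>
    have h := Matrix.posSemidef_gram ℝ (fun _ : Fin m => (1 : ℝ))
    have h' : (Matrix.of fun k l => ∏ i, (inner ℝ (x k i) (x l i) : ℝ)) =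
        Matrix.gram ℝ (fun _ : Fin m => (1 : ℝ)) := by
      ext k l
      simp [Matrix.gram]
    exact h' ▸ h
  | succ n ih =>
    have h := (Matrix.posSemidef_gram ℝ (fun k => x k 0)).hadamard (ih fun k i => x k i.succ)
    have h' : (Matrix.of fun k l => ∏ i, (inner ℝ (x k i) (x l i) : ℝ)) =
        (Matrix.gram ℝ (fun k => x k 0)).hadamard
          (Matrix.of fun k l => ∏ i : Fin n, (inner ℝ (x k i.succ) (x l i.succ) : ℝ)) := by
      ext k l
      simp [Matrix.gram, Fin.prod_univ_succ]
    exact h' ▸ h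

theorem algInner_nonneg (t : AlgTensorPower 𝔥 n) : 0 ≤ algInner t t := by
  obtain ⟨m, c, x, rfl⟩ := exists_eq_sum_algTprod t
  have h := (Matrix.posSemidef_iff_dotProduct_mulVec.1 (posSemidef_prod_inner n x)).2 c
  refine h.trans_eq ?_
  simp only [map_sum, map_smul, LinearMap.sum_apply, LinearMap.smul_apply, algInner_tprod,
    smul_eq_mul, dotProduct, Matrix.mulVec, Matrix.of_apply, star_trivial, Finset.mul_sum]
  rw [Finset.sum_comm]
  refine Finset.sum_congr rfl fun k _ => Finset.sum_congr rfl fun l _ => ?_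
  ring

/-- The Hilbert inner product on the algebraic tensor power, as a pre-inner product. -/
@[reducible] def algCore : PreInnerProductSpace.Core ℝ (AlgTensorPower 𝔥 n) where
  inner s t := algInner s t
  conj_inner_symm s t := by simpa using algInner_symm t s
  re_inner_nonneg t := by simpa using algInner_nonneg t
  add_left s t u := by simp
  smul_left s t c := by simp

instance : SeminormedAddCommGroup (AlgTensorPower 𝔥 n) :=
  @InnerProductSpace.Core.toSeminormedAddCommGroup ℝ _ _ _ _ algCore

instance : InnerProductSpace ℝ (AlgTensorPower 𝔥 n) :=
  InnerProductSpace.ofCore algCore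

theorem inner_algTprod (x y : Fin n → 𝔥) :
    inner ℝ (algTprod x) (algTprod y) = ∏ i, (inner ℝ (x i) (y i) : ℝ) :=
  algInner_tprod x y

/-- The `n`-th Hilbert tensor power `𝔥^{⊗n}`: the completion of the algebraic tensor power for the
inner product `⟪x₁ ⊗ ⋯ ⊗ xₙ, y₁ ⊗ ⋯ ⊗ yₙ⟫ = ∏ i, ⟪xᵢ, yᵢ⟫`. -/
abbrev TensorPower (𝔥 : Type*) [NormedAddCommGroup 𝔥] [InnerProductSpace ℝ 𝔥] (n : ℕ) : Type _ :=
  UniformSpace.Completion (AlgTensorPower 𝔥 n)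

/-- The elementary tensor `x₁ ⊗ ⋯ ⊗ xₙ` in `𝔥^{⊗n}`. -/
def tprod (x : Fin n → 𝔥) : TensorPower 𝔥 n := (algTprod x : AlgTensorPower 𝔥 n)

theorem inner_tprod (x y : Fin n → 𝔥) :
    inner ℝ (tprod x) (tprod y) = ∏ i, (inner ℝ (x i) (y i) : ℝ) := by
  rw [tprod, tprod, UniformSpace.Completion.inner_coe, inner_algTprod]

/-- Permutation of the tensor factors on the algebraic tensor power. -/
def algPermute (σ : Equiv.Perm (Fin n)) : AlgTensorPower 𝔥 n →ₗ[ℝ] AlgTensorPower 𝔥 n :=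
  (PiTensorProduct.reindex ℝ (fun _ : Fin n => 𝔥) σ).toLinearMap

theorem algPermute_algTprod (σ : Equiv.Perm (Fin n)) (x : Fin n → 𝔥) :
    algPermute σ (algTprod x) = algTprod fun i => x (σ.symm i) :=
  PiTensorProduct.reindex_tprod (R := ℝ) (s := fun _ : Fin n => 𝔥) σ x

theorem inner_algPermute (σ : Equiv.Perm (Fin n)) (s t : AlgTensorPower 𝔥 n) :
    (inner ℝ (algPermute σ s) (algPermute σ t) : ℝ) = inner ℝ s t := by
  obtain ⟨m, c, x, rfl⟩ := exists_eq_sum_algTprod s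
  obtain ⟨m', c', y, rfl⟩ := exists_eq_sum_algTprod t
  simp only [map_sum, map_smul, algPermute_algTprod, sum_inner, inner_sum, inner_smul_left,
    inner_smul_right, inner_algTprod]
  refine Finset.sum_congr rfl fun k _ => congrArg _ (Finset.sum_congr rfl fun l _ => ?_)
  rw [Equiv.prod_comp σ.symm fun i => (inner ℝ (x l i) (y k i) : ℝ)]

/-- The unitary operator on `𝔥^{⊗n}` permuting the tensor factors. -/
def permute (σ : Equiv.Perm (Fin n)) : TensorPower 𝔥 n →L[ℝ] TensorPower 𝔥 n :=
  ((algPermute (𝔥 := 𝔥) σ).isometryOfInner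
    (inner_algPermute σ)).toContinuousLinearMap.completion

theorem permute_tprod (σ : Equiv.Perm (Fin n)) (x : Fin n → 𝔥) :
    permute σ (tprod x) = tprod fun i => x (σ.symm i) := by
  rw [tprod, permute, ContinuousLinearMap.completion_apply_coe, tprod, ← algPermute_algTprod]
  rfl

/-- The canonical symmetrization of a tensor. -/
def symmetrize (t : TensorPower 𝔥 n) : TensorPower 𝔥 n :=
  (n.factorial : ℝ)⁻¹ • ∑ σ : Equiv.Perm (Fin n), permute σ t

/-- The symmetric tensor power `𝔥^{⊙n}`, as a set of elements of `𝔥^{⊗n}`. -/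
def symmetricPower (𝔥 : Type*) [NormedAddCommGroup 𝔥] [InnerProductSpace ℝ 𝔥] (n : ℕ) :
    Set (TensorPower 𝔥 n) :=
  {t | ∀ σ : Equiv.Perm (Fin n), permute σ t = t}

/-- The basis tensor `e_{j₁} ⊗ ⋯ ⊗ e_{jₙ}`. -/
def basisTensor (e : HilbertBasis ℕ ℝ 𝔥) (j : Fin n → ℕ) : TensorPower 𝔥 n :=
  tprod fun i => e (j i)

/-- The coefficient `⟪e_{j₁} ⊗ ⋯ ⊗ e_{jₙ}, t⟫` of a tensor. -/
def coeff (e : HilbertBasis ℕ ℝ 𝔥) (t : TensorPower 𝔥 n) (j : Fin n → ℕ) : ℝ :=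
  inner ℝ (basisTensor e j) t

/-- The index tuple `(a₁, …, a_r, j₁, …, j_{p-r})` of length `p`, where `r ≤ p`. -/
def concat {r p : ℕ} (a : Fin r → ℕ) (j : Fin (p - r) → ℕ) : Fin p → ℕ :=
  fun i => Fin.append a j (Fin.castLE le_add_tsub i)

/-- The kernel of the `r`-th contraction, `r ≤ min p q`: with `a`, `b` the coefficients of `f`, `g`,
`(a ⋆_r b)(j, k) = ∑_{i₁, …, i_r} a(i₁, …, i_r, j) b(i₁, …, i_r, k)`, where `j` consists of the
first `p - r` and `k` of the last `q - r` of the indices. -/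
def contractionKernel (e : HilbertBasis ℕ ℝ 𝔥) {p q : ℕ} (r : ℕ) (f : TensorPower 𝔥 p)
    (g : TensorPower 𝔥 q) (jk : Fin ((p - r) + (q - r)) → ℕ) : ℝ :=
  ∑' i : Fin r → ℕ, coeff e f (concat i fun l => jk (Fin.castAdd (q - r) l)) *
    coeff e g (concat i fun l => jk (Fin.natAdd (p - r) l))

/-- The `r`-th contraction `f ⊗_r g ∈ 𝔥^{⊗(p+q-2r)}`, for `r ≤ min p q`. -/
def contraction (e : HilbertBasis ℕ ℝ 𝔥) {p q : ℕ} (r : ℕ) (f : TensorPower 𝔥 p)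
    (g : TensorPower 𝔥 q) : TensorPower 𝔥 ((p - r) + (q - r)) :=
  ∑' jk : Fin ((p - r) + (q - r)) → ℕ, contractionKernel e r f g jk • basisTensor e jk

/-! ### Multiple integrals -/

/-- The multi-indices `q` with `|q| = d`. -/
abbrev MultiIndex (d : ℕ) : Type := {q : ℕ →₀ ℕ // q.degree = d}

/-- The nondecreasing tuple `(i₁, …, i₁, i₂, …, i₂, …)` in which `i` occurs `q i` times. -/
def MultiIndex.tuple {d : ℕ} (q : MultiIndex d) : Fin d → ℕ :=
  fun l => ((Finsupp.toMultiset q.1).sort (· ≤ ·)).getD l 0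

/-- The tensor `e(q) = e_{i₁}^{⊗ q_{i₁}} ⊗ ⋯ ⊗ e_{i_k}^{⊗ q_{i_k}}` in `𝔥^{⊗d}`, where
`i₁ < ⋯ < i_k` is the support of `q`. -/
def multiIndexTensor (e : HilbertBasis ℕ ℝ 𝔥) {d : ℕ} (q : MultiIndex d) : TensorPower 𝔥 d :=
  basisTensor e q.tuple

/-- `Φ(q) = ∏ i, H_{q i}(G i)`, where `H_k` is the `k`-th (probabilists') Hermite polynomial. -/
def hermiteProduct {Ω : Type*} (G : ℕ → Ω → ℝ) (q : ℕ →₀ ℕ) (ω : Ω) : ℝ :=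
  q.prod fun i k => Polynomial.aeval (G i ω) (Polynomial.hermite k)

/-- `F = I_d(h)` (almost surely): if `h = ∑_{|q| = d} c_q ẽ(q)` in `𝔥^{⊗d}`, with `ẽ(q)` the
symmetrization of `e(q)`, then `F = ∑_{|q| = d} c_q Φ(q)` in `L²(P)`. Both series converge
unconditionally in the norm. -/
def IsMultipleIntegral {Ω : Type*} [MeasurableSpace Ω] (P : Measure Ω) (G : ℕ → Ω → ℝ)
    (e : HilbertBasis ℕ ℝ 𝔥) {d : ℕ} (h : TensorPower 𝔥 d) (F : Ω → ℝ) : Prop :=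
  MemLp F 2 P ∧ ∃ c : MultiIndex d → ℝ,
    HasSum (fun q => c q • symmetrize (multiIndexTensor e q)) h ∧
    Tendsto (fun s : Finset (MultiIndex d) =>
      eLpNorm (fun ω => F ω - ∑ q ∈ s, c q * hermiteProduct G q.1 ω) 2 P) atTop (𝓝 0)

/-- The contraction quantity `T₁(F)` of `F = I_d(h)`. -/
def T₁ (e : HilbertBasis ℕ ℝ 𝔥) {d : ℕ} (h : TensorPower 𝔥 d) : ℝ :=
  √((d : ℝ) ^ 2 * ∑ r ∈ Finset.Icc 1 (d - 1),
    ((r - 1).factorial : ℝ) ^ 2 * ((d - 1).choose (r - 1) : ℝ) ^ 4 *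
      ((2 * d - 2 * r).factorial : ℝ) * ‖symmetrize (contraction e r h h)‖ ^ 2)

end TensorPower

/-! ### Fourth moment quantity, distances between laws -/

section Distances

variable {Ω Ω' : Type*} [MeasurableSpace Ω] [MeasurableSpace Ω']

/-- The fourth moment quantity `T₂(F) = √((d - 1) / (3 d) |E F⁴ - 3|)`. -/
def T₂ (P : Measure Ω) (d : ℕ) (F : Ω → ℝ) : ℝ :=
  √(((d : ℝ) - 1) / (3 * d) * |(∫ ω, F ω ^ 4 ∂P) - 3|)

/-- The distance `sup {|E f(F) - E f(Z)| : f ∈ 𝓗}` between the laws of `F` and `Z`, as an element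
of `[0, ∞]`. -/
def distOver (𝓗 : Set (ℝ → ℝ)) (P : Measure Ω) (F : Ω → ℝ) (P' : Measure Ω') (Z : Ω' → ℝ) :
    ℝ≥0∞ :=
  ⨆ f ∈ 𝓗, ENNReal.ofReal |(∫ ω, f (F ω) ∂P) - ∫ ω, f (Z ω) ∂P'|

/-- The total variation distance: the test functions are the indicators of Borel sets. -/
def dTV (P : Measure Ω) (F : Ω → ℝ) (P' : Measure Ω') (Z : Ω' → ℝ) : ℝ≥0∞ :=
  distOver {f | ∃ A : Set ℝ, MeasurableSet A ∧ f = A.indicator 1} P F P' Z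

/-- The Wasserstein distance: the test functions are the `1`-Lipschitz functions. -/
def dW (P : Measure Ω) (F : Ω → ℝ) (P' : Measure Ω') (Z : Ω' → ℝ) : ℝ≥0∞ :=
  distOver {f | LipschitzWith 1 f} P F P' Z

/-- The constant `C_*`, with `‖φ'''‖_∞ = ⨆ x, |φ'''(x)|`. -/
def Cstar (d : ℕ) (φ : ℝ → ℝ) : ℝ :=
  4 * √2 * (1 + (5 : ℝ) ^ (3 * (d : ℝ) / 2)) *
    max (3 / 2 * |iteratedDeriv 2 φ 0| +
        (⨆ x, |iteratedDeriv 3 φ x|) / 3 * (2 * √2 / √Real.pi))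
      (2 * |deriv φ 0| + 1 / 3 * ⨆ x, |iteratedDeriv 3 φ x|)

end Distances

end WienerChaos

end

set_option linter.unusedSectionVars false

noncomputable section

namespace WienerChaos

/-! ### Wick polynomials and their product formula -/

section Wick

open MvPolynomial

variable {ι : Type*}

/-! Suppose first that F is a finite sum in the d-th chaos, so F = `wick a` for a homogeneous
polynomial `a` of degree d in finitely many Gaussians. Euler's identity and Gaussian integration by
parts give E[F g(F)] = E[Q g'(F)] with Q = |∇F|²/d (`integral_wick_mul_comp`). Thus Q is a Stein
kernel of F, and the distance of F from a standard Gaussian is controlled by E[(1 - Q)²].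

The product formula `wick_mul_wick` writes F² = ∑ W_r with W_r in the chaos of degree 2d - 2r, and
the same formula applied to the derivatives of F gives |∇F|² = ∑ r W_r (`carreDuChamp_eq`). The term
W_d is the constant E[F²], and the others are centred and mutually orthogonal, so E[(1 - Q)²] = (1 -
E[F²])² + ∑_{1≤r<d} (r/d)² E[W_r²]. By the dictionary between polynomials and symmetric tensors this
last sum is T₁² (`T₁_polyTensor_sq`). The choice g(x) = x³ gives d (E[F⁴] - 3 E[F²]²) = 3 ∑_{1≤r<d}
r E[W_r²], and r² ≤ (d - 1) r for r ≤ d - 1 compares the two sums: this is T₁ ≤ T₂.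

For total variation, the Stein equation of a test function with values in [0, 1] has a solution with
|g'| ≤ 2, and Cauchy-Schwarz against 1 - Q gives the bound. For smooth test functions, E φ(cos θ F +
sin θ Z) interpolates between F and an independent Gaussian Z; its derivative is cos θ sin θ E[(1 -
Q) φ''(cos θ F + sin θ Z)]. In the Lipschitz case a further integration by parts in Z removes φ''.

A general F is the limit of partial sums F_n with kernels t_n → h. Contractions are bounded bilinear
maps, so T₁ is continuous (`continuous_T₁`); fourth moments in a fixed chaos are bounded by a
constant times the fourth power of the norm of the kernel (`gaussianExpect_pow_four_le`), so F_n → F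
in L⁴. All bounds then pass to the limit, where the variance defect 1 - E[F_n²] disappears. -/

theorem pderiv_pderiv_comm (i j : ι) (a : MvPolynomial ι ℝ) :
    pderiv i (pderiv j a) = pderiv j (pderiv i a) := by
  classical
  have h : ⁅pderiv (R := ℝ) i, pderiv (R := ℝ) j⁆ = 0 := by
    refine MvPolynomial.derivation_ext fun k => ?_
    rw [Derivation.commutator_apply]
    simp only [pderiv_X, Pi.single_apply]
    split_ifs <;> simp
  have h2 := congrArg (fun D => D a) h
  simp only [Derivation.commutator_apply, Derivation.zero_apply] at h2
  exact sub_eq_zero.1 h2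

/-- The Wick map, sending a monomial to the corresponding product of Hermite polynomials. -/
def wick : MvPolynomial ι ℝ →ₗ[ℝ] MvPolynomial ι ℝ :=
  (basisMonomials ι ℝ).constr ℝ fun q =>
    q.prod fun i k => Polynomial.aeval (X i : MvPolynomial ι ℝ) (Polynomial.hermite k)

theorem wick_monomial (q : ι →₀ ℕ) : wick (monomial q (1 : ℝ)) =
    q.prod fun i k => Polynomial.aeval (X i : MvPolynomial ι ℝ) (Polynomial.hermite k) := by
  have := (basisMonomials ι ℝ).constr_basis ℝ (fun q : ι →₀ ℕ =>
    q.prod fun i k => Polynomial.aeval (X i : MvPolynomial ι ℝ) (Polynomial.hermite k)) q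
  rwa [coe_basisMonomials] at this

theorem wick_C (c : ℝ) : wick (C c : MvPolynomial ι ℝ) = C c := by
  have h : (C c : MvPolynomial ι ℝ) = c • monomial 0 1 := by
    rw [smul_monomial, smul_eq_mul, mul_one]; rfl
  rw [h, map_smul, wick_monomial]
  simp [Finsupp.prod_zero_index, smul_eq_C_mul]

theorem pderiv_aeval_X (i : ι) (p : Polynomial ℤ) :
    pderiv i (Polynomial.aeval (X i : MvPolynomial ι ℝ) p) =
      Polynomial.aeval (X i : MvPolynomial ι ℝ) (Polynomial.derivative p) := by
  have h := ((pderiv (R := ℝ) i).restrictScalars ℤ).map_aeval p (X i)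
  rw [Derivation.restrictScalars_apply, Derivation.restrictScalars_apply, pderiv_X_self,
    smul_eq_mul, mul_one] at h
  exact h

theorem pderiv_prod_eq_zero {κ : Type*} (i : ι) (s : Finset κ) (f : κ → MvPolynomial ι ℝ)
    (hf : ∀ k ∈ s, pderiv i (f k) = 0) : pderiv i (∏ k ∈ s, f k) = 0 := by
  classical
  induction s using Finset.induction_on with
  | empty => simp
  | insert k s hk ih =>
    rw [Finset.prod_insert hk, pderiv_mul, hf k (by simp), ih fun l hl => hf l (by simp [hl])]
    simp

theorem pderiv_prod {κ : Type*} [DecidableEq κ] (i : ι) (s : Finset κ)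
    (f : κ → MvPolynomial ι ℝ) :
    pderiv i (∏ k ∈ s, f k) = ∑ k ∈ s, (∏ l ∈ s.erase k, f l) * pderiv i (f k) := by
  induction s using Finset.induction_on with
  | empty => simp
  | insert k s hk ih =>
    rw [Finset.prod_insert hk, pderiv_mul, ih, Finset.sum_insert hk, Finset.erase_insert hk,
      Finset.mul_sum, mul_comm (pderiv i (f k))]
    congr 1
    refine Finset.sum_congr rfl fun l hl => ?_
    have hkl : k ≠ l := fun h => hk (h ▸ hl)
    rw [Finset.erase_insert_of_ne hkl, Finset.prod_insert (by simp [hk]), mul_assoc]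

theorem pderiv_aeval_X_of_ne {i j : ι} (h : j ≠ i) (p : Polynomial ℤ) :
    pderiv i (Polynomial.aeval (X j : MvPolynomial ι ℝ) p) = 0 := by
  have h' := ((pderiv (R := ℝ) i).restrictScalars ℤ).map_aeval p (X j)
  rw [Derivation.restrictScalars_apply, Derivation.restrictScalars_apply, pderiv_X_of_ne h,
    smul_zero] at h'
  exact h'

/-- The Hermite recursion H_{k+1} = x H_k - H_k', in one variable at a time. It makes `wick`
intertwine multiplication by `X i` with the creation operator `X i - ∂_i`, and it replaces explicit
Hermite polynomials in what follows. -/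
theorem wick_X_mul (i : ι) (a : MvPolynomial ι ℝ) :
    wick (X i * a) = X i * wick a - pderiv i (wick a) := by
  classical
  induction a using MvPolynomial.induction_on' with
  | add p q hp hq => rw [mul_add, map_add, hp, hq, map_add, map_add]; ring
  | monomial q c =>
    have h1 : (monomial q c : MvPolynomial ι ℝ) = c • monomial q 1 := by
      rw [smul_monomial, smul_eq_mul, mul_one]
    have h2 : X i * (monomial q 1 : MvPolynomial ι ℝ) = monomial (q + Finsupp.single i 1) 1 := by
      rw [X, monomial_mul, one_mul, add_comm]
    rw [h1, mul_smul_comm, map_smul, map_smul, h2, Derivation.map_smul, mul_smul_comm, ← smul_sub]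
    congr 1
    rw [wick_monomial, wick_monomial]
    -- Raising the exponent of `i` can enlarge the support, so both products are taken over one
    -- index set that contains `i`.
    set s := insert i q.support
    have hs : q.support ⊆ s := Finset.subset_insert _ _
    have hs' : (q + Finsupp.single i 1).support ⊆ s := by
      intro j hj
      simp only [Finsupp.mem_support_iff, Finsupp.add_apply, s, Finset.mem_insert] at hj ⊢
      by_contra h
      push Not at h
      rw [h.2, Finsupp.single_eq_of_ne h.1] at hj
      exact hj rfl
    rw [Finsupp.prod_of_support_subset _ hs _ (by simp),
      Finsupp.prod_of_support_subset _ hs' _ (by simp),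
      ← Finset.mul_prod_erase s _ (Finset.mem_insert_self i _),
      ← Finset.mul_prod_erase s _ (Finset.mem_insert_self i _), pderiv_mul,
      pderiv_prod_eq_zero i (s.erase i), pderiv_aeval_X]
    · rw [Finset.prod_congr rfl fun j hj => by
        rw [Finsupp.add_apply, Finsupp.single_eq_of_ne (Finset.ne_of_mem_erase hj), add_zero]]
      rw [Finsupp.add_apply, Finsupp.single_eq_same, Polynomial.hermite_succ, map_sub, map_mul,
        Polynomial.aeval_X]
      ring
    · intro j hj
      exact pderiv_aeval_X_of_ne (Finset.ne_of_mem_erase hj) _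

/-- By induction on the number of factors, from the commutation of `∂_i` with the creation operator
of `j` up to δ_{ij}. It encodes H_k' = k H_{k-1}. -/
theorem pderiv_wick (i : ι) (a : MvPolynomial ι ℝ) :
    pderiv i (wick a) = wick (pderiv i a) := by
  classical
  induction a using MvPolynomial.induction_on with
  | C c => simp [wick_C]
  | add p q hp hq => simp only [map_add, hp, hq]
  | mul_X p j h =>
    rw [mul_comm, wick_X_mul, map_sub, pderiv_mul, pderiv_mul, map_add, wick_X_mul,
      pderiv_pderiv_comm, h, pderiv_X, Pi.single_apply]
    split_ifs
    · simp
      ring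
    · simp

/-- Iterated partial derivative along a list of variables. -/
def pderivList (L : List ι) (a : MvPolynomial ι ℝ) : MvPolynomial ι ℝ :=
  L.foldl (fun a k => pderiv k a) a

theorem pderivList_nil (a : MvPolynomial ι ℝ) : pderivList [] a = a := rfl

theorem pderivList_cons (k : ι) (L : List ι) (a : MvPolynomial ι ℝ) :
    pderivList (k :: L) a = pderivList L (pderiv k a) := rfl

theorem pderivList_append (L L' : List ι) (a : MvPolynomial ι ℝ) :
    pderivList (L ++ L') a = pderivList L' (pderivList L a) := by
  simp [pderivList]

theorem pderivList_add (L : List ι) (a b : MvPolynomial ι ℝ) :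
    pderivList L (a + b) = pderivList L a + pderivList L b := by
  induction L generalizing a b with
  | nil => rfl
  | cons k L ih => simp only [pderivList_cons, map_add, ih]

theorem pderivList_smul (L : List ι) (c : ℝ) (a : MvPolynomial ι ℝ) :
    pderivList L (c • a) = c • pderivList L a := by
  induction L generalizing a with
  | nil => rfl
  | cons k L ih => rw [pderivList_cons, Derivation.map_smul, ih, pderivList_cons]

/-- Iterated partial derivative, as a linear map. -/
def pderivListₗ (L : List ι) : MvPolynomial ι ℝ →ₗ[ℝ] MvPolynomial ι ℝ where
  toFun := pderivList L
  map_add' := pderivList_add L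
  map_smul' := pderivList_smul L

theorem isHomogeneous_pderivList (L : List ι) {a : MvPolynomial ι ℝ} {n : ℕ}
    (ha : a.IsHomogeneous n) : (pderivList L a).IsHomogeneous (n - L.length) := by
  induction L generalizing a n with
  | nil => exact ha
  | cons k L ih =>
    rw [pderivList_cons, List.length_cons, add_comm, ← Nat.sub_sub]
    exact ih ha.pderiv

/-- The pairing `∑ ∂_{i₁} ⋯ ∂_{i_r} a * ∂_{i₁} ⋯ ∂_{i_r} b`, over all tuples `i₁, …, i_r`. -/
def polyContraction [Fintype ι] : ℕ → MvPolynomial ι ℝ → MvPolynomial ι ℝ → MvPolynomial ι ℝ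
  | 0, a, b => a * b
  | r + 1, a, b => ∑ k, polyContraction r (pderiv k a) (pderiv k b)

variable [Fintype ι]

theorem polyContraction_succ (r : ℕ) (a b : MvPolynomial ι ℝ) :
    polyContraction (r + 1) a b = ∑ k, polyContraction r (pderiv k a) (pderiv k b) := rfl

theorem polyContraction_add (r : ℕ) (a a' b : MvPolynomial ι ℝ) :
    polyContraction r (a + a') b = polyContraction r a b + polyContraction r a' b := by
  induction r generalizing a a' b with
  | zero => simp [polyContraction, add_mul]
  | succ r ih => simp only [polyContraction, map_add, ih, Finset.sum_add_distrib]

theorem polyContraction_smul (r : ℕ) (c : ℝ) (a b : MvPolynomial ι ℝ) :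
    polyContraction r (c • a) b = c • polyContraction r a b := by
  induction r generalizing a b with
  | zero => simp [polyContraction]
  | succ r ih =>
    simp only [polyContraction, Derivation.map_smul, ih, Finset.smul_sum]

theorem polyContraction_zero (r : ℕ) (b : MvPolynomial ι ℝ) : polyContraction r 0 b = 0 := by
  simpa using polyContraction_smul r 0 0 b

theorem polyContraction_sum {κ : Type*} (r : ℕ) (s : Finset κ) (a : κ → MvPolynomial ι ℝ)
    (b : MvPolynomial ι ℝ) :
    polyContraction r (∑ k ∈ s, a k) b = ∑ k ∈ s, polyContraction r (a k) b := by
  classical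
  induction s using Finset.induction_on with
  | empty => simp [polyContraction_zero]
  | insert k s hk ih => rw [Finset.sum_insert hk, Finset.sum_insert hk, polyContraction_add, ih]

/-- Leibniz rule: either none of the r + 1 derivatives hits the factor `X k`, or exactly one does;
by symmetry each of the r + 1 choices contributes the same term. -/
theorem polyContraction_X_mul (r : ℕ) (k : ι) (a b : MvPolynomial ι ℝ) :
    polyContraction (r + 1) (X k * a) b =
      X k * polyContraction (r + 1) a b + ((r : ℝ) + 1) • polyContraction r a (pderiv k b) := by
  classical
  induction r generalizing a b with
  | zero =>
    simp only [polyContraction, pderiv_mul, pderiv_X, Pi.single_apply, add_mul,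
      Finset.sum_add_distrib, ite_mul, one_mul, zero_mul, Finset.mem_univ,
      Nat.cast_zero, zero_add, one_smul, Finset.mul_sum, if_true, Finset.sum_ite_eq]
    rw [add_comm]
    congr 1
    exact Finset.sum_congr rfl fun _ _ => by ring
  | succ r ih =>
    rw [polyContraction]
    simp only [pderiv_mul, pderiv_X, polyContraction_add, ih, Finset.sum_add_distrib]
    have h1 : ∀ x, polyContraction (r + 1) (Pi.single (M := fun _ => MvPolynomial ι ℝ) x 1 k * a)
        (pderiv x b) = if x = k then polyContraction (r + 1) a (pderiv k b) else 0 := by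
      intro x
      by_cases hx : x = k
      · subst hx; simp
      · rw [if_neg hx, Pi.single_eq_of_ne (Ne.symm hx), zero_mul, polyContraction_zero]
    simp only [h1, Finset.sum_ite_eq', Finset.mem_univ, if_true]
    rw [← Finset.mul_sum, ← Finset.smul_sum]
    have h2 : ∑ x, polyContraction r (pderiv x a) (pderiv k (pderiv x b)) =
        polyContraction (r + 1) a (pderiv k b) := by
      rw [polyContraction]
      exact Finset.sum_congr rfl fun x _ => by rw [pderiv_pderiv_comm]
    rw [h2, polyContraction_succ (r + 1) a b]
    push_cast
    module

theorem polyContraction_eq_zero {r n : ℕ} {a : MvPolynomial ι ℝ} (b : MvPolynomial ι ℝ)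
    (ha : a.IsHomogeneous n) (hn : n < r) : polyContraction r a b = 0 := by
  induction r generalizing n a b with
  | zero => omega
  | succ r ih =>
    rw [polyContraction]
    refine Finset.sum_eq_zero fun k _ => ?_
    rcases n with _ | n
    · obtain ⟨c, rfl⟩ : ∃ c, a = C c := ⟨_, (totalDegree_eq_zero_iff_eq_C.1
        (by simpa using ha.totalDegree_le))⟩
      rw [pderiv_C, polyContraction_zero]
    · exact ih _ ha.pderiv (by simpa using hn)

theorem isHomogeneous_polyContraction {r n m : ℕ} {a b : MvPolynomial ι ℝ}
    (ha : a.IsHomogeneous n) (hb : b.IsHomogeneous m) (hrn : r ≤ n) (hrm : r ≤ m) :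
    (polyContraction r a b).IsHomogeneous ((n - r) + (m - r)) := by
  induction r generalizing n m a b with
  | zero => exact ha.mul hb
  | succ r ih =>
    rw [polyContraction]
    refine IsHomogeneous.sum _ _ _ fun k _ => ?_
    have := ih (ha.pderiv (i := k)) (hb.pderiv (i := k)) (by omega) (by omega)
    convert this using 1
    omega

/-- Euler's identity (n + 1) a = ∑ X_k ∂_k a allows an induction on the degree that never mentions
monomials. -/
theorem IsHomogeneous_induction {n : ℕ} {motive : MvPolynomial ι ℝ → Prop}
    {a : MvPolynomial ι ℝ} (ha : a.IsHomogeneous (n + 1))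
    (sum : ∀ f : ι → MvPolynomial ι ℝ, (∀ k, motive (f k)) → motive (((n : ℝ) + 1)⁻¹ • ∑ k, f k))
    (mul : ∀ k b, b.IsHomogeneous n → motive (X k * b)) : motive a := by
  have h : a = ((n : ℝ) + 1)⁻¹ • ∑ k, X k * pderiv k a := by
    rw [ha.sum_X_mul_pderiv, ← Nat.cast_smul_eq_nsmul ℝ, smul_smul]
    push_cast
    rw [inv_mul_cancel₀ (by positivity), one_smul]
  rw [h]
  exact sum _ fun k => mul k _ ha.pderiv

/-- The product formula for Wick polynomials. -/
theorem wick_mul_wick {n : ℕ} {a : MvPolynomial ι ℝ} (ha : a.IsHomogeneous n)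
    (b : MvPolynomial ι ℝ) :
    wick a * wick b =
      ∑ r ∈ Finset.range (n + 1), (r.factorial : ℝ)⁻¹ • wick (polyContraction r a b) := by
  induction n generalizing a b with
  | zero =>
    obtain ⟨c, rfl⟩ : ∃ c, a = C c := ⟨_, (totalDegree_eq_zero_iff_eq_C.1
      (by simpa using ha.totalDegree_le))⟩
    rw [wick_C]
    simp [polyContraction, ← smul_eq_C_mul]
  | succ n ih =>
    refine IsHomogeneous_induction (motive := fun a => wick a * wick b = ∑ r ∈ Finset.range (n + 1 + 1),
      (r.factorial : ℝ)⁻¹ • wick (polyContraction r a b)) ha (fun f hf => ?_) fun k a ha => ?_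
    · simp only [map_smul, map_sum, smul_mul_assoc, Finset.sum_mul, hf, polyContraction_smul,
        polyContraction_sum, Finset.smul_sum]
      rw [Finset.sum_comm]
      refine Finset.sum_congr rfl fun r _ => Finset.sum_congr rfl fun l _ => smul_comm _ _ _
    -- The creation operator applied to the whole product also differentiates `wick b`; the last
    -- term compensates for this. The induction hypothesis then applies to the pairs (a, b) and (a,
    -- ∂_k b).
    · have h1 : wick (X k * a) * wick b = X k * (wick a * wick b) - pderiv k (wick a * wick b) +
          wick a * wick (pderiv k b) := by
        rw [wick_X_mul, pderiv_mul, ← pderiv_wick k b]; ring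
      rw [h1, ih ha b, ih ha, map_sum, Finset.mul_sum, ← Finset.sum_sub_distrib]
      simp only [Derivation.map_smul, mul_smul_comm, ← smul_sub, ← wick_X_mul]
      rw [Finset.sum_range_succ' _ (n + 1)]
      simp only [polyContraction_X_mul, map_add, smul_add, Finset.sum_add_distrib, map_smul]
      -- The shift of the index produces an extra term with r = n + 1, which is zero because `a` has
      -- degree n only.
      have h2 : ∑ r ∈ Finset.range (n + 1), ((r + 1).factorial : ℝ)⁻¹ •
          wick (X k * polyContraction (r + 1) a b) +
          ((0 : ℕ).factorial : ℝ)⁻¹ • wick (polyContraction 0 (X k * a) b) =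
          ∑ r ∈ Finset.range (n + 1), (r.factorial : ℝ)⁻¹ •
            wick (X k * polyContraction r a b) := by
        have h3 : polyContraction 0 (X k * a) b = X k * polyContraction 0 a b := mul_assoc _ _ _
        rw [h3, ← Finset.sum_range_succ' (fun r => (r.factorial : ℝ)⁻¹ •
          wick (X k * polyContraction r a b)), Finset.sum_range_succ,
          polyContraction_eq_zero b ha (Nat.lt_succ_self n)]
        simp
      rw [← h2]
      have h4 : ∀ r : ℕ, ((r + 1).factorial : ℝ)⁻¹ • ((r : ℝ) + 1) •
          wick (polyContraction r a (pderiv k b)) =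
          (r.factorial : ℝ)⁻¹ • wick (polyContraction r a (pderiv k b)) := by
        intro r
        rw [smul_smul, Nat.factorial_succ]
        congr 1
        push_cast
        field_simp
      simp only [h4]
      abel

theorem polyContraction_eq_sum (r : ℕ) (a b : MvPolynomial ι ℝ) :
    polyContraction r a b =
      ∑ i : Fin r → ι, pderivList (List.ofFn i) a * pderivList (List.ofFn i) b := by
  induction r generalizing a b with
  | zero => simp [polyContraction, pderivList_nil]
  | succ r ih =>
    rw [polyContraction, ← (Fin.consEquiv fun _ => ι).sum_comp, Fintype.sum_prod_type]
    refine Finset.sum_congr rfl fun k _ => ?_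
    rw [ih]
    refine Finset.sum_congr rfl fun i _ => ?_
    simp [Fin.consEquiv, List.ofFn_succ, pderivList_cons]

/-- Taylor's formula for homogeneous polynomials. -/
theorem IsHomogeneous_eq_sum {n : ℕ} {a : MvPolynomial ι ℝ} (ha : a.IsHomogeneous n) :
    a = (n.factorial : ℝ)⁻¹ • ∑ j : Fin n → ι,
      constantCoeff (pderivList (List.ofFn j) a) • ∏ l, X (j l) := by
  induction n generalizing a with
  | zero =>
    obtain ⟨c, rfl⟩ : ∃ c, a = C c := ⟨_, (totalDegree_eq_zero_iff_eq_C.1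
      (by simpa using ha.totalDegree_le))⟩
    simp [pderivList_nil, smul_eq_C_mul]
  | succ n ih =>
    have h : a = ((n : ℝ) + 1)⁻¹ • ∑ k, X k * pderiv k a := by
      rw [ha.sum_X_mul_pderiv, ← Nat.cast_smul_eq_nsmul ℝ, smul_smul]
      push_cast
      rw [inv_mul_cancel₀ (by positivity), one_smul]
    conv_lhs => rw [h]
    rw [← (Fin.consEquiv fun _ => ι).sum_comp, Fintype.sum_prod_type, Nat.factorial_succ]
    push_cast
    rw [mul_inv, ← smul_smul, Finset.smul_sum (r := ((n.factorial : ℝ)⁻¹))]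
    congr 1
    refine Finset.sum_congr rfl fun k _ => ?_
    conv_lhs => rw [ih (ha.pderiv (i := k))]
    rw [mul_smul_comm, Finset.mul_sum]
    congr 1
    refine Finset.sum_congr rfl fun j _ => ?_
    simp [Fin.consEquiv, List.ofFn_succ, pderivList_cons, Fin.prod_univ_succ]

/-- The factors other than `p` are listed through `swap 0 p ∘ succ` so as to agree with the
decomposition of permutations in `Equiv.Perm.decomposeFin`. -/
theorem pderiv_prod_X [DecidableEq ι] {n : ℕ} (k : ι) (l : Fin (n + 1) → ι) :
    pderiv k (∏ m, X (l m) : MvPolynomial ι ℝ) =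
      ∑ p : Fin (n + 1), (if k = l p then (1 : ℝ) else 0) •
        ∏ m : Fin n, X (l (Equiv.swap 0 p m.succ)) := by
  rw [pderiv_prod]
  refine Finset.sum_congr rfl fun p _ => ?_
  have h : ∏ m ∈ Finset.univ.erase p, (X (l m) : MvPolynomial ι ℝ) =
      ∏ m : Fin n, X (l (Equiv.swap 0 p m.succ)) := by
    have h0 : Finset.univ.erase p =
        (Finset.univ.image Fin.succ).map (Equiv.swap (0 : Fin (n + 1)) p).toEmbedding := by
      ext m
      obtain ⟨m, rfl⟩ := (Equiv.swap (0 : Fin (n + 1)) p).surjective m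
      rw [Finset.mem_map_equiv, Equiv.symm_apply_apply]
      simp only [Finset.mem_erase, Finset.mem_univ, and_true, Finset.mem_image, true_and]
      rw [Fin.exists_succ_eq, ne_eq, ne_eq, not_iff_not]
      conv_lhs => rw [← Equiv.swap_apply_left 0 p]
      exact (Equiv.injective _).eq_iff
    rw [h0, Finset.prod_map, Finset.prod_image (fun _ _ _ _ h => Fin.succ_injective _ h)]
    rfl
  rw [h, pderiv_X, Pi.single_apply]
  by_cases h : k = l p
  · simp [h]
  · simp [h, Ne.symm h]

/-- Each derivative must consume one factor, so what survives counts the bijections matching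
derivatives with factors. The first derivative chooses the image of 0, and induction handles the
rest. -/
theorem coeff_zero_pderivList_prod_X [DecidableEq ι] {n : ℕ} (i l : Fin n → ι) :
    constantCoeff (pderivList (List.ofFn i) (∏ m, X (l m))) =
      ∑ σ : Equiv.Perm (Fin n), if (∀ m, i m = l (σ m)) then (1 : ℝ) else 0 := by
  induction n with
  | zero => simp [pderivList_nil]
  | succ n ih =>
    rw [← Equiv.Perm.decomposeFin.symm.sum_comp, Fintype.sum_prod_type, List.ofFn_succ,
      pderivList_cons, pderiv_prod_X]
    change constantCoeff (pderivListₗ _ _) = _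
    simp only [map_sum, map_smul]
    refine Finset.sum_congr rfl fun p _ => ?_
    have := ih (fun m => i m.succ) (fun m => l (Equiv.swap 0 p m.succ))
    change constantCoeff (pderivListₗ _ _) = _ at this
    rw [smul_eq_C_mul, map_mul, constantCoeff_C, this, Finset.mul_sum]
    refine Finset.sum_congr rfl fun σ _ => ?_
    simp only [Fin.forall_fin_succ, Equiv.Perm.decomposeFin_symm_apply_zero,
      Equiv.Perm.decomposeFin_symm_apply_succ, ite_and]
    split_ifs <;> simp

end Wick

/-! ### Gaussian integration by parts -/

section Gaussian

theorem integrable_gaussianReal_iff {f : ℝ → ℝ} :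
    Integrable f (gaussianReal 0 1) ↔ Integrable fun x => gaussianPDFReal 0 1 x * f x := by
  rw [gaussianReal_of_var_ne_zero _ one_ne_zero, integrable_withDensity_iff_integrable_smul'
    (measurable_gaussianPDF 0 1) (ae_of_all _ fun _ => gaussianPDF_lt_top)]
  simp [toReal_gaussianPDF]

theorem hasDerivAt_gaussianPDFReal (x : ℝ) :
    HasDerivAt (gaussianPDFReal 0 1) (-x * gaussianPDFReal 0 1 x) x := by
  have h : gaussianPDFReal 0 1 =
      fun x => (√(2 * Real.pi))⁻¹ * Real.exp (-x ^ 2 / 2) := by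
    ext x; simp [gaussianPDFReal]
  rw [h]
  have := (((hasDerivAt_id x).pow 2).neg.div_const 2).exp.const_mul (√(2 * Real.pi))⁻¹
  refine this.congr_deriv ?_
  simp only [id, Nat.cast_ofNat, Nat.add_one_sub_one, pow_one, mul_one, Pi.neg_apply, Pi.pow_apply]
  ring

/-- Gaussian integration by parts on the line. -/
theorem integral_mul_gaussianReal {v v' : ℝ → ℝ} (hv : ∀ x, HasDerivAt v (v' x) x)
    (h0 : Integrable v (gaussianReal 0 1)) (h1 : Integrable (fun x => x * v x) (gaussianReal 0 1))
    (h2 : Integrable v' (gaussianReal 0 1)) :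
    ∫ x, x * v x ∂gaussianReal 0 1 = ∫ x, v' x ∂gaussianReal 0 1 := by
  rw [integrable_gaussianReal_iff] at h0 h1 h2
  rw [integral_gaussianReal_eq_integral_smul one_ne_zero,
    integral_gaussianReal_eq_integral_smul one_ne_zero]
  have := integral_mul_deriv_eq_deriv_mul_of_integrable (u := gaussianPDFReal 0 1) (v := v)
    (u' := fun x => -x * gaussianPDFReal 0 1 x) (v' := v')
    (fun x _ => hasDerivAt_gaussianPDFReal x) (fun x _ => hv x) h2
    (by refine h1.neg.congr (ae_of_all _ fun x => ?_); simp; ring) h0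
  simp only [smul_eq_mul]
  rw [this, ← integral_neg]
  congr 1
  ext x
  ring

variable {ι : Type*} [Fintype ι]

/-- The standard Gaussian measure on `ℝ^ι`. -/
abbrev stdGaussianPi (ι : Type*) [Fintype ι] : Measure (ι → ℝ) :=
  Measure.pi fun _ => gaussianReal 0 1

/-- Resampling one coordinate does not change the product law. Fubini can then isolate coordinate
`i` without splitting the index type. -/
theorem map_update_stdGaussianPi [DecidableEq ι] (i : ι) :
    MeasurePreserving (fun p : (ι → ℝ) × ℝ => Function.update p.1 i p.2)
      ((stdGaussianPi ι).prod (gaussianReal 0 1)) (stdGaussianPi ι) := by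
  have hm : Measurable fun p : (ι → ℝ) × ℝ => Function.update p.1 i p.2 := by
    refine measurable_pi_lambda _ fun j => ?_
    by_cases h : j = i
    · subst h; simpa using measurable_snd
    · simp only [Function.update_of_ne h]; fun_prop
  refine ⟨hm, (Measure.pi_eq fun s hs => ?_).symm⟩
  rw [Measure.map_apply hm (MeasurableSet.univ_pi hs)]
  have h : (fun p : (ι → ℝ) × ℝ => Function.update p.1 i p.2) ⁻¹' Set.univ.pi s =
      (Set.univ.pi (Function.update s i Set.univ)) ×ˢ s i := by
    ext ⟨x, t⟩
    simp only [Set.mem_preimage, Set.mem_univ_pi, Set.mem_prod]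
    constructor
    · intro hx
      refine ⟨fun j => ?_, by simpa using hx i⟩
      by_cases hj : j = i
      · subst hj; simp
      · simpa [Function.update_of_ne hj] using hx j
    · rintro ⟨hx, ht⟩ j
      by_cases hj : j = i
      · subst hj; simpa using ht
      · simpa [Function.update_of_ne hj] using hx j
  rw [h, Measure.prod_prod, Measure.pi_pi, ← Finset.prod_erase_mul _ _ (Finset.mem_univ i),
    ← Finset.prod_erase_mul _ _ (Finset.mem_univ i)]
  simp only [Function.update_self, measure_univ, mul_one]
  congr 1
  refine Finset.prod_congr rfl fun j hj => ?_
  rw [Function.update_of_ne (Finset.ne_of_mem_erase hj)]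

/-- Gaussian integration by parts in one coordinate. -/
theorem integral_mul_stdGaussianPi [DecidableEq ι] (i : ι) {V V' : (ι → ℝ) → ℝ}
    (hV : ∀ x t, HasDerivAt (fun t => V (Function.update x i t)) (V' (Function.update x i t)) t)
    (h0 : Integrable V (stdGaussianPi ι)) (h1 : Integrable (fun x => x i * V x) (stdGaussianPi ι))
    (h2 : Integrable V' (stdGaussianPi ι)) :
    ∫ x, x i * V x ∂stdGaussianPi ι = ∫ x, V' x ∂stdGaussianPi ι := by
  have hp := map_update_stdGaussianPi i
  have k0 := hp.integrable_comp_of_integrable h0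
  have k1 := hp.integrable_comp_of_integrable h1
  have k2 := hp.integrable_comp_of_integrable h2
  have e1 := hp.map_eq ▸ integral_map hp.measurable.aemeasurable
    (by rw [hp.map_eq]; exact h1.aestronglyMeasurable)
  have e2 := hp.map_eq ▸ integral_map hp.measurable.aemeasurable
    (by rw [hp.map_eq]; exact h2.aestronglyMeasurable)
  rw [e1, e2]
  have f1 := integral_prod _ k1
  have f2 := integral_prod _ k2
  simp only [Function.comp_def] at f1 f2
  rw [f1, f2]
  refine integral_congr_ae ?_
  filter_upwards [k0.prod_right_ae, k1.prod_right_ae, k2.prod_right_ae] with x x0 x1 x2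
  simp only [Function.comp_def, Function.update_self] at x0 x1 x2 ⊢
  exact integral_mul_gaussianReal (hV x) x0 x1 x2

/-! ### Expectations of polynomials and orthogonality of the chaoses -/

open MvPolynomial

theorem measurable_eval (a : MvPolynomial ι ℝ) : Measurable fun x : ι → ℝ => eval x a :=
  (MvPolynomial.continuous_eval a).measurable

theorem holderTriple_two_mul (p : ℝ≥0∞) : ENNReal.HolderTriple (2 * p) (2 * p) p := by
  refine ⟨?_⟩
  rw [ENNReal.mul_inv (Or.inl (by simp)) (Or.inl (by simp)), ← add_mul,
    ENNReal.inv_two_add_inv_two, one_mul]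

/-- Hölder with both exponents equal to 2p: the induction on the polynomial must therefore cover all
finite exponents at once. -/
theorem memLp_eval (a : MvPolynomial ι ℝ) {p : ℝ≥0∞} (hp : p ≠ ∞) :
    MemLp (fun x => eval x a) p (stdGaussianPi ι) := by
  classical
  induction a using MvPolynomial.induction_on generalizing p with
  | C c => simpa using memLp_const c
  | add a b ha hb => simpa using! (ha hp).add (hb hp)
  | mul_X a i ha =>
    have h1 : MemLp (fun x : ι → ℝ => x i) (2 * p) (stdGaussianPi ι) :=
      (memLp_id_gaussianReal' _ (ENNReal.mul_ne_top (by simp) hp)).comp_measurePreserving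
        (measurePreserving_eval (fun _ : ι => gaussianReal 0 1) i)
    have := holderTriple_two_mul p
    simpa using! h1.mul (ha (p := 2 * p) (ENNReal.mul_ne_top (by simp) hp))

theorem integrable_eval (a : MvPolynomial ι ℝ) :
    Integrable (fun x => eval x a) (stdGaussianPi ι) :=
  memLp_one_iff_integrable.1 (memLp_eval a (by simp))

theorem integrable_eval_mul (a : MvPolynomial ι ℝ) {f : (ι → ℝ) → ℝ}
    (hf : MemLp f 2 (stdGaussianPi ι)) :
    Integrable (fun x => eval x a * f x) (stdGaussianPi ι) :=
  (memLp_eval a (p := 2) (by simp)).integrable_mul hf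

theorem hasDerivAt_eval_update [DecidableEq ι] (i : ι) (a : MvPolynomial ι ℝ) (x : ι → ℝ)
    (t : ℝ) : HasDerivAt (fun t => eval (Function.update x i t) a)
      (eval (Function.update x i t) (pderiv i a)) t := by
  induction a using MvPolynomial.induction_on with
  | C c => simpa using hasDerivAt_const t c
  | add a b ha hb => simpa using! ha.add hb
  | mul_X a j ha =>
    have h1 : HasDerivAt (fun t => Function.update x i t j)
        (eval (Function.update x i t) (pderiv i (X j : MvPolynomial ι ℝ))) t := by
      by_cases h : j = i
      · subst h; simpa using hasDerivAt_id' t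
      · simpa [Function.update_of_ne h, pderiv_X_of_ne h] using hasDerivAt_const t (x j)
    simp only [map_mul, eval_X, pderiv_mul, map_add]
    exact ha.mul h1

/-- Integration by parts for a polynomial times a function of a polynomial. -/
theorem integral_X_mul_comp [DecidableEq ι] (i : ι) (u F : MvPolynomial ι ℝ) {g g' : ℝ → ℝ}
    (hg : ∀ x, HasDerivAt g (g' x) x)
    (h0 : MemLp (fun x => g (eval x F)) 2 (stdGaussianPi ι))
    (h1 : MemLp (fun x => g' (eval x F)) 2 (stdGaussianPi ι)) :
    ∫ x, eval x (X i * u) * g (eval x F) ∂stdGaussianPi ι =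
      ∫ x, eval x (pderiv i u) * g (eval x F) ∂stdGaussianPi ι +
        ∫ x, eval x (u * pderiv i F) * g' (eval x F) ∂stdGaussianPi ι := by
  have := integral_mul_stdGaussianPi i (V := fun x => eval x u * g (eval x F))
    (V' := fun x => eval x (pderiv i u) * g (eval x F) + eval x (u * pderiv i F) * g' (eval x F))
    (fun x t => by
      have h := (hasDerivAt_eval_update i u x t).mul
        ((hg _).comp t (hasDerivAt_eval_update i F x t))
      refine h.congr_deriv ?_
      simp only [map_mul, Function.comp_apply]
      ring)
    (integrable_eval_mul u h0)
    ((integrable_eval_mul (X i * u) h0).congr (ae_of_all _ fun x => by simp [mul_assoc]))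
    ((integrable_eval_mul _ h0).add (integrable_eval_mul _ h1))
  rw [← integral_add (integrable_eval_mul _ h0) (integrable_eval_mul _ h1), ← this]
  simp [mul_assoc]

/-- The Gaussian expectation of a polynomial. -/
def gaussianExpect : MvPolynomial ι ℝ →ₗ[ℝ] ℝ where
  toFun a := ∫ x, eval x a ∂stdGaussianPi ι
  map_add' a b := by
    simp only [map_add]
    exact integral_add (integrable_eval a) (integrable_eval b)
  map_smul' c a := by
    simp only [smul_eval, RingHom.id_apply, smul_eq_mul]
    exact integral_const_mul _ _

theorem gaussianExpect_apply (a : MvPolynomial ι ℝ) :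
    gaussianExpect a = ∫ x, eval x a ∂stdGaussianPi ι := rfl

theorem gaussianExpect_C (c : ℝ) : gaussianExpect (C c : MvPolynomial ι ℝ) = c := by
  simp [gaussianExpect_apply]

theorem gaussianExpect_X_mul (i : ι) (a : MvPolynomial ι ℝ) :
    gaussianExpect (X i * a) = gaussianExpect (pderiv i a) := by
  classical
  have := integral_X_mul_comp i a 0 (g := fun _ => 1) (g' := fun _ => 0)
    (fun x => hasDerivAt_const x 1) (memLp_const _) (memLp_const _)
  simpa [gaussianExpect_apply] using this

/-- The creation operator `X i - ∂_i` is the adjoint of `∂_i` for the Gaussian measure. -/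
theorem gaussianExpect_wick_X_mul (i : ι) (a b : MvPolynomial ι ℝ) :
    gaussianExpect (wick (X i * a) * b) = gaussianExpect (wick a * pderiv i b) := by
  have h : wick (X i * a) * b = X i * (wick a * b) - pderiv i (wick a) * b := by
    rw [wick_X_mul]; ring
  rw [h, map_sub, gaussianExpect_X_mul, pderiv_mul, map_add]
  ring

theorem eq_C_of_isHomogeneous_zero {a : MvPolynomial ι ℝ} (ha : a.IsHomogeneous 0) :
    a = C (constantCoeff a) := by
  obtain ⟨c, rfl⟩ : ∃ c, a = C c := ⟨_, (totalDegree_eq_zero_iff_eq_C.1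
    (by simpa using ha.totalDegree_le))⟩
  simp

theorem gaussianExpect_wick_of_isHomogeneous_zero {a : MvPolynomial ι ℝ}
    (ha : a.IsHomogeneous 0) : gaussianExpect (wick a) = constantCoeff a := by
  rw [eq_C_of_isHomogeneous_zero ha, wick_C, gaussianExpect_C, constantCoeff_C]

theorem gaussianExpect_wick_eq_zero {n : ℕ} (hn : n ≠ 0) {a : MvPolynomial ι ℝ}
    (ha : a.IsHomogeneous n) : gaussianExpect (wick a) = 0 := by
  obtain ⟨n, rfl⟩ := Nat.exists_eq_succ_of_ne_zero hn
  refine IsHomogeneous_induction (motive := fun a => gaussianExpect (wick a) = 0) ha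
    (fun f hf => ?_) fun k b _ => ?_
  · simp [hf]
  · simpa using gaussianExpect_wick_X_mul k b 1

/-- If n < m, at most n derivatives are contracted, so every term of the product formula has
positive degree and is centred. -/
theorem gaussianExpect_wick_mul_wick_of_ne {n m : ℕ} (hnm : n ≠ m) {a b : MvPolynomial ι ℝ}
    (ha : a.IsHomogeneous n) (hb : b.IsHomogeneous m) :
    gaussianExpect (wick a * wick b) = 0 := by
  wlog h : n < m generalizing n m a b
  · rw [mul_comm]
    exact this hnm.symm hb ha (by omega)
  rw [wick_mul_wick ha, map_sum]
  refine Finset.sum_eq_zero fun r hr => ?_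
  have hr' := Finset.mem_range.1 hr
  rw [map_smul, gaussianExpect_wick_eq_zero _
    (isHomogeneous_polyContraction ha hb (by omega) (by omega)), smul_zero]
  omega

/-- Only the full contraction r = n in the product formula has degree zero. -/
theorem gaussianExpect_wick_mul_wick {n : ℕ} {a b : MvPolynomial ι ℝ}
    (ha : a.IsHomogeneous n) (hb : b.IsHomogeneous n) :
    gaussianExpect (wick a * wick b) =
      (n.factorial : ℝ)⁻¹ * constantCoeff (polyContraction n a b) := by
  rw [wick_mul_wick ha, map_sum, Finset.sum_range_succ, Finset.sum_eq_zero, zero_add, map_smul,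
    gaussianExpect_wick_of_isHomogeneous_zero, smul_eq_mul]
  · simpa using isHomogeneous_polyContraction ha hb le_rfl le_rfl
  · intro r hr
    have hr' := Finset.mem_range.1 hr
    rw [map_smul, gaussianExpect_wick_eq_zero _
      (isHomogeneous_polyContraction ha hb (by omega) (by omega)), smul_zero]
    omega

/-- The term of degree `2 d - 2 r` in the chaos decomposition of the square of `wick a`. -/
def chaosTerm (a : MvPolynomial ι ℝ) (r : ℕ) : MvPolynomial ι ℝ :=
  (r.factorial : ℝ)⁻¹ • polyContraction r a a

/-- The carré du champ `‖D F‖²` of `F = wick a`. -/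
def carreDuChamp (a : MvPolynomial ι ℝ) : MvPolynomial ι ℝ :=
  ∑ k, pderiv k (wick a) * pderiv k (wick a)

/-! ### Chaos decompositions of F² and |∇F|², and the fourth moment -/

theorem wick_sq {d : ℕ} {a : MvPolynomial ι ℝ} (ha : a.IsHomogeneous d) :
    wick a * wick a = ∑ r ∈ Finset.range (d + 1), wick (chaosTerm a r) := by
  rw [wick_mul_wick ha]
  simp [chaosTerm]

/-- The product formula for the squares of the first derivatives gives, after summation over the
variable, contractions of order r + 1 with coefficient 1/r! instead of 1/(r+1)!. The quotient is the
weight r + 1. -/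
theorem carreDuChamp_eq {d : ℕ} {a : MvPolynomial ι ℝ} (ha : a.IsHomogeneous d) :
    carreDuChamp a = ∑ r ∈ Finset.range (d + 1), (r : ℝ) • wick (chaosTerm a r) := by
  rcases d with _ | d
  · rw [eq_C_of_isHomogeneous_zero ha]
    simp [carreDuChamp, wick_C]
  have h : ∀ r : ℕ, ((r + 1 : ℕ) : ℝ) • wick (chaosTerm a (r + 1)) =
      ∑ k, (r.factorial : ℝ)⁻¹ • wick (polyContraction r (pderiv k a) (pderiv k a)) := by
    intro r
    rw [chaosTerm, map_smul, smul_smul, polyContraction_succ, map_sum, ← Finset.smul_sum,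
      Nat.factorial_succ]
    congr 1
    push_cast
    field_simp
  rw [Finset.sum_range_succ' _ (d + 1)]
  simp only [h, carreDuChamp, pderiv_wick]
  rw [Finset.sum_comm, Nat.cast_zero, zero_smul, add_zero]
  exact Finset.sum_congr rfl fun k _ => wick_mul_wick (ha.pderiv (i := k)) (pderiv k a)

theorem isHomogeneous_chaosTerm {d r : ℕ} (hr : r ≤ d) {a : MvPolynomial ι ℝ}
    (ha : a.IsHomogeneous d) : (chaosTerm a r).IsHomogeneous ((d - r) + (d - r)) :=
  (homogeneousSubmodule ι ℝ _).smul_mem _ (isHomogeneous_polyContraction ha ha hr hr)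

/-- Euler's identity carried through `wick`: the d-th chaos is the eigenspace of the number operator
∑ (X_k - ∂_k) ∂_k for the eigenvalue d. -/
theorem wick_eq_sum {d : ℕ} {a : MvPolynomial ι ℝ} (ha : a.IsHomogeneous d) :
    (d : ℝ) • wick a = ∑ k, (X k * wick (pderiv k a) - pderiv k (wick (pderiv k a))) := by
  simp only [← wick_X_mul, ← map_sum]
  rw [ha.sum_X_mul_pderiv, ← Nat.cast_smul_eq_nsmul ℝ, map_smul]

/-- The integration by parts formula for elements of a fixed chaos. -/
theorem integral_wick_mul_comp {d : ℕ} {a : MvPolynomial ι ℝ} (ha : a.IsHomogeneous d)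
    {g g' : ℝ → ℝ} (hg : ∀ x, HasDerivAt g (g' x) x)
    (h0 : MemLp (fun x => g (eval x (wick a))) 2 (stdGaussianPi ι))
    (h1 : MemLp (fun x => g' (eval x (wick a))) 2 (stdGaussianPi ι)) :
    d * ∫ x, eval x (wick a) * g (eval x (wick a)) ∂stdGaussianPi ι =
      ∫ x, eval x (carreDuChamp a) * g' (eval x (wick a)) ∂stdGaussianPi ι := by
  classical
  have h2 : ∀ x, (d : ℝ) * (eval x (wick a) * g (eval x (wick a))) =
      ∑ k, (eval x (X k * wick (pderiv k a)) * g (eval x (wick a)) -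
        eval x (pderiv k (wick (pderiv k a))) * g (eval x (wick a))) := by
    intro x
    have := congrArg (fun p => eval x p * g (eval x (wick a))) (wick_eq_sum ha)
    simp only [smul_eval, map_sum, map_sub, Finset.sum_mul, sub_mul] at this
    rw [← this]; ring
  rw [← integral_const_mul]
  simp only [h2]
  rw [integral_finsetSum _ fun k _ => by
    exact (integrable_eval_mul _ h0).sub (integrable_eval_mul _ h0)]
  simp only [carreDuChamp, map_sum, Finset.sum_mul]
  rw [integral_finsetSum _ fun k _ => integrable_eval_mul _ h1]
  refine Finset.sum_congr rfl fun k _ => ?_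
  rw [integral_sub (integrable_eval_mul _ h0) (integrable_eval_mul _ h0),
    integral_X_mul_comp k _ _ hg h0 h1, add_sub_cancel_left, pderiv_wick]

/-- Integration by parts against g(x) = x³. -/
theorem gaussianExpect_wick_pow_four {d : ℕ} {a : MvPolynomial ι ℝ} (ha : a.IsHomogeneous d) :
    d * gaussianExpect (wick a ^ 4) = 3 * gaussianExpect (carreDuChamp a * (wick a * wick a)) := by
  have := integral_wick_mul_comp ha (g := fun x => x ^ 3) (g' := fun x => 3 * x ^ 2)
    (fun x => by simpa using hasDerivAt_pow 3 x)
    (by simp only [← map_pow]; exact memLp_eval _ (by simp))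
    (by simp only [← map_pow]; exact (memLp_eval _ (by simp)).const_mul 3)
  simp only [gaussianExpect_apply, map_pow, map_mul]
  rw [← integral_const_mul 3]
  have e1 : ∀ x : ι → ℝ, eval x (wick a) ^ 4 = eval x (wick a) * eval x (wick a) ^ 3 :=
    fun x => by ring
  have e2 : ∀ x : ι → ℝ, 3 * (eval x (carreDuChamp a) * (eval x (wick a) * eval x (wick a))) =
      eval x (carreDuChamp a) * (3 * eval x (wick a) ^ 2) := fun x => by ring
  simp only [e1, e2]
  exact this

theorem gaussianExpect_sum_mul_sum {d : ℕ} {a : MvPolynomial ι ℝ} (ha : a.IsHomogeneous d)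
    {s : Finset ℕ} (hs : ∀ r ∈ s, r ≤ d) (c c' : ℕ → ℝ) :
    gaussianExpect ((∑ r ∈ s, c r • wick (chaosTerm a r)) *
        ∑ r ∈ s, c' r • wick (chaosTerm a r)) =
      ∑ r ∈ s, c r * c' r * gaussianExpect (wick (chaosTerm a r) * wick (chaosTerm a r)) := by
  rw [Finset.sum_mul_sum, map_sum]
  refine Finset.sum_congr rfl fun r hr => ?_
  rw [map_sum, Finset.sum_eq_single_of_mem r hr]
  · rw [smul_mul_smul_comm, map_smul, smul_eq_mul]
  · intro l hl hlr
    rw [smul_mul_smul_comm, map_smul, gaussianExpect_wick_mul_wick_of_ne _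
      (isHomogeneous_chaosTerm (hs r hr) ha) (isHomogeneous_chaosTerm (hs l hl) ha), smul_zero]
    have := hs r hr
    have := hs l hl
    omega

/-- The squared norm of a chaos term. -/
def chaosNorm (a : MvPolynomial ι ℝ) (r : ℕ) : ℝ :=
  gaussianExpect (wick (chaosTerm a r) * wick (chaosTerm a r))

theorem wick_chaosTerm_self {d : ℕ} {a : MvPolynomial ι ℝ} (ha : a.IsHomogeneous d) :
    wick (chaosTerm a d) = C (gaussianExpect (wick a * wick a)) := by
  have h := isHomogeneous_chaosTerm le_rfl ha
  rw [Nat.sub_self] at h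
  rw [eq_C_of_isHomogeneous_zero h, wick_C, gaussianExpect_wick_mul_wick ha ha]
  simp [chaosTerm]

theorem chaosNorm_self {d : ℕ} {a : MvPolynomial ι ℝ} (ha : a.IsHomogeneous d) :
    chaosNorm a d = gaussianExpect (wick a * wick a) ^ 2 := by
  rw [chaosNorm, wick_chaosTerm_self ha, ← C_mul, gaussianExpect_C, sq]

theorem chaosNorm_nonneg (a : MvPolynomial ι ℝ) (r : ℕ) : 0 ≤ chaosNorm a r := by
  rw [chaosNorm, gaussianExpect_apply]
  refine integral_nonneg fun x => ?_
  rw [map_mul]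
  exact mul_self_nonneg _

theorem gaussianExpect_pow_four_eq {d : ℕ} {a : MvPolynomial ι ℝ} (ha : a.IsHomogeneous d) :
    gaussianExpect (wick a ^ 4) = ∑ r ∈ Finset.range (d + 1), chaosNorm a r := by
  have h := gaussianExpect_sum_mul_sum ha (s := Finset.range (d + 1))
    (fun r hr => by simpa [Nat.lt_succ_iff] using hr) (fun _ => 1) (fun _ => 1)
  simp only [one_smul, ← wick_sq ha, one_mul] at h
  rw [show wick a ^ 4 = wick a * wick a * (wick a * wick a) by ring, h]
  rfl

theorem sum_range_succ_eq_Icc (d : ℕ) (hd : 1 ≤ d) (f : ℕ → ℝ) (h0 : f 0 = 0) :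
    ∑ r ∈ Finset.range (d + 1), f r = ∑ r ∈ Finset.Icc 1 (d - 1), f r + f d := by
  obtain ⟨d, rfl⟩ : ∃ k, d = k + 1 := ⟨d - 1, by omega⟩
  rw [Finset.sum_range_succ, Finset.range_eq_Ico, Finset.sum_eq_sum_Ico_succ_bot (by omega), h0,
    zero_add]
  rfl

/-- Pairing |∇F|² = ∑ r W_r with F² = ∑ W_r by orthogonality gives d E[F⁴] = 3 ∑ r E[W_r²]. The term
r = d is exactly the Gaussian part 3 d E[F²]², which the subtraction removes. -/
theorem gaussianExpect_pow_four_sub {d : ℕ} (hd : 1 ≤ d) {a : MvPolynomial ι ℝ}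
    (ha : a.IsHomogeneous d) :
    d * (gaussianExpect (wick a ^ 4) - 3 * gaussianExpect (wick a * wick a) ^ 2) =
      3 * ∑ r ∈ Finset.Icc 1 (d - 1), r * chaosNorm a r := by
  have h := gaussianExpect_sum_mul_sum ha (s := Finset.range (d + 1))
    (fun r hr => by simpa [Nat.lt_succ_iff] using hr) (fun r => r) (fun _ => 1)
  simp only [one_smul, ← wick_sq ha, mul_one, ← carreDuChamp_eq ha] at h
  rw [mul_sub, gaussianExpect_wick_pow_four ha, h,
    sum_range_succ_eq_Icc d hd _ (by simp)]
  change 3 * (_ + d * chaosNorm a d) - _ = _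
  rw [chaosNorm_self ha]
  simp only [chaosNorm]
  ring

/-- In |∇F|²/d the term r = d is the constant E[F²]; the other terms are centred and orthogonal, so
Pythagoras applies. No unit variance is assumed, because partial sums of a normalized F need not be
normalized. -/
theorem gaussianExpect_one_sub_sq {d : ℕ} (hd : 1 ≤ d) {a : MvPolynomial ι ℝ}
    (ha : a.IsHomogeneous d) :
    gaussianExpect ((1 - (d : ℝ)⁻¹ • carreDuChamp a) * (1 - (d : ℝ)⁻¹ • carreDuChamp a)) =
      (1 - gaussianExpect (wick a * wick a)) ^ 2 +
        ∑ r ∈ Finset.Icc 1 (d - 1), ((r : ℝ) / d) ^ 2 * chaosNorm a r := by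
  have hd' : (d : ℝ) ≠ 0 := by positivity
  set v := gaussianExpect (wick a * wick a) with hv
  set S := ∑ r ∈ Finset.Icc 1 (d - 1), ((r : ℝ) / d) • wick (chaosTerm a r) with hS
  have h1 : 1 - (d : ℝ)⁻¹ • carreDuChamp a = C (1 - v) - S := by
    obtain ⟨k, rfl⟩ : ∃ k, d = k + 1 := ⟨d - 1, by omega⟩
    rw [carreDuChamp_eq ha, Finset.sum_range_succ, wick_chaosTerm_self ha, smul_add, smul_smul,
      inv_mul_cancel₀ hd', one_smul, Finset.range_eq_Ico,
      Finset.sum_eq_sum_Ico_succ_bot (by omega), Nat.cast_zero, zero_smul, zero_add,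
      Finset.smul_sum, C_sub, C_1, hS]
    simp only [smul_smul, div_eq_inv_mul]
    change _ - (∑ r ∈ Finset.Icc 1 (k + 1 - 1), _ + _) = _
    rw [← hv]
    abel
  have h2 : gaussianExpect (C (1 - v) * S) = 0 := by
    rw [← smul_eq_C_mul, map_smul, hS, map_sum, Finset.sum_eq_zero, smul_zero]
    intro r hr
    have := Finset.mem_Icc.1 hr
    rw [map_smul, gaussianExpect_wick_eq_zero _ (isHomogeneous_chaosTerm (by omega) ha), smul_zero]
    omega
  have h3 : gaussianExpect (S * S) =
      ∑ r ∈ Finset.Icc 1 (d - 1), ((r : ℝ) / d) ^ 2 * chaosNorm a r := by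
    rw [hS, gaussianExpect_sum_mul_sum ha fun r hr => by have := Finset.mem_Icc.1 hr; omega]
    simp only [sq, chaosNorm]
  have h4 : (C (1 - v) - S) * (C (1 - v) - S) =
      C ((1 - v) ^ 2) - C (1 - v) * S - C (1 - v) * S + S * S := by
    rw [C_pow]; ring
  rw [h1, h4, map_add, map_sub, map_sub, h2, h3, gaussianExpect_C]
  ring

/-- Term by term, r² ≤ (d - 1) r for r ≤ d - 1. This is the whole content of T₁ ≤ T₂. -/
theorem sum_chaosNorm_le {d : ℕ} (hd : 1 ≤ d) {a : MvPolynomial ι ℝ} (ha : a.IsHomogeneous d) :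
    ∑ r ∈ Finset.Icc 1 (d - 1), ((r : ℝ) / d) ^ 2 * chaosNorm a r ≤
      ((d : ℝ) - 1) / (3 * d) *
        (gaussianExpect (wick a ^ 4) - 3 * gaussianExpect (wick a * wick a) ^ 2) := by
  have hd' : (0 : ℝ) < d := by positivity
  have h1 : gaussianExpect (wick a ^ 4) - 3 * gaussianExpect (wick a * wick a) ^ 2 =
      3 / d * ∑ r ∈ Finset.Icc 1 (d - 1), r * chaosNorm a r := by
    rw [div_mul_eq_mul_div, ← gaussianExpect_pow_four_sub hd ha]
    field_simp
  rw [h1, ← mul_assoc, Finset.mul_sum]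
  refine Finset.sum_le_sum fun r hr => ?_
  have hr' := Finset.mem_Icc.1 hr
  have h2 : (r : ℝ) ≤ d - 1 := by
    have : r + 1 ≤ d := by omega
    have : ((r + 1 : ℕ) : ℝ) ≤ d := by exact_mod_cast this
    push_cast at this
    linarith
  rw [← mul_assoc]
  refine mul_le_mul_of_nonneg_right ?_ (chaosNorm_nonneg a r)
  have h3 : ((d : ℝ) - 1) / (3 * d) * (3 / d) * r = (d - 1) * r / d ^ 2 := by
    field_simp
  rw [h3, div_pow, div_le_div_iff_of_pos_right (by positivity), sq]
  exact mul_le_mul_of_nonneg_right h2 (by positivity)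

end Gaussian

/-! ### Boundedness of contractions and continuity of T₁ -/

section Tensor

variable {𝔥 : Type*} [NormedAddCommGroup 𝔥] [InnerProductSpace ℝ 𝔥] (e : HilbertBasis ℕ ℝ 𝔥)

theorem inner_basisTensor {n : ℕ} (j k : Fin n → ℕ) :
    inner ℝ (basisTensor e j) (basisTensor e k) = if j = k then (1 : ℝ) else 0 := by
  rw [basisTensor, basisTensor, inner_tprod]
  simp only [orthonormal_iff_ite.1 e.orthonormal]
  split_ifs with h
  · exact Finset.prod_eq_one fun i _ => by rw [h, if_pos rfl]
  · obtain ⟨i, hi⟩ := Function.ne_iff.1 h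
    exact Finset.prod_eq_zero (Finset.mem_univ i) (if_neg hi)

theorem orthonormal_basisTensor (n : ℕ) :
    Orthonormal ℝ (basisTensor e : (Fin n → ℕ) → TensorPower 𝔥 n) :=
  orthonormal_iff_ite.2 fun j k => inner_basisTensor e j k

theorem summable_coeff_sq {n : ℕ} (t : TensorPower 𝔥 n) : Summable fun j => coeff e t j ^ 2 := by
  simpa [coeff] using (orthonormal_basisTensor e n).inner_products_summable t

theorem tsum_coeff_sq_le {n : ℕ} (t : TensorPower 𝔥 n) : ∑' j, coeff e t j ^ 2 ≤ ‖t‖ ^ 2 := by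
  simpa [coeff] using (orthonormal_basisTensor e n).tsum_inner_products_le t

theorem concat_castLE {r p : ℕ} (hr : r ≤ p) (i : Fin r → ℕ) (j : Fin (p - r) → ℕ) (l : Fin r) :
    concat i j (Fin.castLE hr l) = i l := by
  have : Fin.castLE (le_add_tsub : p ≤ r + (p - r)) (Fin.castLE hr l) = Fin.castAdd (p - r) l :=
    rfl
  rw [concat, this, Fin.append_left]

theorem concat_natAdd {r p : ℕ} (hr : r ≤ p) (i : Fin r → ℕ) (j : Fin (p - r) → ℕ)
    (l : Fin (p - r)) :
    concat i j (Fin.cast (by omega) (Fin.natAdd r l) : Fin p) = j l := by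
  have : Fin.castLE (le_add_tsub : p ≤ r + (p - r))
      (Fin.cast (by omega) (Fin.natAdd r l) : Fin p) = Fin.natAdd r l := rfl
  rw [concat, this, Fin.append_right]

theorem concat_injective {r p : ℕ} (hr : r ≤ p) :
    Function.Injective fun x : (Fin (p - r) → ℕ) × (Fin r → ℕ) => (concat x.2 x.1 : Fin p → ℕ) := by
  rintro ⟨j, i⟩ ⟨j', i'⟩ h
  refine Prod.ext (funext fun l => ?_) (funext fun l => ?_)
  · have := congrFun h (Fin.cast (by omega) (Fin.natAdd r l))
    dsimp only at this
    rwa [concat_natAdd hr, concat_natAdd hr] at this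
  · simpa only [concat_castLE] using congrFun h (Fin.castLE hr l)

theorem summable_mul_of_sq {κ : Type*} {x y : κ → ℝ} (hx : Summable fun i => x i ^ 2)
    (hy : Summable fun i => y i ^ 2) : Summable fun i => x i * y i := by
  refine Summable.of_norm_bounded (hx.add hy) fun i => ?_
  rw [Real.norm_eq_abs, abs_le]
  constructor <;> nlinarith [sq_nonneg (x i + y i), sq_nonneg (x i - y i), sq_nonneg (x i),
    sq_nonneg (y i)]

theorem tsum_mul_sq_le {κ : Type*} {x y : κ → ℝ} (hx : Summable fun i => x i ^ 2)
    (hy : Summable fun i => y i ^ 2) :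
    (∑' i, x i * y i) ^ 2 ≤ (∑' i, x i ^ 2) * ∑' i, y i ^ 2 := by
  refine le_of_tendsto ((summable_mul_of_sq hx hy).hasSum.pow 2) (Eventually.of_forall fun s => ?_)
  refine (Finset.sum_mul_sq_le_sq_mul_sq s x y).trans ?_
  exact mul_le_mul (hx.sum_le_tsum s fun _ _ => sq_nonneg _)
    (hy.sum_le_tsum s fun _ _ => sq_nonneg _) (Finset.sum_nonneg fun _ _ => sq_nonneg _)
    (tsum_nonneg fun _ => sq_nonneg _)

variable {p q r : ℕ}

theorem summable_coeff_concat_prod (hp : r ≤ p) (f : TensorPower 𝔥 p) :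
    Summable fun x : (Fin (p - r) → ℕ) × (Fin r → ℕ) => coeff e f (concat x.2 x.1) ^ 2 :=
  (summable_coeff_sq e f).comp_injective (concat_injective hp)

theorem summable_coeff_concat (hp : r ≤ p) (f : TensorPower 𝔥 p) (j : Fin (p - r) → ℕ) :
    Summable fun i : Fin r → ℕ => coeff e f (concat i j) ^ 2 :=
  (summable_coeff_concat_prod e hp f).prod_factor j

/-- The squared norm of a slice of a tensor. -/
def sliceNorm (r : ℕ) (f : TensorPower 𝔥 p) (j : Fin (p - r) → ℕ) : ℝ :=
  ∑' i : Fin r → ℕ, coeff e f (concat i j) ^ 2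

theorem sliceNorm_nonneg (f : TensorPower 𝔥 p) (j : Fin (p - r) → ℕ) : 0 ≤ sliceNorm e r f j :=
  tsum_nonneg fun _ => sq_nonneg _

theorem summable_sliceNorm (hp : r ≤ p) (f : TensorPower 𝔥 p) : Summable (sliceNorm e r f) :=
  (summable_coeff_concat_prod e hp f).prod

theorem tsum_sliceNorm_le (hp : r ≤ p) (f : TensorPower 𝔥 p) : ∑' j, sliceNorm e r f j ≤ ‖f‖ ^ 2 := by
  refine le_trans (le_of_eq ?_) ((tsum_comp_le_tsum_of_inj (summable_coeff_sq e f)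
    (fun _ => sq_nonneg _) (concat_injective hp)).trans (tsum_coeff_sq_le e f))
  exact (summable_coeff_concat_prod e hp f).tsum_prod.symm

theorem summable_sliceNorm_mul (hp : r ≤ p) (hq : r ≤ q) (f : TensorPower 𝔥 p)
    (g : TensorPower 𝔥 q) :
    Summable fun jk : Fin ((p - r) + (q - r)) → ℕ =>
      sliceNorm e r f (fun l => jk (Fin.castAdd (q - r) l)) *
        sliceNorm e r g (fun l => jk (Fin.natAdd (p - r) l)) := by
  have h := (summable_sliceNorm e hp f).mul_of_nonneg (summable_sliceNorm e hq g)
    (sliceNorm_nonneg e f) (sliceNorm_nonneg e g)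
  exact (Fin.appendEquiv (α := ℕ) (p - r) (q - r)).symm.summable_iff.2 h

theorem tsum_sliceNorm_mul_le (hp : r ≤ p) (hq : r ≤ q) (f : TensorPower 𝔥 p)
    (g : TensorPower 𝔥 q) :
    ∑' jk : Fin ((p - r) + (q - r)) → ℕ,
      sliceNorm e r f (fun l => jk (Fin.castAdd (q - r) l)) *
        sliceNorm e r g (fun l => jk (Fin.natAdd (p - r) l)) ≤ ‖f‖ ^ 2 * ‖g‖ ^ 2 := by
  have h := (summable_sliceNorm e hp f).mul_of_nonneg (summable_sliceNorm e hq g)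
    (sliceNorm_nonneg e f) (sliceNorm_nonneg e g)
  have h1 := (Fin.appendEquiv (α := ℕ) (p - r) (q - r)).symm.tsum_eq
    fun x => sliceNorm e r f x.1 * sliceNorm e r g x.2
  refine (le_of_eq h1).trans ?_
  rw [← (summable_sliceNorm e hp f).tsum_mul_tsum (summable_sliceNorm e hq g) h]
  exact mul_le_mul (tsum_sliceNorm_le e hp f) (tsum_sliceNorm_le e hq g)
    (tsum_nonneg fun _ => sliceNorm_nonneg e g _) (sq_nonneg _)

/-- Cauchy-Schwarz in the contracted indices, with the free indices fixed. -/
theorem contractionKernel_sq_le (hp : r ≤ p) (hq : r ≤ q) (f : TensorPower 𝔥 p)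
    (g : TensorPower 𝔥 q) (jk : Fin ((p - r) + (q - r)) → ℕ) :
    contractionKernel e r f g jk ^ 2 ≤
      sliceNorm e r f (fun l => jk (Fin.castAdd (q - r) l)) *
        sliceNorm e r g (fun l => jk (Fin.natAdd (p - r) l)) :=
  tsum_mul_sq_le (summable_coeff_concat e hp f _) (summable_coeff_concat e hq g _)

theorem summable_contractionKernel_sq (hp : r ≤ p) (hq : r ≤ q) (f : TensorPower 𝔥 p)
    (g : TensorPower 𝔥 q) : Summable fun jk => contractionKernel e r f g jk ^ 2 :=
  Summable.of_nonneg_of_le (fun _ => sq_nonneg _) (contractionKernel_sq_le e hp hq f g)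
    (summable_sliceNorm_mul e hp hq f g)

theorem summable_contraction (hp : r ≤ p) (hq : r ≤ q) (f : TensorPower 𝔥 p)
    (g : TensorPower 𝔥 q) :
    Summable fun jk => contractionKernel e r f g jk • basisTensor e jk := by
  have h := ((orthonormal_basisTensor e ((p - r) + (q - r))).orthogonalFamily
    ).summable_iff_norm_sq_summable (contractionKernel e r f g)
  refine (h.2 ?_).congr fun jk => ?_
  · simpa using summable_contractionKernel_sq e hp hq f g
  · simp

/-- Summing the kernel bound over the free indices factorizes into two sums of slice norms, each at
most a squared norm by Bessel's inequality. -/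
theorem norm_contraction_le (hp : r ≤ p) (hq : r ≤ q) (f : TensorPower 𝔥 p)
    (g : TensorPower 𝔥 q) : ‖contraction e r f g‖ ≤ ‖f‖ * ‖g‖ := by
  refine le_of_sq_le_sq ?_ (by positivity)
  rw [mul_pow]
  refine le_of_tendsto ((summable_contraction e hp hq f g).hasSum.norm.pow 2)
    (Eventually.of_forall fun s => ?_)
  have h := (orthonormal_basisTensor e ((p - r) + (q - r))).inner_sum
    (contractionKernel e r f g) (contractionKernel e r f g) s
  rw [real_inner_self_eq_norm_sq] at h
  rw [h]
  refine le_trans ?_ (tsum_sliceNorm_mul_le e hp hq f g)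
  refine le_trans (Finset.sum_le_sum fun jk _ => ?_)
    ((summable_sliceNorm_mul e hp hq f g).sum_le_tsum s fun _ _ =>
      mul_nonneg (sliceNorm_nonneg e f _) (sliceNorm_nonneg e g _))
  rw [conj_trivial, ← sq]
  exact contractionKernel_sq_le e hp hq f g jk

theorem contraction_sub_left (hp : r ≤ p) (hq : r ≤ q) (f f' : TensorPower 𝔥 p)
    (g : TensorPower 𝔥 q) :
    contraction e r (f - f') g = contraction e r f g - contraction e r f' g := by
  rw [contraction, contraction, contraction,
    ← (summable_contraction e hp hq f g).tsum_sub (summable_contraction e hp hq f' g)]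
  refine tsum_congr fun jk => ?_
  rw [← sub_smul]
  congr 1
  simp only [contractionKernel]
  rw [← (summable_mul_of_sq (summable_coeff_concat e hp f _)
    (summable_coeff_concat e hq g _)).tsum_sub (summable_mul_of_sq
    (summable_coeff_concat e hp f' _) (summable_coeff_concat e hq g _))]
  refine tsum_congr fun i => ?_
  simp only [coeff, inner_sub_right]
  ring

theorem contraction_sub_right (hp : r ≤ p) (hq : r ≤ q) (f : TensorPower 𝔥 p)
    (g g' : TensorPower 𝔥 q) :
    contraction e r f (g - g') = contraction e r f g - contraction e r f g' := by
  rw [contraction, contraction, contraction,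
    ← (summable_contraction e hp hq f g).tsum_sub (summable_contraction e hp hq f g')]
  refine tsum_congr fun jk => ?_
  rw [← sub_smul]
  congr 1
  simp only [contractionKernel]
  rw [← (summable_mul_of_sq (summable_coeff_concat e hp f _)
    (summable_coeff_concat e hq g _)).tsum_sub (summable_mul_of_sq
    (summable_coeff_concat e hp f _) (summable_coeff_concat e hq g' _))]
  refine tsum_congr fun i => ?_
  simp only [coeff, inner_sub_right]
  ring

/-- A bounded bilinear map is continuous on the diagonal. -/
theorem continuous_contraction_self (hp : r ≤ p) :
    Continuous fun f : TensorPower 𝔥 p => contraction e r f f := by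
  rw [continuous_iff_continuousAt]
  intro f
  rw [ContinuousAt, tendsto_iff_norm_sub_tendsto_zero]
  have h1 : Tendsto (fun g : TensorPower 𝔥 p => ‖g - f‖ * ‖g‖ + ‖f‖ * ‖g - f‖) (𝓝 f) (𝓝 0) := by
    have h : Continuous fun g : TensorPower 𝔥 p => ‖g - f‖ * ‖g‖ + ‖f‖ * ‖g - f‖ := by fun_prop
    simpa using h.tendsto f
  refine squeeze_zero (fun _ => norm_nonneg _) (fun g => ?_) h1
  have h2 : contraction e r g g - contraction e r f f =
      contraction e r (g - f) g + contraction e r f (g - f) := by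
    rw [contraction_sub_left e hp hp, contraction_sub_right e hp hp]; abel
  rw [h2]
  exact (norm_add_le _ _).trans (add_le_add (norm_contraction_le e hp hp _ _)
    (norm_contraction_le e hp hp _ _))

/-- The symmetrization operator. -/
def symmetrizeL (n : ℕ) : TensorPower 𝔥 n →L[ℝ] TensorPower 𝔥 n :=
  (n.factorial : ℝ)⁻¹ • ∑ σ : Equiv.Perm (Fin n), permute σ

theorem symmetrizeL_apply {n : ℕ} (t : TensorPower 𝔥 n) : symmetrizeL n t = symmetrize t := by
  simp [symmetrizeL, symmetrize]

theorem continuous_T₁ (d : ℕ) : Continuous fun h : TensorPower 𝔥 d => T₁ e h := by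
  unfold T₁
  simp only [← symmetrizeL_apply]
  refine Real.continuous_sqrt.comp (continuous_const.mul ?_)
  refine continuous_finsetSum _ fun r hr => ?_
  have hr' := Finset.mem_Icc.1 hr
  have := continuous_contraction_self e (𝔥 := 𝔥) (r := r) (p := d) (by omega)
  fun_prop

end Tensor

/-! ### Dictionary between homogeneous polynomials and symmetric tensors -/

section PolyTensor

open MvPolynomial

variable {𝔥 : Type*} [NormedAddCommGroup 𝔥] [InnerProductSpace ℝ 𝔥] (e : HilbertBasis ℕ ℝ 𝔥)
  {ι : Type*} [Fintype ι] (v : ι → ℕ)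

/-- The symmetric tensor `(1 / n!) ∑ᵢ (∂_{i₁} ⋯ ∂_{iₙ} a)(0) e_{i₁} ⊗ ⋯ ⊗ e_{iₙ}` of a
polynomial. -/
def polyTensor (n : ℕ) : MvPolynomial ι ℝ →ₗ[ℝ] TensorPower 𝔥 n :=
  (n.factorial : ℝ)⁻¹ • ∑ i : Fin n → ι,
    (LinearMap.toSpanSingleton ℝ (TensorPower 𝔥 n) (basisTensor e fun l => v (i l))).comp
      ((lcoeff ℝ 0).comp (pderivListₗ (List.ofFn i)))

theorem polyTensor_apply (n : ℕ) (a : MvPolynomial ι ℝ) :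
    polyTensor e v n a = (n.factorial : ℝ)⁻¹ • ∑ i : Fin n → ι,
      constantCoeff (pderivList (List.ofFn i) a) • basisTensor e fun l => v (i l) := by
  simp only [polyTensor, LinearMap.smul_apply, LinearMap.sum_apply, LinearMap.comp_apply,
    LinearMap.toSpanSingleton_apply]
  rfl

theorem symmetrize_basisTensor {n : ℕ} (j : Fin n → ℕ) :
    symmetrize (basisTensor e j) =
      (n.factorial : ℝ)⁻¹ • ∑ σ : Equiv.Perm (Fin n), basisTensor e fun l => j (σ l) := by
  rw [symmetrize, ← Equiv.sum_comp (Equiv.inv (Equiv.Perm (Fin n)))]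
  congr 1
  refine Finset.sum_congr rfl fun σ _ => ?_
  rw [basisTensor, permute_tprod]
  rfl

/-- The full derivatives of a product of variables run over the permutations of its factors, and
1/n! turns that sum into a symmetrization. Hence the normalization of `polyTensor`. -/
theorem polyTensor_prod_X {n : ℕ} (l : Fin n → ι) :
    polyTensor e v n (∏ m, X (l m)) = symmetrize (basisTensor e fun m => v (l m)) := by
  classical
  rw [polyTensor_apply, symmetrize_basisTensor]
  congr 1
  simp only [coeff_zero_pderivList_prod_X, Finset.sum_smul, ite_smul, one_smul, zero_smul]
  rw [Finset.sum_comm]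
  refine Finset.sum_congr rfl fun σ _ => ?_
  rw [Finset.sum_eq_single (fun m => l (σ m))]
  · simp
  · intro i _ hi
    rw [if_neg]
    exact fun h => hi (funext h)
  · simp

variable {v}

theorem coeff_polyTensor_of_notMem {n : ℕ} (a : MvPolynomial ι ℝ) {j : Fin n → ℕ}
    (hj : ∀ i : Fin n → ι, (fun l => v (i l)) ≠ j) : coeff e (polyTensor e v n a) j = 0 := by
  rw [polyTensor_apply, coeff, inner_smul_right, inner_sum, Finset.sum_eq_zero, mul_zero]
  intro i _
  rw [inner_smul_right, inner_basisTensor, if_neg (hj i).symm, mul_zero]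

theorem comp_injective_of_injective (hv : Function.Injective v) (n : ℕ) :
    Function.Injective fun (i : Fin n → ι) (l : Fin n) => v (i l) :=
  fun _ _ h => funext fun l => hv (congrFun h l)

theorem coeff_polyTensor (hv : Function.Injective v) {n : ℕ} (a : MvPolynomial ι ℝ)
    (i : Fin n → ι) : coeff e (polyTensor e v n a) (fun l => v (i l)) =
      (n.factorial : ℝ)⁻¹ * constantCoeff (pderivList (List.ofFn i) a) := by
  rw [polyTensor_apply, coeff, inner_smul_right, inner_sum, Finset.sum_eq_single i]
  · rw [inner_smul_right, inner_basisTensor, if_pos rfl, mul_one]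
  · intro j _ hj
    rw [inner_smul_right, inner_basisTensor, if_neg, mul_zero]
    exact fun h => hj (comp_injective_of_injective hv n h).symm
  · simp

/-- The Wiener isometry: both sides equal 1/n! times the sum of squares of all n-th order
derivatives of `a` at 0. -/
theorem gaussianExpect_wick_sq (hv : Function.Injective v) {n : ℕ} {a : MvPolynomial ι ℝ}
    (ha : a.IsHomogeneous n) :
    gaussianExpect (wick a * wick a) = n.factorial * ‖polyTensor e v n a‖ ^ 2 := by
  have ho : Orthonormal ℝ fun i : Fin n → ι => basisTensor e fun l => v (i l) :=
    (orthonormal_basisTensor e n).comp _ (comp_injective_of_injective hv n)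
  have h := ho.inner_sum (fun i => constantCoeff (pderivList (List.ofFn i) a))
    (fun i => constantCoeff (pderivList (List.ofFn i) a)) Finset.univ
  rw [real_inner_self_eq_norm_sq] at h
  rw [gaussianExpect_wick_mul_wick ha ha, polyContraction_eq_sum, polyTensor_apply, norm_smul,
    mul_pow, h, map_sum, Real.norm_eq_abs, sq_abs]
  simp only [map_mul, conj_trivial]
  have : (n.factorial : ℝ) ≠ 0 := by positivity
  field_simp

/-- The concatenation of an `r`-tuple and a `(p - r)`-tuple, as a `p`-tuple. -/
def concatTuple {r p : ℕ} (i : Fin r → ι) (j : Fin (p - r) → ι) : Fin p → ι :=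
  fun l => Fin.append i j (Fin.castLE le_add_tsub l)

theorem concat_comp {r p : ℕ} (i : Fin r → ι) (j : Fin (p - r) → ι) :
    (concat (fun l => v (i l)) (fun l => v (j l)) : Fin p → ℕ) =
      fun l => v (concatTuple i j l) := by
  ext l
  simp only [concat, concatTuple]
  generalize (Fin.castLE le_add_tsub l : Fin (r + (p - r))) = m
  refine Fin.addCases (fun m => ?_) (fun m => ?_) m <;> simp

theorem ofFn_concatTuple {r p : ℕ} (hr : r ≤ p) (i : Fin r → ι) (j : Fin (p - r) → ι) :
    List.ofFn (concatTuple i j : Fin p → ι) = List.ofFn i ++ List.ofFn j := by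
  rw [← List.ofFn_fin_append, List.ofFn_congr (show r + (p - r) = p by omega)]
  rfl

/-- Derivatives along a concatenated tuple are iterated derivatives. The infinite sum is finite
because a nonzero coefficient forces all indices into the range of `v`. -/
theorem contractionKernel_polyTensor (hv : Function.Injective v) {d r : ℕ} (hr : r ≤ d)
    (a : MvPolynomial ι ℝ) (jk : Fin ((d - r) + (d - r)) → ι) :
    contractionKernel e r (polyTensor e v d a) (polyTensor e v d a) (fun l => v (jk l)) =
      ((d.factorial : ℝ)⁻¹) ^ 2 * ∑ i : Fin r → ι,
        constantCoeff (pderivList (List.ofFn fun l => jk (Fin.castAdd (d - r) l))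
          (pderivList (List.ofFn i) a)) *
        constantCoeff (pderivList (List.ofFn fun l => jk (Fin.natAdd (d - r) l))
          (pderivList (List.ofFn i) a)) := by
  rw [contractionKernel, ← (comp_injective_of_injective hv r).tsum_eq, tsum_fintype,
    Finset.mul_sum]
  · refine Finset.sum_congr rfl fun i _ => ?_
    rw [concat_comp, concat_comp i fun l => jk (Fin.natAdd (d - r) l), coeff_polyTensor e hv,
      coeff_polyTensor e hv, ofFn_concatTuple hr, ofFn_concatTuple hr, pderivList_append,
      pderivList_append]
    ring
  · intro i hi
    by_contra hni
    refine hi (mul_eq_zero_of_left (coeff_polyTensor_of_notMem e a fun m hm => hni ?_) _)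
    refine ⟨fun l => m (Fin.castLE hr l), funext fun l => ?_⟩
    rw [← concat_castLE hr i _ l, ← hm]

theorem contraction_polyTensor (hv : Function.Injective v) {d r : ℕ} (hr : r ≤ d)
    (a : MvPolynomial ι ℝ) :
    contraction e r (polyTensor e v d a) (polyTensor e v d a) =
      ∑ jk : Fin ((d - r) + (d - r)) → ι,
        contractionKernel e r (polyTensor e v d a) (polyTensor e v d a) (fun l => v (jk l)) •
          basisTensor e fun l => v (jk l) := by
  rw [contraction, ← (comp_injective_of_injective hv _).tsum_eq, tsum_fintype]
  intro jk hjk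
  by_contra hni
  have h0 : contractionKernel e r (polyTensor e v d a) (polyTensor e v d a) jk ≠ 0 :=
    fun h => hjk (by simp [h])
  have h1 : (∃ m : Fin (d - r) → ι, ∀ l, v (m l) = jk (Fin.castAdd (d - r) l)) ∧
      ∃ m : Fin (d - r) → ι, ∀ l, v (m l) = jk (Fin.natAdd (d - r) l) := by
    constructor
    · by_contra hm
      refine h0 ?_
      rw [contractionKernel, tsum_congr, tsum_zero]
      intro i
      refine mul_eq_zero_of_left (coeff_polyTensor_of_notMem e a fun m hm' => hm ?_) _
      refine ⟨fun l => m (Fin.cast (by omega) (Fin.natAdd r l)), fun l => ?_⟩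
      have := congrFun hm' (Fin.cast (by omega) (Fin.natAdd r l))
      rwa [concat_natAdd hr] at this
    · by_contra hm
      refine h0 ?_
      rw [contractionKernel, tsum_congr, tsum_zero]
      intro i
      refine mul_eq_zero_of_right _ (coeff_polyTensor_of_notMem e a fun m hm' => hm ?_)
      refine ⟨fun l => m (Fin.cast (by omega) (Fin.natAdd r l)), fun l => ?_⟩
      have := congrFun hm' (Fin.cast (by omega) (Fin.natAdd r l))
      rwa [concat_natAdd hr] at this
  obtain ⟨⟨m, hm⟩, m', hm'⟩ := h1
  refine hni ⟨Fin.append m m', funext fun l => ?_⟩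
  refine Fin.addCases (fun l => ?_) (fun l => ?_) l
  · simp only [Fin.append_left, hm]
  · simp only [Fin.append_right, hm']

/-- Each r-th derivative of `a` is expanded by Taylor's formula in degree d - r, and the square of
the expansion is indexed by concatenated tuples. Taylor contributes 1/(d-r)! twice; the kernel
carries 1/d! twice. -/
theorem polyContraction_self_eq (hv : Function.Injective v) {d r : ℕ} (hr : r ≤ d)
    {a : MvPolynomial ι ℝ} (ha : a.IsHomogeneous d) :
    polyContraction r a a = ((d.factorial : ℝ) / (d - r).factorial) ^ 2 •
      ∑ jk : Fin ((d - r) + (d - r)) → ι,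
        contractionKernel e r (polyTensor e v d a) (polyTensor e v d a) (fun l => v (jk l)) •
          ∏ l, X (jk l) := by
  have h1 : ∀ i : Fin r → ι, (pderivList (List.ofFn i) a).IsHomogeneous (d - r) := fun i => by
    simpa using isHomogeneous_pderivList (List.ofFn i) ha
  have h2 : ∀ i : Fin r → ι, pderivList (List.ofFn i) a * pderivList (List.ofFn i) a =
      (((d - r).factorial : ℝ)⁻¹) ^ 2 • ∑ jk : Fin ((d - r) + (d - r)) → ι,
        (constantCoeff (pderivList (List.ofFn fun l => jk (Fin.castAdd (d - r) l))
          (pderivList (List.ofFn i) a)) *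
        constantCoeff (pderivList (List.ofFn fun l => jk (Fin.natAdd (d - r) l))
          (pderivList (List.ofFn i) a))) • ∏ l, X (jk l) := by
    intro i
    conv_lhs => rw [IsHomogeneous_eq_sum (h1 i)]
    rw [smul_mul_smul_comm, ← sq, Finset.sum_mul_sum, ← Fintype.sum_prod_type',
      ← (Fin.appendEquiv (d - r) (d - r)).sum_comp]
    congr 1
    refine Finset.sum_congr rfl fun jk _ => ?_
    simp only [Fin.prod_univ_add, smul_mul_smul_comm, Fin.appendEquiv, Equiv.coe_fn_mk,
      Fin.append_left, Fin.append_right]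
  rw [polyContraction_eq_sum, Finset.sum_congr rfl fun i _ => h2 i, ← Finset.smul_sum,
    Finset.sum_comm, Finset.smul_sum, Finset.smul_sum]
  refine Finset.sum_congr rfl fun jk _ => ?_
  rw [← Finset.sum_smul, contractionKernel_polyTensor e hv hr, smul_smul, smul_smul]
  congr 1
  have : (d.factorial : ℝ) ≠ 0 := by positivity
  field_simp

theorem polyTensor_polyContraction (hv : Function.Injective v) {d r : ℕ} (hr : r ≤ d)
    {a : MvPolynomial ι ℝ} (ha : a.IsHomogeneous d) :
    polyTensor e v ((d - r) + (d - r)) (polyContraction r a a) =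
      ((d.factorial : ℝ) / (d - r).factorial) ^ 2 •
        symmetrize (contraction e r (polyTensor e v d a) (polyTensor e v d a)) := by
  rw [polyContraction_self_eq e hv hr ha, contraction_polyTensor e hv hr, ← symmetrizeL_apply]
  simp only [map_smul, map_sum, polyTensor_prod_X, symmetrizeL_apply]

/-- The isometry in degree 2d - 2r; the constant is (d!/(d-r)!)²/r! = r! binom(d,r)². -/
theorem chaosNorm_eq (hv : Function.Injective v) {d r : ℕ} (hr : r ≤ d)
    {a : MvPolynomial ι ℝ} (ha : a.IsHomogeneous d) :
    chaosNorm a r = ((r.factorial : ℝ) * (d.choose r : ℝ) ^ 2) ^ 2 * (2 * d - 2 * r).factorial *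
      ‖symmetrize (contraction e r (polyTensor e v d a) (polyTensor e v d a))‖ ^ 2 := by
  rw [chaosNorm, gaussianExpect_wick_sq e hv (isHomogeneous_chaosTerm hr ha), chaosTerm, map_smul,
    polyTensor_polyContraction e hv hr ha, smul_smul, norm_smul, mul_pow, Real.norm_eq_abs, sq_abs,
    show (2 * d - 2 * r).factorial = (d - r + (d - r)).factorial by congr 1; omega,
    Nat.cast_choose ℝ hr]
  have h1 : (r.factorial : ℝ) ≠ 0 := by positivity
  field_simp

/-- The constants agree by the absorption identity d binom(d-1,r-1) = r binom(d,r). -/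
theorem T₁_polyTensor_sq (hv : Function.Injective v) {d : ℕ} {a : MvPolynomial ι ℝ}
    (ha : a.IsHomogeneous d) :
    T₁ e (polyTensor e v d a) ^ 2 =
      ∑ r ∈ Finset.Icc 1 (d - 1), ((r : ℝ) / d) ^ 2 * chaosNorm a r := by
  rw [T₁, Real.sq_sqrt (mul_nonneg (sq_nonneg _) (Finset.sum_nonneg fun r _ => by positivity)),
    Finset.mul_sum]
  refine Finset.sum_congr rfl fun r hr => ?_
  have hr' := Finset.mem_Icc.1 hr
  rw [chaosNorm_eq e hv (by omega) ha]
  obtain ⟨d, rfl⟩ : ∃ k, d = k + 1 := ⟨d - 1, by omega⟩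
  obtain ⟨r, rfl⟩ : ∃ k, r = k + 1 := ⟨r - 1, by omega⟩
  have h1 : ((d + 1 : ℕ) : ℝ) * (d.choose r : ℝ) = ((d + 1).choose (r + 1) : ℝ) * ((r + 1 : ℕ) : ℝ) := by
    exact_mod_cast Nat.add_one_mul_choose_eq d r
  have h2 : (d.choose r : ℝ) =
      ((d + 1).choose (r + 1) : ℝ) * ((r + 1 : ℕ) : ℝ) / ((d + 1 : ℕ) : ℝ) := by
    rw [← h1]; field_simp
  simp only [Nat.add_sub_cancel]
  rw [h2, Nat.factorial_succ]
  push_cast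
  field_simp

end PolyTensor

/-! ### Stein kernels -/

section SteinKernel

variable {Ω Ω' : Type*} [MeasurableSpace Ω] [MeasurableSpace Ω'] {μ : Measure Ω} {μ' : Measure Ω'}

/-- All moments of `X` are finite. -/
def HasAllMoments (X : Ω → ℝ) (μ : Measure Ω) : Prop := ∀ p : ℝ≥0∞, p ≠ ∞ → MemLp X p μ

namespace HasAllMoments

variable {X Y : Ω → ℝ}

theorem add (hX : HasAllMoments X μ) (hY : HasAllMoments Y μ) :
    HasAllMoments (fun ω => X ω + Y ω) μ := fun p hp => (hX p hp).add (hY p hp)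

theorem sub (hX : HasAllMoments X μ) (hY : HasAllMoments Y μ) :
    HasAllMoments (fun ω => X ω - Y ω) μ := fun p hp => (hX p hp).sub (hY p hp)

theorem mul (hX : HasAllMoments X μ) (hY : HasAllMoments Y μ) :
    HasAllMoments (fun ω => X ω * Y ω) μ := fun p hp => by
  have := holderTriple_two_mul p
  have h2 : 2 * p ≠ ∞ := ENNReal.mul_ne_top (by simp) hp
  exact (hY (2 * p) h2).mul (hX (2 * p) h2)

theorem const [IsFiniteMeasure μ] (c : ℝ) : HasAllMoments (fun _ : Ω => c) μ :=
  fun _ _ => memLp_const c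

theorem const_mul (c : ℝ) (hX : HasAllMoments X μ) : HasAllMoments (fun ω => c * X ω) μ :=
  fun p hp => (hX p hp).const_mul c

theorem abs (hX : HasAllMoments X μ) : HasAllMoments (fun ω => |X ω|) μ :=
  fun p hp => (hX p hp).norm

theorem integrable (hX : HasAllMoments X μ) : Integrable X μ :=
  memLp_one_iff_integrable.1 (hX 1 (by simp))

theorem memLp_two (hX : HasAllMoments X μ) : MemLp X 2 μ := hX 2 (by simp)

theorem aestronglyMeasurable (hX : HasAllMoments X μ) : AEStronglyMeasurable X μ :=
  hX.integrable.aestronglyMeasurable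

theorem of_le (hX : HasAllMoments X μ) (hY : AEStronglyMeasurable Y μ)
    (h : ∀ ω, |Y ω| ≤ X ω) : HasAllMoments Y μ :=
  fun p hp => (hX p hp).of_le hY (ae_of_all _ fun ω => (h ω).trans (le_abs_self _))

theorem comp {f : Ω' → Ω} (hX : HasAllMoments X μ) (hf : MeasurePreserving f μ' μ) :
    HasAllMoments (fun ω => X (f ω)) μ' := fun p hp => (hX p hp).comp_measurePreserving hf

end HasAllMoments

theorem hasAllMoments_id_gaussianReal : HasAllMoments (fun x => x) (gaussianReal 0 1) :=
  fun p hp => memLp_id_gaussianReal' p hp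

theorem abs_integral_mul_le_sqrt {f g : Ω → ℝ} (hf : MemLp f 2 μ) (hg : MemLp g 2 μ) :
    |∫ ω, f ω * g ω ∂μ| ≤ √(∫ ω, f ω ^ 2 ∂μ) * √(∫ ω, g ω ^ 2 ∂μ) := by
  have h := integral_mul_norm_le_Lp_mul_Lq (μ := μ) (f := f) (g := g) Real.HolderConjugate.two_two
    (by simpa using hf) (by simpa using hg)
  rw [← Real.norm_eq_abs]
  refine (norm_integral_le_integral_norm _).trans ?_
  simp only [norm_mul]
  refine h.trans_eq ?_
  simp [Real.sqrt_eq_rpow]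

/-- `Q` is a Stein kernel of `F`: `E[F g(F)] = E[Q g'(F)]`. -/
structure IsSteinKernel (F Q : Ω → ℝ) (μ : Measure Ω) : Prop where
  moments : HasAllMoments F μ
  kernel_moments : HasAllMoments Q μ
  integral_mul : ∀ g g' : ℝ → ℝ, (∀ x, HasDerivAt g (g' x) x) → MemLp (fun ω => g (F ω)) 2 μ →
    MemLp (fun ω => g' (F ω)) 2 μ → ∫ ω, F ω * g (F ω) ∂μ = ∫ ω, Q ω * g' (F ω) ∂μ

theorem IsSteinKernel.comp {F Q : Ω → ℝ} (h : IsSteinKernel F Q μ) {f : Ω' → Ω}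
    (hf : MeasurePreserving f μ' μ) :
    IsSteinKernel (fun ω => F (f ω)) (fun ω => Q (f ω)) μ' := by
  refine ⟨h.moments.comp hf, h.kernel_moments.comp hf, fun g g' hg h0 h1 => ?_⟩
  have hgm : Measurable g :=
    (continuous_iff_continuousAt.2 fun x => (hg x).continuousAt).measurable
  -- Continuity of `g'` is not assumed, but a derivative is always measurable.
  have hg'm : Measurable g' := by
    have : g' = deriv g := funext fun x => (hg x).deriv.symm
    exact this ▸ measurable_deriv g
  have hF := hf.map_eq.symm ▸ h.moments.aestronglyMeasurable
  have hQ := hf.map_eq.symm ▸ h.kernel_moments.aestronglyMeasurable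
  have hgF := (hgm.comp_aemeasurable hF.aemeasurable).aestronglyMeasurable
  have hg'F := (hg'm.comp_aemeasurable hF.aemeasurable).aestronglyMeasurable
  have k0 : MemLp (fun ω => g (F ω)) 2 μ := by
    rw [← hf.map_eq]
    exact (memLp_map_measure_iff hgF hf.measurable.aemeasurable).2 h0
  have k1 : MemLp (fun ω => g' (F ω)) 2 μ := by
    rw [← hf.map_eq]
    exact (memLp_map_measure_iff hg'F hf.measurable.aemeasurable).2 h1
  have := h.integral_mul g g' hg k0 k1
  rw [← hf.map_eq] at this
  exact (integral_map hf.measurable.aemeasurable (hF.mul hgF)).symm.trans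
    (this.trans (integral_map hf.measurable.aemeasurable (hQ.mul hg'F)))

/-! ### Interpolation between F and an independent Gaussian -/

variable [IsProbabilityMeasure μ] {F Q : Ω → ℝ}

/-- The function `φ` is `C²`, with derivatives `φ₁` and `φ₂`, and `φ₂` has linear growth. -/
structure HasSecondDerivGrowth (φ φ₁ φ₂ : ℝ → ℝ) (A B : ℝ) : Prop where
  hasDerivAt : ∀ x, HasDerivAt φ (φ₁ x) x
  hasDerivAt' : ∀ x, HasDerivAt φ₁ (φ₂ x) x
  continuous : Continuous φ₂
  nonneg : 0 ≤ A
  nonneg' : 0 ≤ B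
  le : ∀ x, |φ₂ x| ≤ A + B * |x|

namespace HasSecondDerivGrowth

variable {φ φ₁ φ₂ : ℝ → ℝ} {A B : ℝ}

theorem continuous_zero (hφ : HasSecondDerivGrowth φ φ₁ φ₂ A B) : Continuous φ :=
  continuous_iff_continuousAt.2 fun x => (hφ.hasDerivAt x).continuousAt

theorem continuous_one (hφ : HasSecondDerivGrowth φ φ₁ φ₂ A B) : Continuous φ₁ :=
  continuous_iff_continuousAt.2 fun x => (hφ.hasDerivAt' x).continuousAt

theorem le_one (hφ : HasSecondDerivGrowth φ φ₁ φ₂ A B) (x : ℝ) :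
    |φ₁ x| ≤ |φ₁ 0| + (A + B * |x|) * |x| := by
  have h := (convex_closedBall (0 : ℝ) |x|).norm_image_sub_le_of_norm_hasDerivWithin_le
    (f := φ₁) (f' := φ₂) (C := A + B * |x|)
    (fun y _ => (hφ.hasDerivAt' y).hasDerivWithinAt) (fun y hy => (hφ.le y).trans ?_)
    (x := 0) (y := x) (by simp) (by simp)
  · rw [sub_zero, Real.norm_eq_abs, Real.norm_eq_abs] at h
    have := abs_sub_abs_le_abs_sub (φ₁ x) (φ₁ 0)
    linarith
  · have : |y| ≤ |x| := by simpa using hy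
    have := hφ.nonneg'
    gcongr

/-- Local Lipschitz estimate. -/
theorem abs_sub_le (hφ : HasSecondDerivGrowth φ φ₁ φ₂ A B) (x y : ℝ) :
    |φ y - φ x| ≤ (|φ₁ 0| + (A + B * (|x| + |y|)) * (|x| + |y|)) * |y - x| := by
  refine (convex_closedBall (0 : ℝ) (|x| + |y|)).norm_image_sub_le_of_norm_hasDerivWithin_le
    (f := φ) (f' := φ₁)
    (fun y _ => (hφ.hasDerivAt y).hasDerivWithinAt) (fun z hz => (hφ.le_one z).trans ?_)
    (by simp) (by simp)
  have h1 : |z| ≤ |x| + |y| := by simpa using hz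
  have := hφ.nonneg'
  have := hφ.nonneg
  gcongr

theorem le_zero (hφ : HasSecondDerivGrowth φ φ₁ φ₂ A B) (x : ℝ) :
    |φ x| ≤ |φ 0| + (|φ₁ 0| + (A + B * |x|) * |x|) * |x| := by
  have h := hφ.abs_sub_le 0 x
  simp only [abs_zero, zero_add, sub_zero] at h
  have := abs_sub_abs_le_abs_sub (φ x) (φ 0)
  linarith

variable {X : Ω → ℝ}

theorem hasAllMoments_two (hφ : HasSecondDerivGrowth φ φ₁ φ₂ A B) (hX : HasAllMoments X μ) :
    HasAllMoments (fun ω => φ₂ (X ω)) μ :=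
  ((HasAllMoments.const A).add (hX.abs.const_mul B)).of_le
    (hφ.continuous.comp_aestronglyMeasurable hX.aestronglyMeasurable) fun _ => hφ.le _

theorem hasAllMoments_one (hφ : HasSecondDerivGrowth φ φ₁ φ₂ A B) (hX : HasAllMoments X μ) :
    HasAllMoments (fun ω => φ₁ (X ω)) μ :=
  ((HasAllMoments.const |φ₁ 0|).add
    (((HasAllMoments.const A).add (hX.abs.const_mul B)).mul hX.abs)).of_le
    (hφ.continuous_one.comp_aestronglyMeasurable hX.aestronglyMeasurable) fun _ => hφ.le_one _

theorem hasAllMoments_zero (hφ : HasSecondDerivGrowth φ φ₁ φ₂ A B) (hX : HasAllMoments X μ) :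
    HasAllMoments (fun ω => φ (X ω)) μ :=
  ((HasAllMoments.const |φ 0|).add (((HasAllMoments.const |φ₁ 0|).add
    (((HasAllMoments.const A).add (hX.abs.const_mul B)).mul hX.abs)).mul hX.abs)).of_le
    (hφ.continuous_zero.comp_aestronglyMeasurable hX.aestronglyMeasurable) fun _ => hφ.le_zero _

end HasSecondDerivGrowth

/-- The interpolation `cos θ F + sin θ Z`, on the product space. -/
def smartPath (F : Ω → ℝ) (θ : ℝ) (p : Ω × ℝ) : ℝ := Real.cos θ * F p.1 + Real.sin θ * p.2

theorem hasAllMoments_fst {X : Ω → ℝ} (hX : HasAllMoments X μ) :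
    HasAllMoments (fun p : Ω × ℝ => X p.1) (μ.prod (gaussianReal 0 1)) :=
  hX.comp measurePreserving_fst

theorem hasAllMoments_snd :
    HasAllMoments (fun p : Ω × ℝ => p.2) (μ.prod (gaussianReal 0 1)) :=
  hasAllMoments_id_gaussianReal.comp measurePreserving_snd

theorem hasAllMoments_smartPath (hF : HasAllMoments F μ) (θ : ℝ) :
    HasAllMoments (smartPath F θ) (μ.prod (gaussianReal 0 1)) :=
  ((hasAllMoments_fst hF).const_mul _).add (hasAllMoments_snd.const_mul _)

variable {φ φ₁ φ₂ : ℝ → ℝ} {A B : ℝ}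

theorem abs_smartPath_le (F : Ω → ℝ) (θ : ℝ) (p : Ω × ℝ) :
    |smartPath F θ p| ≤ |F p.1| + |p.2| := by
  refine (abs_add_le _ _).trans ?_
  rw [abs_mul, abs_mul]
  have := Real.abs_cos_le_one θ
  have := Real.abs_sin_le_one θ
  have := abs_nonneg (F p.1)
  have := abs_nonneg p.2
  exact add_le_add (mul_le_of_le_one_left (by assumption) (by assumption))
    (mul_le_of_le_one_left (by assumption) (by assumption))

theorem hasDerivAt_smartPath (F : Ω → ℝ) (θ : ℝ) (p : Ω × ℝ) :
    HasDerivAt (fun θ => smartPath F θ p) (-Real.sin θ * F p.1 + Real.cos θ * p.2) θ :=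
  ((Real.hasDerivAt_cos θ).mul_const _).add ((Real.hasDerivAt_sin θ).mul_const _)

/-- Since |cos θ F + sin θ Z| ≤ |F| + |Z|, the θ-derivative is dominated by a polynomial in |F| +
|Z| that does not depend on θ. -/
theorem hasDerivAt_integral_smartPath (hφ : HasSecondDerivGrowth φ φ₁ φ₂ A B)
    (hF : HasAllMoments F μ) (θ : ℝ) :
    HasDerivAt (fun θ => ∫ p, φ (smartPath F θ p) ∂μ.prod (gaussianReal 0 1))
      (∫ p, φ₁ (smartPath F θ p) * (-Real.sin θ * F p.1 + Real.cos θ * p.2)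
        ∂μ.prod (gaussianReal 0 1)) θ := by
  have hR : HasAllMoments (fun p : Ω × ℝ => |F p.1| + |p.2|) (μ.prod (gaussianReal 0 1)) :=
    (hasAllMoments_fst hF).abs.add hasAllMoments_snd.abs
  have hb : HasAllMoments (fun p : Ω × ℝ => (|φ₁ 0| + (A + B * (|F p.1| + |p.2|)) *
      (|F p.1| + |p.2|)) * (|F p.1| + |p.2|)) (μ.prod (gaussianReal 0 1)) :=
    ((HasAllMoments.const _).add (((HasAllMoments.const A).add (hR.const_mul B)).mul hR)).mul hR
  refine (hasDerivAt_integral_of_dominated_loc_of_deriv_le (s := Set.univ)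
    (F := fun θ p => φ (smartPath F θ p))
    (F' := fun θ p => φ₁ (smartPath F θ p) * (-Real.sin θ * F p.1 + Real.cos θ * p.2))
    Filter.univ_mem
    (Eventually.of_forall fun θ =>
      (hφ.hasAllMoments_zero (hasAllMoments_smartPath hF θ)).aestronglyMeasurable)
    (hφ.hasAllMoments_zero (hasAllMoments_smartPath hF θ)).integrable
    ((hφ.hasAllMoments_one (hasAllMoments_smartPath hF θ)).mul
      (((hasAllMoments_fst hF).const_mul _).add
        (hasAllMoments_snd.const_mul _))).aestronglyMeasurable
    (ae_of_all _ fun p θ _ => ?_) hb.integrable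
    (ae_of_all _ fun p θ _ => (hφ.hasDerivAt _).comp θ (hasDerivAt_smartPath F θ p))).2
  have h1 := abs_smartPath_le F θ p
  have h2 : |-Real.sin θ * F p.1 + Real.cos θ * p.2| ≤ |F p.1| + |p.2| := by
    refine (abs_add_le _ _).trans ?_
    rw [abs_mul, abs_mul, abs_neg]
    exact add_le_add (mul_le_of_le_one_left (abs_nonneg _) (Real.abs_sin_le_one θ))
      (mul_le_of_le_one_left (abs_nonneg _) (Real.abs_cos_le_one θ))
  rw [norm_mul, Real.norm_eq_abs, Real.norm_eq_abs]
  have := hφ.nonneg'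
  have := hφ.nonneg
  refine mul_le_mul ((hφ.le_one _).trans ?_) h2 (abs_nonneg _) (by positivity)
  gcongr

/-- With the Gaussian variable frozen at `z`, this is the Stein kernel identity for x ↦ φ₁(cos θ x +
sin θ z). -/
theorem integral_fst_mul_smartPath (hφ : HasSecondDerivGrowth φ φ₁ φ₂ A B)
    (hF : IsSteinKernel F Q μ) (θ : ℝ) :
    ∫ p, F p.1 * φ₁ (smartPath F θ p) ∂μ.prod (gaussianReal 0 1) =
      Real.cos θ * ∫ p, Q p.1 * φ₂ (smartPath F θ p) ∂μ.prod (gaussianReal 0 1) := by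
  have hS := hasAllMoments_smartPath hF.moments θ
  rw [← integral_const_mul, integral_prod_symm _
    ((hasAllMoments_fst hF.moments).mul (hφ.hasAllMoments_one hS)).integrable,
    integral_prod_symm _ (((hasAllMoments_fst hF.kernel_moments).mul
      (hφ.hasAllMoments_two hS)).const_mul (Real.cos θ)).integrable]
  congr 1
  ext z
  have hz : HasAllMoments (fun ω => smartPath F θ (ω, z)) μ :=
    (hF.moments.const_mul _).add (HasAllMoments.const (Real.sin θ * z))
  have h := hF.integral_mul (fun x => φ₁ (Real.cos θ * x + Real.sin θ * z))
    (fun x => Real.cos θ * φ₂ (Real.cos θ * x + Real.sin θ * z))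
    (fun x => by
      have := (hφ.hasDerivAt' (Real.cos θ * x + Real.sin θ * z)).comp x
        (((hasDerivAt_id' x).const_mul (Real.cos θ)).add_const (Real.sin θ * z))
      refine this.congr_deriv ?_
      ring)
    (hφ.hasAllMoments_one hz).memLp_two ((hφ.hasAllMoments_two hz).const_mul _).memLp_two
  refine h.trans (integral_congr_ae (ae_of_all _ fun ω => ?_))
  simp only [smartPath]
  ring

/-- Gaussian integration by parts in `z` with `ω` frozen. The weight `Y` is 1 when the path is
differentiated, and 1 - Q when φ₂ is traded back for φ₁ in the Lipschitz bound. -/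
theorem integral_mul_snd_mul_smartPath (hφ : HasSecondDerivGrowth φ φ₁ φ₂ A B)
    (hF : HasAllMoments F μ) {Y : Ω → ℝ} (hY : HasAllMoments Y μ) (θ : ℝ) :
    ∫ p, Y p.1 * (p.2 * φ₁ (smartPath F θ p)) ∂μ.prod (gaussianReal 0 1) =
      Real.sin θ * ∫ p, Y p.1 * φ₂ (smartPath F θ p) ∂μ.prod (gaussianReal 0 1) := by
  have hS := hasAllMoments_smartPath hF θ
  rw [← integral_const_mul, integral_prod _
    ((hasAllMoments_fst hY).mul (hasAllMoments_snd.mul (hφ.hasAllMoments_one hS))).integrable,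
    integral_prod _ (((hasAllMoments_fst hY).mul
      (hφ.hasAllMoments_two hS)).const_mul (Real.sin θ)).integrable]
  congr 1
  ext ω
  have hz : HasAllMoments (fun z => smartPath F θ (ω, z)) (gaussianReal 0 1) :=
    (HasAllMoments.const (Real.cos θ * F ω)).add
      (hasAllMoments_id_gaussianReal.const_mul (Real.sin θ))
  have h := integral_mul_gaussianReal (v := fun z => φ₁ (smartPath F θ (ω, z)))
    (v' := fun z => Real.sin θ * φ₂ (smartPath F θ (ω, z)))
    (fun x => by
      have := (hφ.hasDerivAt' (Real.cos θ * F ω + Real.sin θ * x)).comp x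
        (((hasDerivAt_id' x).const_mul (Real.sin θ)).const_add (Real.cos θ * F ω))
      refine this.congr_deriv ?_
      simp only [smartPath]
      ring)
    (hφ.hasAllMoments_one hz).integrable
    (hasAllMoments_id_gaussianReal.mul (hφ.hasAllMoments_one hz)).integrable
    ((hφ.hasAllMoments_two hz).const_mul _).integrable
  simp only
  rw [integral_const_mul, h, ← integral_const_mul]
  congr 1
  ext z
  ring

theorem integral_deriv_smartPath (hφ : HasSecondDerivGrowth φ φ₁ φ₂ A B)
    (hF : IsSteinKernel F Q μ) (θ : ℝ) :
    ∫ p, φ₁ (smartPath F θ p) * (-Real.sin θ * F p.1 + Real.cos θ * p.2)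
        ∂μ.prod (gaussianReal 0 1) =
      Real.cos θ * (Real.sin θ *
        ∫ p, (1 - Q p.1) * φ₂ (smartPath F θ p) ∂μ.prod (gaussianReal 0 1)) := by
  have hS := hasAllMoments_smartPath hF.moments θ
  have h1 := integral_fst_mul_smartPath hφ hF θ
  have h2 := integral_mul_snd_mul_smartPath hφ hF.moments (HasAllMoments.const 1) θ
  have i1 := ((hasAllMoments_fst hF.moments).mul (hφ.hasAllMoments_one hS)).integrable
  have i2 := (hasAllMoments_snd.mul (hφ.hasAllMoments_one hS)).integrable
  have i3 := (hφ.hasAllMoments_two hS).integrable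
  have i4 := ((hasAllMoments_fst hF.kernel_moments).mul (hφ.hasAllMoments_two hS)).integrable
  simp only [one_mul] at h2
  have e1 : ∀ p : Ω × ℝ, φ₁ (smartPath F θ p) * (-Real.sin θ * F p.1 + Real.cos θ * p.2) =
      Real.cos θ * (p.2 * φ₁ (smartPath F θ p)) - Real.sin θ * (F p.1 * φ₁ (smartPath F θ p)) :=
    fun p => by ring
  have e2 : ∀ p : Ω × ℝ, (1 - Q p.1) * φ₂ (smartPath F θ p) =
      φ₂ (smartPath F θ p) - Q p.1 * φ₂ (smartPath F θ p) := fun p => by ring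
  simp only [e1, e2]
  rw [integral_sub (i2.const_mul _) (i1.const_mul _), integral_const_mul, integral_const_mul, h1,
    h2, integral_sub i3 i4]
  ring

theorem integral_smartPath_zero (φ : ℝ → ℝ) (F : Ω → ℝ) :
    ∫ p, φ (smartPath F 0 p) ∂μ.prod (gaussianReal 0 1) = ∫ ω, φ (F ω) ∂μ := by
  have := integral_fun_fst (μ := μ) (ν := gaussianReal 0 1) fun ω => φ (F ω)
  simpa [smartPath] using this

theorem integral_smartPath_pi_div_two (φ : ℝ → ℝ) (F : Ω → ℝ) :
    ∫ p, φ (smartPath F (Real.pi / 2) p) ∂μ.prod (gaussianReal 0 1) =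
      ∫ x, φ x ∂gaussianReal 0 1 := by
  have := integral_fun_snd (μ := μ) (ν := gaussianReal 0 1) fun x => φ x
  simpa [smartPath] using this

theorem integral_id_sq_gaussianReal : ∫ x, x ^ 2 ∂gaussianReal 0 1 = 1 := by
  have := integral_mul_gaussianReal (v := fun x => x) (v' := fun _ => 1)
    (fun x => hasDerivAt_id' x) hasAllMoments_id_gaussianReal.integrable
    (hasAllMoments_id_gaussianReal.mul hasAllMoments_id_gaussianReal).integrable
    (integrable_const 1)
  simpa [sq] using this

theorem integral_one_sub_sq_fst (Q : Ω → ℝ) :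
    ∫ p, (1 - Q p.1) ^ 2 ∂μ.prod (gaussianReal 0 1) = ∫ ω, (1 - Q ω) ^ 2 ∂μ := by
  simpa using integral_fun_fst (μ := μ) (ν := gaussianReal 0 1) fun ω => (1 - Q ω) ^ 2

theorem integral_sq_snd : ∫ p, p.2 ^ 2 ∂μ.prod (gaussianReal 0 1) = 1 := by
  have := integral_fun_snd (μ := μ) (ν := gaussianReal 0 1) fun x => x ^ 2
  simpa [integral_id_sq_gaussianReal] using this

/-- Bound for smooth Lipschitz test functions. -/
theorem abs_integral_sub_le_of_lipschitz (hφ : HasSecondDerivGrowth φ φ₁ φ₂ A B)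
    (h1 : ∀ x, |φ₁ x| ≤ 1) (hF : IsSteinKernel F Q μ) :
    |(∫ ω, φ (F ω) ∂μ) - ∫ x, φ x ∂gaussianReal 0 1| ≤ √(∫ ω, (1 - Q ω) ^ 2 ∂μ) := by
  set T := √(∫ ω, (1 - Q ω) ^ 2 ∂μ) with hT
  have hQ1 : HasAllMoments (fun ω => 1 - Q ω) μ := (HasAllMoments.const 1).sub hF.kernel_moments
  have key : ∀ θ, |Real.sin θ *
      ∫ p, (1 - Q p.1) * φ₂ (smartPath F θ p) ∂μ.prod (gaussianReal 0 1)| ≤ T := by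
    intro θ
    -- The factor sin θ is what integration by parts in reverse needs: φ₂ becomes z φ₁, whose L²
    -- norm is at most 1 because |φ₁| ≤ 1 and E[Z²] = 1.
    rw [← integral_mul_snd_mul_smartPath hφ hF.moments hQ1 θ]
    have hzm := hasAllMoments_snd.mul (hφ.hasAllMoments_one (hasAllMoments_smartPath hF.moments θ))
    refine (abs_integral_mul_le_sqrt (hasAllMoments_fst hQ1).memLp_two hzm.memLp_two).trans ?_
    rw [integral_one_sub_sq_fst]
    refine mul_le_of_le_one_right (Real.sqrt_nonneg _) ?_
    rw [Real.sqrt_le_one, ← integral_sq_snd (μ := μ)]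
    refine integral_mono_ae hzm.memLp_two.integrable_sq hasAllMoments_snd.memLp_two.integrable_sq
      (ae_of_all _ fun p => ?_)
    simp only [mul_pow]
    refine mul_le_of_le_one_right (sq_nonneg _) ?_
    rw [sq_le_one_iff_abs_le_one]
    exact h1 _
  have hd := hasDerivAt_integral_smartPath hφ hF.moments
  -- The derivative is bounded by T cos θ, with primitive T sin θ. Keeping the cosine gives the
  -- constant 1 at θ = π/2.
  have := image_norm_le_of_norm_deriv_right_le_deriv_boundary' (a := 0) (b := Real.pi / 2)
    (f := fun θ => (∫ p, φ (smartPath F θ p) ∂μ.prod (gaussianReal 0 1)) - ∫ ω, φ (F ω) ∂μ)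
    (B := fun θ => T * Real.sin θ) (B' := fun θ => T * Real.cos θ)
    (fun θ _ => ((hd θ).sub_const _).continuousAt.continuousWithinAt)
    (fun θ _ => ((hd θ).sub_const _).hasDerivWithinAt)
    (by simp [integral_smartPath_zero]) (by fun_prop)
    (fun θ _ => ((Real.hasDerivAt_sin θ).const_mul T).hasDerivWithinAt)
    (fun θ hθ => by
      rw [integral_deriv_smartPath hφ hF, Real.norm_eq_abs, abs_mul, mul_comm]
      have hc := Real.cos_nonneg_of_mem_Icc (x := θ)
        ⟨by linarith [hθ.1, Real.pi_pos], by linarith [hθ.2]⟩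
      rw [abs_of_nonneg hc]
      exact mul_le_mul_of_nonneg_right (key θ) hc)
    (Set.right_mem_Icc.2 (by positivity))
  rw [integral_smartPath_pi_div_two] at this
  rw [abs_sub_comm]
  simpa using this

/-- Bound for `C²` test functions whose second derivative has linear growth. -/
theorem abs_integral_sub_le_of_growth (hφ : HasSecondDerivGrowth φ φ₁ φ₂ A B)
    (hF : IsSteinKernel F Q μ) :
    |(∫ ω, φ (F ω) ∂μ) - ∫ x, φ x ∂gaussianReal 0 1| ≤
      2 * √(2 * A ^ 2 + 4 * B ^ 2 * (1 + ∫ ω, F ω ^ 2 ∂μ)) * √(∫ ω, (1 - Q ω) ^ 2 ∂μ) := by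
  set T := √(∫ ω, (1 - Q ω) ^ 2 ∂μ) with hT
  set K := √(2 * A ^ 2 + 4 * B ^ 2 * (1 + ∫ ω, F ω ^ 2 ∂μ)) with hK
  have hQ1 : HasAllMoments (fun ω => 1 - Q ω) μ := (HasAllMoments.const 1).sub hF.kernel_moments
  have key : ∀ θ, |∫ p, (1 - Q p.1) * φ₂ (smartPath F θ p) ∂μ.prod (gaussianReal 0 1)| ≤
      K * T := by
    intro θ
    have h2 := hφ.hasAllMoments_two (hasAllMoments_smartPath hF.moments θ)
    refine (abs_integral_mul_le_sqrt (hasAllMoments_fst hQ1).memLp_two h2.memLp_two).trans ?_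
    rw [integral_one_sub_sq_fst, mul_comm]
    refine mul_le_mul_of_nonneg_right (Real.sqrt_le_sqrt ?_) (Real.sqrt_nonneg _)
    have iF := (hasAllMoments_fst (μ := μ) hF.moments).memLp_two.integrable_sq
    have iZ := (hasAllMoments_snd (μ := μ)).memLp_two.integrable_sq
    have hle : ∫ p, φ₂ (smartPath F θ p) ^ 2 ∂μ.prod (gaussianReal 0 1) ≤
        ∫ p, (2 * A ^ 2 + 4 * B ^ 2 * (p.2 ^ 2 + F p.1 ^ 2)) ∂μ.prod (gaussianReal 0 1) := by
      refine integral_mono_ae h2.memLp_two.integrable_sq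
        ((integrable_const _).add ((iZ.add iF).const_mul _)) (ae_of_all _ fun p => ?_)
      have k1 : |φ₂ (smartPath F θ p)| ≤ A + B * (|F p.1| + |p.2|) :=
        (hφ.le _).trans (by have := hφ.nonneg'; gcongr; exact abs_smartPath_le F θ p)
      have k2 : φ₂ (smartPath F θ p) ^ 2 ≤ (A + B * (|F p.1| + |p.2|)) ^ 2 := by
        rw [← sq_abs]; gcongr
      refine k2.trans ?_
      have k3 := sq_abs (F p.1)
      have k4 := sq_abs p.2
      simp only
      rw [← k3, ← k4]
      -- Two uses of (u + v)² ≤ 2u² + 2v²: first for A and B (|F| + |Z|), then for |F| and |Z|.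
      nlinarith [sq_nonneg (A - B * (|F p.1| + |p.2|)), mul_nonneg (sq_nonneg B)
        (sq_nonneg (|F p.1| - |p.2|))]
    refine hle.trans_eq ?_
    rw [integral_add (integrable_const _) (by exact (iZ.add iF).const_mul _),
      integral_const_mul (4 * B ^ 2),
      integral_add iZ iF, integral_sq_snd]
    have : ∫ p, F p.1 ^ 2 ∂μ.prod (gaussianReal 0 1) = ∫ ω, F ω ^ 2 ∂μ := by
      simpa using integral_fun_fst (μ := μ) (ν := gaussianReal 0 1) fun ω => F ω ^ 2
    rw [this]
    simp
  have hd := hasDerivAt_integral_smartPath hφ hF.moments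
  have hKT : 0 ≤ K * T := mul_nonneg (Real.sqrt_nonneg _) (Real.sqrt_nonneg _)
  have := norm_image_sub_le_of_norm_deriv_le_segment' (a := 0) (b := Real.pi / 2) (C := K * T)
    (f := fun θ => ∫ p, φ (smartPath F θ p) ∂μ.prod (gaussianReal 0 1))
    (fun θ _ => (hd θ).hasDerivWithinAt)
    (fun θ hθ => by
      rw [integral_deriv_smartPath hφ hF, Real.norm_eq_abs, abs_mul, abs_mul]
      exact mul_le_of_le_one_left (by positivity) (Real.abs_cos_le_one θ) |>.trans
        ((mul_le_of_le_one_left (abs_nonneg _) (Real.abs_sin_le_one θ)).trans (key θ)))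
    (Real.pi / 2) (Set.right_mem_Icc.2 (by positivity))
  rw [integral_smartPath_pi_div_two, integral_smartPath_zero, Real.norm_eq_abs,
    abs_sub_comm] at this
  refine this.trans ?_
  -- The interval has length π/2 ≤ 2, whence the factor 2.
  have := Real.pi_le_four
  nlinarith

end SteinKernel

/-! ### Stein's equation, Borel sets and mollification -/

section SteinEquation

theorem hasDerivAt_exp_neg_half_sq (x : ℝ) :
    HasDerivAt (fun x : ℝ => Real.exp (-(1 / 2) * x ^ 2)) (-(x * Real.exp (-(1 / 2) * x ^ 2))) x := by
  have := ((hasDerivAt_pow 2 x).const_mul (-(1 / 2) : ℝ)).exp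
  refine this.congr_deriv ?_
  push_cast
  ring

theorem tendsto_exp_neg_half_sq {l : Filter ℝ} (hl : Tendsto (fun x : ℝ => x ^ 2) l atTop) :
    Tendsto (fun x : ℝ => Real.exp (-(1 / 2) * x ^ 2)) l (𝓝 0) :=
  Real.tendsto_exp_atBot.comp (hl.const_mul_atTop_of_neg (by norm_num))

theorem integrable_exp_neg_half_sq : Integrable fun x : ℝ => Real.exp (-(1 / 2) * x ^ 2) :=
  integrable_exp_neg_mul_sq (by norm_num)

theorem integrable_mul_exp_neg_half_sq :
    Integrable fun x : ℝ => x * Real.exp (-(1 / 2) * x ^ 2) :=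
  integrable_mul_exp_neg_mul_sq (by norm_num)

theorem setIntegral_Ioi_mul_exp (x : ℝ) :
    ∫ y in Set.Ioi x, y * Real.exp (-(1 / 2) * y ^ 2) = Real.exp (-(1 / 2) * x ^ 2) := by
  have h := integral_Ioi_of_hasDerivAt_of_tendsto' (a := x)
    (fun y _ => (hasDerivAt_exp_neg_half_sq y)) integrable_mul_exp_neg_half_sq.neg.integrableOn
    (tendsto_exp_neg_half_sq (tendsto_pow_atTop (by norm_num)))
  rw [integral_neg] at h
  linarith

theorem setIntegral_Iic_mul_exp (x : ℝ) :
    ∫ y in Set.Iic x, -y * Real.exp (-(1 / 2) * y ^ 2) = Real.exp (-(1 / 2) * x ^ 2) := by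
  have h := integral_Iic_of_hasDerivAt_of_tendsto' (a := x)
    (fun y _ => (hasDerivAt_exp_neg_half_sq y)) integrable_mul_exp_neg_half_sq.neg.integrableOn
    (tendsto_exp_neg_half_sq (by
      simpa [Function.comp_def] using
        (tendsto_pow_atTop (α := ℝ) two_ne_zero).comp tendsto_neg_atBot_atTop))
  simpa using h

variable {k : ℝ → ℝ}

/-- The primitive of `k e^{-y²/2}` vanishing at `-∞`. -/
def gaussianPrimitive (k : ℝ → ℝ) (x : ℝ) : ℝ :=
  ∫ y in Set.Iic x, k y * Real.exp (-(1 / 2) * y ^ 2)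

theorem integrable_mul_gaussian (hk : Continuous k) (hk1 : ∀ x, |k x| ≤ 1) :
    Integrable fun y => k y * Real.exp (-(1 / 2) * y ^ 2) :=
  integrable_exp_neg_half_sq.bdd_mul (c := 1) hk.aestronglyMeasurable (ae_of_all _ hk1)

theorem hasDerivAt_gaussianPrimitive (hk : Continuous k) (hk1 : ∀ x, |k x| ≤ 1) (x : ℝ) :
    HasDerivAt (gaussianPrimitive k) (k x * Real.exp (-(1 / 2) * x ^ 2)) x := by
  have hi := integrable_mul_gaussian hk hk1
  have h : gaussianPrimitive k = fun x => gaussianPrimitive k 0 +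
      ∫ y in (0 : ℝ)..x, k y * Real.exp (-(1 / 2) * y ^ 2) := by
    ext x
    have := intervalIntegral.integral_Iic_sub_Iic (a := 0) (b := x) hi.integrableOn hi.integrableOn
    rw [← this, gaussianPrimitive, gaussianPrimitive]
    ring
  have hc : Continuous fun y => k y * Real.exp (-(1 / 2) * y ^ 2) := by fun_prop
  rw [h]
  exact (hc.integral_hasStrictDerivAt 0 x).hasDerivAt.const_add _

/-- For x ≥ 0 the centring of `k` replaces the left tail by the right one. On the tail |x| ≤ |y|, so
|x| moves inside the integral as |y|, and y e^{-y²/2} has an explicit primitive. -/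
theorem abs_mul_gaussianPrimitive_le (hk : Continuous k) (hk1 : ∀ x, |k x| ≤ 1)
    (h0 : ∫ y, k y * Real.exp (-(1 / 2) * y ^ 2) = 0) (x : ℝ) :
    |x * gaussianPrimitive k x| ≤ Real.exp (-(1 / 2) * x ^ 2) := by
  have hi := integrable_mul_gaussian hk hk1
  have hb : ∀ y, |k y * Real.exp (-(1 / 2) * y ^ 2)| ≤ Real.exp (-(1 / 2) * y ^ 2) := fun y => by
    rw [abs_mul, abs_of_pos (Real.exp_pos _)]
    exact mul_le_of_le_one_left (Real.exp_pos _).le (hk1 y)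
  rcases le_total 0 x with hx | hx
  · have h1 : gaussianPrimitive k x =
        -∫ y in Set.Ioi x, k y * Real.exp (-(1 / 2) * y ^ 2) := by
      have := intervalIntegral.integral_Iic_add_Ioi (b := x) hi.integrableOn hi.integrableOn
      rw [gaussianPrimitive]
      linarith
    rw [h1, mul_neg, abs_neg, ← integral_const_mul, ← setIntegral_Ioi_mul_exp x]
    refine abs_integral_le_integral_abs.trans ?_
    refine setIntegral_mono_on (hi.const_mul x).abs.integrableOn
      integrable_mul_exp_neg_half_sq.integrableOn measurableSet_Ioi fun y hy => ?_
    rw [abs_mul, abs_of_nonneg hx]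
    exact mul_le_mul (le_of_lt hy) (hb y) (abs_nonneg _) (hx.trans (le_of_lt hy))
  · rw [gaussianPrimitive, ← integral_const_mul, ← setIntegral_Iic_mul_exp x]
    refine abs_integral_le_integral_abs.trans ?_
    refine setIntegral_mono_on (hi.const_mul x).abs.integrableOn
      (by simpa using integrable_mul_exp_neg_half_sq.neg.integrableOn) measurableSet_Iic
      fun y hy => ?_
    have hy' : y ≤ x := hy
    rw [abs_mul, abs_of_nonpos hx]
    exact mul_le_mul (by linarith) (hb y) (abs_nonneg _) (by linarith)

/-- The Stein equation for a continuous test function with values in `[0, 1]`. -/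
theorem exists_stein_solution {f : ℝ → ℝ} (hf : Continuous f) (hf0 : ∀ x, 0 ≤ f x)
    (hf1 : ∀ x, f x ≤ 1) :
    ∃ g g' : ℝ → ℝ, (∀ x, HasDerivAt g (g' x) x) ∧ Continuous g' ∧ (∀ x, |g' x| ≤ 2) ∧
      ∀ x, g' x - x * g x = f x - ∫ y, f y ∂gaussianReal 0 1 := by
  set m := ∫ y, f y ∂gaussianReal 0 1 with hm
  have hfi : Integrable f (gaussianReal 0 1) :=
    Integrable.of_bound hf.aestronglyMeasurable 1 (ae_of_all _ fun x => by
      rw [Real.norm_eq_abs, abs_of_nonneg (hf0 x)]; exact hf1 x)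
  have hm0 : 0 ≤ m := integral_nonneg hf0
  have hm1 : m ≤ 1 := by
    simpa using integral_mono hfi (integrable_const (1 : ℝ)) hf1
  have hkc : Continuous fun x => f x - m := by fun_prop
  have hk1 : ∀ x, |f x - m| ≤ 1 := fun x => by
    rw [abs_le]; constructor <;> linarith [hf0 x, hf1 x]
  have h0 : ∫ y, (f y - m) * Real.exp (-(1 / 2) * y ^ 2) = 0 := by
    have h1 : ∫ y, (f y - m) ∂gaussianReal 0 1 = 0 := by
      rw [integral_sub hfi (integrable_const _)]; simp [hm]
    rw [integral_gaussianReal_eq_integral_smul one_ne_zero] at h1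
    have h2 : ∀ y, gaussianPDFReal 0 1 y • (f y - m) =
        (√(2 * Real.pi))⁻¹ * ((f y - m) * Real.exp (-(1 / 2) * y ^ 2)) := fun y => by
      rw [gaussianPDFReal, smul_eq_mul]
      simp only [NNReal.coe_one, mul_one, sub_zero]
      rw [show -y ^ 2 / 2 = -(1 / 2) * y ^ 2 by ring]
      ring
    simp only [h2] at h1
    rw [integral_const_mul] at h1
    refine (mul_eq_zero.1 h1).resolve_left (inv_ne_zero (Real.sqrt_ne_zero'.2 (by positivity)))
  -- Variation of constants: e^{-x²/2} is an integrating factor of g' - x g, so g = e^{x²/2} U.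
  set U := gaussianPrimitive fun x => f x - m with hU
  have hUd := hasDerivAt_gaussianPrimitive hkc hk1
  have he : ∀ x : ℝ, Real.exp (1 / 2 * x ^ 2) * Real.exp (-(1 / 2) * x ^ 2) = 1 := fun x => by
    rw [← Real.exp_add]; simp
  have hg : ∀ x, HasDerivAt (fun x => Real.exp (1 / 2 * x ^ 2) * U x)
      (x * (Real.exp (1 / 2 * x ^ 2) * U x) + (f x - m)) x := fun x => by
    have h1 := (((hasDerivAt_pow 2 x).const_mul (1 / 2 : ℝ)).exp).mul (hUd x)
    refine h1.congr_deriv ?_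
    have := he x
    push_cast
    linear_combination (f x - m) * this
  refine ⟨_, _, hg, ?_, fun x => ?_, fun x => by ring⟩
  · have hUc : Continuous U := continuous_iff_continuousAt.2 fun x => (hUd x).continuousAt
    fun_prop
  -- The bound 2 on g' = x g + (f - m) is 1 + 1.
  · have h1 : |x * (Real.exp (1 / 2 * x ^ 2) * U x)| ≤ 1 := by
      rw [mul_left_comm, abs_mul, abs_of_pos (Real.exp_pos _)]
      refine le_trans ?_ (he x).le
      exact mul_le_mul_of_nonneg_left (abs_mul_gaussianPrimitive_le hkc hk1 h0 x)
        (Real.exp_pos _).le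
    refine (abs_add_le _ _).trans ?_
    linarith [hk1 x]

/-- Inserting F into Stein's equation and using the kernel turns the difference of expectations into
E[(1 - Q) g'(F)], to which Cauchy-Schwarz applies. -/
theorem abs_integral_sub_le_of_continuous {Ω : Type*} [MeasurableSpace Ω] {μ : Measure Ω}
    [IsProbabilityMeasure μ] {F Q : Ω → ℝ} (hF : IsSteinKernel F Q μ) {f : ℝ → ℝ}
    (hf : Continuous f) (hf0 : ∀ x, 0 ≤ f x) (hf1 : ∀ x, f x ≤ 1) :
    |(∫ ω, f (F ω) ∂μ) - ∫ x, f x ∂gaussianReal 0 1| ≤ 2 * √(∫ ω, (1 - Q ω) ^ 2 ∂μ) := by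
  obtain ⟨g, g', hg, hgc, hg2, heq⟩ := exists_stein_solution hf hf0 hf1
  have hFm := hF.moments.aestronglyMeasurable
  have m1 : HasAllMoments (fun ω => g' (F ω)) μ :=
    (HasAllMoments.const 2).of_le (hgc.comp_aestronglyMeasurable hFm) fun ω => hg2 _
  have hgl : ∀ x, |g x| ≤ |g 0| + 2 * |x| := fun x => by
    have h := convex_univ.norm_image_sub_le_of_norm_hasDerivWithin_le (f := g) (f' := g') (C := 2)
      (fun y _ => (hg y).hasDerivWithinAt) (fun y _ => hg2 y) (Set.mem_univ 0) (Set.mem_univ x)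
    rw [sub_zero, Real.norm_eq_abs, Real.norm_eq_abs] at h
    have := abs_sub_abs_le_abs_sub (g x) (g 0)
    linarith
  have hgcont : Continuous g := continuous_iff_continuousAt.2 fun x => (hg x).continuousAt
  have m0 : HasAllMoments (fun ω => g (F ω)) μ :=
    ((HasAllMoments.const |g 0|).add (hF.moments.abs.const_mul 2)).of_le
      (hgcont.comp_aestronglyMeasurable hFm) fun ω => hgl _
  have hfi : Integrable (fun ω => f (F ω)) μ :=
    Integrable.of_bound (hf.comp_aestronglyMeasurable hFm) 1 (ae_of_all _ fun x => by
      rw [Real.norm_eq_abs, abs_of_nonneg (hf0 _)]; exact hf1 _)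
  have h1 : (∫ ω, f (F ω) ∂μ) - ∫ x, f x ∂gaussianReal 0 1 =
      ∫ ω, (1 - Q ω) * g' (F ω) ∂μ := by
    have e1 : ∫ ω, (g' (F ω) - F ω * g (F ω)) ∂μ =
        (∫ ω, f (F ω) ∂μ) - ∫ x, f x ∂gaussianReal 0 1 := by
      simp only [heq]
      rw [integral_sub hfi (integrable_const _)]
      simp
    rw [← e1, integral_sub m1.integrable (hF.moments.mul m0).integrable,
      hF.integral_mul g g' hg m0.memLp_two m1.memLp_two,
      ← integral_sub m1.integrable (hF.kernel_moments.mul m1).integrable]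
    congr 1
    ext ω
    ring
  rw [h1]
  have hQ1 : HasAllMoments (fun ω => 1 - Q ω) μ := (HasAllMoments.const 1).sub hF.kernel_moments
  refine (abs_integral_mul_le_sqrt hQ1.memLp_two m1.memLp_two).trans ?_
  rw [mul_comm]
  refine mul_le_mul_of_nonneg_right ?_ (Real.sqrt_nonneg _)
  rw [Real.sqrt_le_left (by norm_num)]
  refine (integral_mono_ae m1.memLp_two.integrable_sq (integrable_const ((2 : ℝ) ^ 2))
    (ae_of_all _ fun ω => ?_)).trans_eq (by simp)
  simp only
  rw [← sq_abs]
  exact pow_le_pow_left₀ (abs_nonneg _) (hg2 _) 2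

/-- Indicators of closed sets are limits of continuous thickened indicators. Inner regularity of `ρ`
passes to Borel sets, while `γ` needs only monotonicity; the one-sided form can be used again with
the measures exchanged. -/
theorem measureReal_le_of_continuous {ρ γ : Measure ℝ} [IsProbabilityMeasure ρ]
    [IsProbabilityMeasure γ] {M : ℝ}
    (h : ∀ f : ℝ → ℝ, Continuous f → (∀ x, 0 ≤ f x) → (∀ x, f x ≤ 1) →
      ∫ x, f x ∂ρ ≤ (∫ x, f x ∂γ) + M) {A : Set ℝ} (hA : MeasurableSet A) :
    ρ.real A ≤ γ.real A + M := by
  have hclosed : ∀ K : Set ℝ, IsClosed K → ρ.real K ≤ γ.real K + M := by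
    intro K hK
    have hpos : ∀ n : ℕ, (0 : ℝ) < 1 / ((n : ℝ) + 1) := fun n => by positivity
    have hlim : ∀ (ν : Measure ℝ) [IsProbabilityMeasure ν],
        Tendsto (fun n => ∫ x, (thickenedIndicator (hpos n) K x : ℝ) ∂ν) atTop
          (𝓝 (ν.real K)) := by
      intro ν _
      have h1 := tendsto_lintegral_thickenedIndicator_of_isClosed ν hK hpos
        tendsto_one_div_add_atTop_nhds_zero_nat
      have h2 := (ENNReal.tendsto_toReal (measure_ne_top ν K)).comp h1
      refine h2.congr fun n => ?_
      rw [Function.comp_apply, integral_eq_lintegral_of_nonneg_ae (ae_of_all _ fun _ => NNReal.coe_nonneg _)]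
      · simp
      · exact (NNReal.continuous_coe.comp (thickenedIndicator (hpos n) K).continuous
          ).aestronglyMeasurable
    refine le_of_tendsto_of_tendsto' (hlim ρ) ((hlim γ).add_const M) fun n => ?_
    refine h _ (NNReal.continuous_coe.comp (thickenedIndicator (hpos n) K).continuous)
      (fun _ => NNReal.coe_nonneg _) fun x => ?_
    exact_mod_cast thickenedIndicator_le_one (hpos n) K x
  refine le_of_forall_pos_le_add fun ε hε => ?_
  obtain ⟨K, hKA, hK, hlt⟩ := hA.exists_isClosed_lt_add (measure_ne_top ρ A)
    (ε := ENNReal.ofReal ε) (by simpa using hε)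
  have h1 : ρ.real A ≤ ρ.real K + ε := by
    have := ENNReal.toReal_mono (by finiteness) hlt.le
    rwa [ENNReal.toReal_add (measure_ne_top _ _) (by simp), ENNReal.toReal_ofReal hε.le] at this
  have h2 : γ.real K ≤ γ.real A := measureReal_mono hKA
  linarith [hclosed K hK]

/-- Applied to a normalized bump it preserves the Lipschitz constant 1; applied to the derivative of
the bump it bounds the second derivative of the mollification. -/
theorem lipschitz_convolution {k f : ℝ → ℝ} (hk : Continuous k) (hkc : HasCompactSupport k)
    (hf : LipschitzWith 1 f) (x y : ℝ) :
    |(convolution k f (ContinuousLinearMap.lsmul ℝ ℝ) volume) x -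
      (convolution k f (ContinuousLinearMap.lsmul ℝ ℝ) volume) y| ≤
      (∫ t, |k t|) * |x - y| := by
  have hi : ∀ x, Integrable fun t => k t * f (x - t) := fun x =>
    (hk.mul (hf.continuous.comp (continuous_const.sub continuous_id))).integrable_of_hasCompactSupport
      hkc.mul_right
  simp only [convolution_def, ContinuousLinearMap.lsmul_apply, smul_eq_mul]
  rw [← integral_sub (hi x) (hi y), ← integral_mul_const]
  refine abs_integral_le_integral_abs.trans ?_
  refine integral_mono_ae ((hi x).sub (hi y)).abs
    ((hk.integrable_of_hasCompactSupport hkc).abs.mul_const _) (ae_of_all _ fun t => ?_)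
  simp only
  rw [← mul_sub, abs_mul]
  refine mul_le_mul_of_nonneg_left ?_ (abs_nonneg _)
  have := hf.dist_le_mul (x - t) (y - t)
  simpa [Real.dist_eq] using this

theorem exists_smooth_approx {f : ℝ → ℝ} (hf : LipschitzWith 1 f) {ε : ℝ} (hε : 0 < ε) :
    ∃ φ φ₁ φ₂ : ℝ → ℝ, ∃ A : ℝ, HasSecondDerivGrowth φ φ₁ φ₂ A 0 ∧ (∀ x, |φ₁ x| ≤ 1) ∧
      ∀ x, |φ x - f x| ≤ ε := by
  -- The outer radius ε gives a uniform error at most ε for a 1-Lipschitz function. The inner radius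
  -- is arbitrary.
  let b : ContDiffBump (0 : ℝ) := ⟨ε / 2, ε, by positivity, by linarith⟩
  set k : ℝ → ℝ := b.normed volume with hk
  have hks : ContDiff ℝ (2 : ℕ∞) k := b.contDiff_normed
  have hkc : HasCompactSupport k := b.hasCompactSupport_normed
  have hfl : LocallyIntegrable f volume := hf.continuous.locallyIntegrable
  set φ := convolution k f (ContinuousLinearMap.lsmul ℝ ℝ) volume with hφ
  have hφs : ContDiff ℝ (2 : ℕ∞) φ := hkc.contDiff_convolution_left _ hks hfl
  have hφs' : ContDiff ℝ (1 + 1) φ := hφs.of_le (by norm_num)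
  have hd1 : ∀ x, HasDerivAt φ (convolution (deriv k) f (ContinuousLinearMap.lsmul ℝ ℝ) volume x) x :=
    hkc.hasDerivAt_convolution_left _ (hks.of_le (by norm_num)) hfl
  have hdφ : deriv φ = convolution (deriv k) f (ContinuousLinearMap.lsmul ℝ ℝ) volume :=
    funext fun x => (hd1 x).deriv
  have hk' : ContDiff ℝ 1 (deriv k) := (contDiff_succ_iff_deriv.1 (hks.of_le (by norm_num))).2.2
  have hφ' : ContDiff ℝ 1 (deriv φ) := (contDiff_succ_iff_deriv.1 hφs').2.2
  have h1 : ∫ t, |k t| = 1 := by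
    rw [← b.integral_normed (μ := volume)]
    congr 1
    ext t
    exact abs_of_nonneg (b.nonneg_normed t)
  have hL1 : LipschitzWith 1 φ := LipschitzWith.of_dist_le_mul fun x y => by
    have := lipschitz_convolution hks.continuous hkc hf x y
    rw [h1] at this
    simpa [Real.dist_eq] using this
  set A := ∫ t, |deriv k t| with hA
  have hA0 : 0 ≤ A := integral_nonneg fun _ => abs_nonneg _
  have hL2 : LipschitzWith A.toNNReal (deriv φ) := LipschitzWith.of_dist_le_mul fun x y => by
    rw [hdφ, Real.coe_toNNReal _ hA0]
    exact lipschitz_convolution hk'.continuous hkc.deriv hf x y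
  refine ⟨φ, deriv φ, deriv (deriv φ), A, ⟨fun x => ?_, fun x => ?_, ?_, hA0, le_rfl, fun x => ?_⟩,
    fun x => ?_, fun x => ?_⟩
  · exact (hφs.differentiable (by norm_num) x).hasDerivAt
  · exact (hφ'.differentiable (by norm_num) x).hasDerivAt
  · exact hφ'.continuous_deriv le_rfl
  · have := norm_deriv_le_of_lipschitz (x₀ := x) hL2
    rw [Real.coe_toNNReal _ hA0, Real.norm_eq_abs] at this
    simpa using this
  · simpa using norm_deriv_le_of_lipschitz (x₀ := x) hL1
  · have := b.dist_normed_convolution_le (μ := volume) (g := f) (x₀ := x) (ε := ε)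
      hf.continuous.aestronglyMeasurable fun y hy => ?_
    · exact this
    · have := hf.dist_le_mul y x
      have hy' : dist y x < ε := hy
      simp only [NNReal.coe_one, one_mul] at this
      linarith

end SteinEquation

/-! ### Finite sums in a fixed chaos -/

section FiniteChaos

open MvPolynomial

variable {𝔥 : Type*} [NormedAddCommGroup 𝔥] [InnerProductSpace ℝ 𝔥] (e : HilbertBasis ℕ ℝ 𝔥)

variable (𝔥) in
/-- A constant for the comparison of the `L⁴` and `L²` norms on the `d`-th chaos. -/
def hypercontractiveConst (d : ℕ) : ℝ :=
  ∑ r ∈ Finset.range (d + 1), ((r.factorial : ℝ) * (d.choose r : ℝ) ^ 2) ^ 2 *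
    (2 * d - 2 * r).factorial * ‖symmetrizeL (𝔥 := 𝔥) ((d - r) + (d - r))‖ ^ 2

variable (𝔥) in
theorem hypercontractiveConst_nonneg (d : ℕ) : 0 ≤ hypercontractiveConst 𝔥 d :=
  Finset.sum_nonneg fun r _ => by positivity

/-- A crude substitute for hypercontractivity: E[F⁴] is a sum of squared norms of symmetrized
contractions, and each contraction has norm at most the square of the norm of the kernel. The
constant depends on `d` but not on the number of variables. -/
theorem gaussianExpect_pow_four_le {ι : Type*} [Fintype ι] {v : ι → ℕ}
    (hv : Function.Injective v) {d : ℕ} {a : MvPolynomial ι ℝ} (ha : a.IsHomogeneous d) :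
    gaussianExpect (wick a ^ 4) ≤ hypercontractiveConst 𝔥 d * ‖polyTensor e v d a‖ ^ 4 := by
  rw [gaussianExpect_pow_four_eq ha, hypercontractiveConst, Finset.sum_mul]
  refine Finset.sum_le_sum fun r hr => ?_
  have hr' : r ≤ d := Nat.lt_succ_iff.1 (Finset.mem_range.1 hr)
  rw [chaosNorm_eq e hv hr' ha, mul_assoc _ (_ ^ 2) (_ ^ 4)]
  refine mul_le_mul_of_nonneg_left ?_ (by positivity)
  have h1 := (symmetrizeL ((d - r) + (d - r))).le_opNorm
    (contraction e r (polyTensor e v d a) (polyTensor e v d a))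
  have h2 := norm_contraction_le e hr' hr' (polyTensor e v d a) (polyTensor e v d a)
  rw [← symmetrizeL_apply]
  refine (pow_le_pow_left₀ (norm_nonneg _) (h1.trans
    (mul_le_mul_of_nonneg_left h2 (norm_nonneg _))) 2).trans_eq ?_
  ring

theorem isSteinKernel_wick {ι : Type*} [Fintype ι] {d : ℕ} (hd : d ≠ 0) {a : MvPolynomial ι ℝ}
    (ha : a.IsHomogeneous d) :
    IsSteinKernel (fun x => eval x (wick a)) (fun x => eval x ((d : ℝ)⁻¹ • carreDuChamp a))
      (stdGaussianPi ι) := by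
  refine ⟨fun p hp => memLp_eval _ hp, fun p hp => memLp_eval _ hp, fun g g' hg h0 h1 => ?_⟩
  have h := integral_wick_mul_comp ha hg h0 h1
  have hd' : (d : ℝ) ≠ 0 := by exact_mod_cast hd
  simp only [smul_eval, mul_assoc]
  rw [integral_const_mul, ← h, inv_mul_cancel_left₀ hd']

theorem sum_single_tuple {d : ℕ} (q : MultiIndex d) :
    ∑ l, Finsupp.single (q.tuple l) 1 = q.1 := by
  set L := (Finsupp.toMultiset q.1).sort (· ≤ ·) with hL
  have hlen : L.length = d := by
    rw [hL, Multiset.length_sort, Finsupp.card_toMultiset]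
    exact q.2
  have h1 : List.ofFn q.tuple = L := by
    refine List.ext_getElem (by simp [hlen]) fun i h1 h2 => ?_
    simp [MultiIndex.tuple, ← hL, h2]
  have h2 : ((L : Multiset ℕ).map fun a => Finsupp.single a 1).sum =
      Multiset.toFinsupp (L : Multiset ℕ) := by
    generalize (L : Multiset ℕ) = s
    induction s using Multiset.induction_on with
    | empty => simp
    | cons a s ih =>
      rw [Multiset.map_cons, Multiset.sum_cons, ih, ← Multiset.singleton_add, map_add,
        Multiset.toFinsupp_singleton]
  rw [← List.sum_ofFn]
  have h3 : List.ofFn (fun l => (Finsupp.single (q.tuple l) 1 : ℕ →₀ ℕ)) =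
      L.map fun a => Finsupp.single a 1 := by
    rw [← h1, List.map_ofFn]
    rfl
  rw [h3, ← Multiset.sum_coe, ← Multiset.map_coe, h2, hL, Multiset.sort_eq]
  simp

theorem eval_wick_prod_X {Ω : Type*} (G : ℕ → Ω → ℝ) {d N : ℕ} (q : MultiIndex d)
    {j : Fin d → Fin N} (hj : ∀ l, (j l : ℕ) = q.tuple l) (ω : Ω) :
    eval (fun i : Fin N => G i ω) (wick (∏ l, X (j l))) = hermiteProduct G q.1 ω := by
  have h1 : (∏ l, X (j l) : MvPolynomial (Fin N) ℝ) = monomial (∑ l, Finsupp.single (j l) 1) 1 := by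
    rw [monomial_sum_one]
    rfl
  have h2 : q.1 = (∑ l, Finsupp.single (j l) 1 : Fin N →₀ ℕ).mapDomain Fin.val := by
    rw [Finsupp.mapDomain_finsetSum, ← sum_single_tuple q]
    simp [Finsupp.mapDomain_single, hj]
  rw [h1, wick_monomial, hermiteProduct, h2, Finsupp.prod_mapDomain_index_inj Fin.val_injective,
    Finsupp.prod, Finsupp.prod, map_prod]
  refine Finset.prod_congr rfl fun i _ => ?_
  rw [Polynomial.aeval_def, Polynomial.aeval_def, Polynomial.hom_eval₂, eval_X]
  congr 1
  exact RingHom.ext_int _ _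

variable {Ω : Type*} [MeasurableSpace Ω] {P : Measure Ω} [IsProbabilityMeasure P]
  {G : ℕ → Ω → ℝ}

theorem measurePreserving_gaussian (hGm : ∀ i, Measurable (G i)) (hGi : iIndepFun G P)
    (hG : ∀ i, P.map (G i) = gaussianReal 0 1) (N : ℕ) :
    MeasurePreserving (fun ω (i : Fin N) => G i ω) P (stdGaussianPi (Fin N)) := by
  refine ⟨measurable_pi_lambda _ fun i => hGm i, ?_⟩
  have h := (iIndepFun_iff_map_fun_eq_pi_map fun i => (hGm _).aemeasurable).1
    (hGi.precomp (g := fun i : Fin N => (i : ℕ)) Fin.val_injective)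
  simp only [hG] at h
  exact h

/-- The partial sum `∑_{q ∈ s} c_q Φ(q)`. -/
def chaosSum (G : ℕ → Ω → ℝ) {d : ℕ} (c : MultiIndex d → ℝ) (s : Finset (MultiIndex d))
    (ω : Ω) : ℝ := ∑ q ∈ s, c q * hermiteProduct G q.1 ω

/-- The partial sum `∑_{q ∈ s} c_q ẽ(q)`. -/
def tensorSum {d : ℕ} (c : MultiIndex d → ℝ) (s : Finset (MultiIndex d)) : TensorPower 𝔥 d :=
  ∑ q ∈ s, c q • symmetrize (multiIndexTensor e q)

/-- A finite sum involves finitely many of the Gaussians, so one polynomial represents both the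
random variable and its kernel. -/
theorem exists_poly (G : ℕ → Ω → ℝ) {d : ℕ} (c : MultiIndex d → ℝ)
    (s : Finset (MultiIndex d)) :
    ∃ (N : ℕ) (a : MvPolynomial (Fin N) ℝ), a.IsHomogeneous d ∧
      (∀ ω, eval (fun i : Fin N => G i ω) (wick a) = chaosSum G c s ω) ∧
      polyTensor e Fin.val d a = tensorSum e c s := by
  set N := (s.sup fun q => Finset.univ.sup q.tuple) + 1 with hN
  have hlt : ∀ q ∈ s, ∀ l, q.tuple l < N := fun q hq l =>
    Nat.lt_succ_of_le ((Finset.le_sup (f := q.tuple) (Finset.mem_univ l)).trans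
      (Finset.le_sup (f := fun q : MultiIndex d => Finset.univ.sup q.tuple) hq))
  -- Reduction modulo N is a junk value outside `s`; for `q` in `s` every index is below N and
  -- nothing changes.
  let j : MultiIndex d → Fin d → Fin N := fun q l => Fin.ofNat N (q.tuple l)
  have hj : ∀ q ∈ s, ∀ l, (j q l : ℕ) = q.tuple l := fun q hq l =>
    Nat.mod_eq_of_lt (hlt q hq l)
  refine ⟨N, ∑ q ∈ s, c q • ∏ l, X (j q l), ?_, fun ω => ?_, ?_⟩
  · refine IsHomogeneous.sum _ _ _ fun q _ => (homogeneousSubmodule _ ℝ d).smul_mem _ ?_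
    have := IsHomogeneous.prod Finset.univ (fun l => (X (j q l) : MvPolynomial (Fin N) ℝ))
      (fun _ => 1) fun l _ => isHomogeneous_X ℝ _
    simpa using this
  · simp only [map_sum, map_smul, smul_eval, chaosSum]
    exact Finset.sum_congr rfl fun q hq => by rw [eval_wick_prod_X G q (hj q hq)]
  · simp only [map_sum, map_smul, polyTensor_prod_X, tensorSum]
    refine Finset.sum_congr rfl fun q hq => ?_
    simp only [hj q hq]
    rfl

theorem finite_chaos (hGm : ∀ i, Measurable (G i)) (hGi : iIndepFun G P)
    (hG : ∀ i, P.map (G i) = gaussianReal 0 1) {d : ℕ} (hd : 1 ≤ d) (c : MultiIndex d → ℝ)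
    (s : Finset (MultiIndex d)) :
    (∃ Q : Ω → ℝ, IsSteinKernel (chaosSum G c s) Q P ∧
      ∫ ω, (1 - Q ω) ^ 2 ∂P =
        (1 - ∫ ω, chaosSum G c s ω ^ 2 ∂P) ^ 2 + T₁ e (tensorSum e c s) ^ 2) ∧
    T₁ e (tensorSum e c s) ^ 2 ≤ ((d : ℝ) - 1) / (3 * d) *
      ((∫ ω, chaosSum G c s ω ^ 4 ∂P) - 3 * (∫ ω, chaosSum G c s ω ^ 2 ∂P) ^ 2) ∧
    ∫ ω, chaosSum G c s ω ^ 4 ∂P ≤ hypercontractiveConst 𝔥 d * ‖tensorSum e c s‖ ^ 4 := by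
  obtain ⟨N, a, ha, hF, hh⟩ := exists_poly e G c s
  have hmp := measurePreserving_gaussian hGm hGi hG N
  have htr : ∀ p : MvPolynomial (Fin N) ℝ,
      ∫ ω, eval (fun i : Fin N => G i ω) p ∂P = gaussianExpect p := fun p => by
    rw [gaussianExpect_apply, ← hmp.map_eq, integral_map hmp.measurable.aemeasurable
      (measurable_eval p).aestronglyMeasurable]
  have h2 : ∫ ω, chaosSum G c s ω ^ 2 ∂P = gaussianExpect (wick a * wick a) := by
    simp only [← htr, map_mul, ← hF, sq]
  have h4 : ∫ ω, chaosSum G c s ω ^ 4 ∂P = gaussianExpect (wick a ^ 4) := by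
    simp only [← htr, map_pow, ← hF]
  have hT := T₁_polyTensor_sq e Fin.val_injective ha
  rw [hh] at hT
  refine ⟨⟨fun ω => eval (fun i : Fin N => G i ω) ((d : ℝ)⁻¹ • carreDuChamp a), ?_, ?_⟩, ?_, ?_⟩
  · have h := (isSteinKernel_wick (by omega) ha).comp hmp
    simp only [hF] at h
    exact h
  · have h := gaussianExpect_one_sub_sq hd ha
    rw [h2, hT, ← h, ← htr]
    simp only [map_mul, map_sub, map_one, sq]
  · rw [hT, h2, h4]
    exact sum_chaosNorm_le hd ha
  · rw [h4, ← hh]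
    exact gaussianExpect_pow_four_le e Fin.val_injective ha

end FiniteChaos

/-! ### Approximation of a general element of the chaos -/

section Limit

variable {𝔥 : Type*} [NormedAddCommGroup 𝔥] [InnerProductSpace ℝ 𝔥]
  {Ω : Type*} [MeasurableSpace Ω] {P : Measure Ω} [IsProbabilityMeasure P]

theorem integral_pow_eq_toReal_eLpNorm {X : Ω → ℝ} {p : ℕ} (hp : p ≠ 0) (he : Even p)
    (hX : MemLp X p P) : ∫ ω, X ω ^ p ∂P = (eLpNorm X p P).toReal ^ p := by
  have h0 : (p : ℝ) ≠ 0 := by exact_mod_cast hp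
  have h1 : 0 ≤ ∫ ω, X ω ^ p ∂P := integral_nonneg fun ω => he.pow_nonneg _
  rw [hX.eLpNorm_eq_integral_rpow_norm (by exact_mod_cast hp) (by simp)]
  simp only [ENNReal.toReal_natCast, Real.rpow_natCast, Real.norm_eq_abs, he.pow_abs]
  rw [ENNReal.toReal_ofReal (by positivity), ← Real.rpow_natCast, ← Real.rpow_mul h1,
    inv_mul_cancel₀ h0, Real.rpow_one]

theorem tendsto_integral_pow {X : ℕ → Ω → ℝ} {Y : Ω → ℝ} {p : ℕ} (hp : 1 ≤ p) (he : Even p)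
    (hX : ∀ n, MemLp (X n) p P) (hY : MemLp Y p P)
    (h : Tendsto (fun n => eLpNorm (X n - Y) p P) atTop (𝓝 0)) :
    Tendsto (fun n => ∫ ω, X n ω ^ p ∂P) atTop (𝓝 (∫ ω, Y ω ^ p ∂P)) := by
  have : Fact ((1 : ℝ≥0∞) ≤ p) := ⟨by exact_mod_cast hp⟩
  have h1 := ((Lp.tendsto_Lp_iff_tendsto_eLpNorm'' X hX Y hY).2 h).norm
  simp only [integral_pow_eq_toReal_eLpNorm (by omega : p ≠ 0) he, hX, hY]
  simp only [Lp.norm_toLp] at h1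
  exact h1.pow p

theorem integrable_pow_four {X : Ω → ℝ} (hX : MemLp X 4 P) : Integrable (fun ω => X ω ^ 4) P := by
  have := hX.integrable_norm_pow (p := 4) (by norm_num)
  simpa [Even.pow_abs (show Even 4 by decide)] using this

theorem memLp_two_sq {X : Ω → ℝ} (hX : MemLp X 4 P) : MemLp (fun ω => X ω ^ 2) 2 P := by
  refine (memLp_two_iff_integrable_sq (hX.aestronglyMeasurable.pow 2)).2 ?_
  refine (integrable_pow_four hX).congr (ae_of_all _ fun ω => ?_)
  simp only [Pi.pow_apply]
  ring

theorem memLp_two_quadratic {X Y : Ω → ℝ} (hX : MemLp X 4 P) (hY : MemLp Y 4 P) :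
    MemLp (fun ω => 1 + 2 * X ω ^ 2 + 2 * Y ω ^ 2) 2 P := by
  have h1 : MemLp (fun _ : Ω => (1 : ℝ)) 2 P := memLp_const 1
  have h2 : MemLp (fun ω => 2 * X ω ^ 2) 2 P := (memLp_two_sq hX).const_mul 2
  have h3 : MemLp (fun ω => 2 * Y ω ^ 2) 2 P := (memLp_two_sq hY).const_mul 2
  exact (h1.add h2).add h3

theorem integral_quadratic_sq_le {X Y : Ω → ℝ} (hX : MemLp X 4 P) (hY : MemLp Y 4 P) :
    ∫ ω, (1 + 2 * X ω ^ 2 + 2 * Y ω ^ 2) ^ 2 ∂P ≤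
      3 + 12 * (∫ ω, X ω ^ 4 ∂P) + 12 * ∫ ω, Y ω ^ 4 ∂P := by
  have i1 : Integrable (fun ω => 12 * X ω ^ 4) P := (integrable_pow_four hX).const_mul 12
  have i2 : Integrable (fun ω => 12 * Y ω ^ 4) P := (integrable_pow_four hY).const_mul 12
  have i3 : Integrable (fun ω => 3 + 12 * X ω ^ 4) P := (integrable_const 3).add i1
  have i4 : ∫ ω, (3 + 12 * X ω ^ 4 + 12 * Y ω ^ 4) ∂P =
      3 + 12 * (∫ ω, X ω ^ 4 ∂P) + 12 * ∫ ω, Y ω ^ 4 ∂P := by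
    rw [integral_add i3 i2, integral_add (integrable_const 3) i1, integral_const_mul,
      integral_const_mul]
    simp
  rw [← i4]
  refine integral_mono_ae (memLp_two_quadratic hX hY).integrable_sq (i3.add i2)
    (ae_of_all _ fun ω => ?_)
  simp only
  generalize X ω = x
  generalize Y ω = y
  nlinarith [sq_nonneg (1 - 2 * x ^ 2), sq_nonneg (1 - 2 * y ^ 2),
    sq_nonneg (2 * x ^ 2 - 2 * y ^ 2)]

/-- The local Lipschitz constant is replaced by a quadratic weight, which is square integrable as
soon as fourth moments exist. This suits the limit F, for which only L⁴ is established. -/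
theorem HasSecondDerivGrowth.abs_sub_le_quadratic {φ φ₁ φ₂ : ℝ → ℝ} {A B : ℝ}
    (hφ : HasSecondDerivGrowth φ φ₁ φ₂ A B) (b a : ℝ) :
    |φ b - φ a| ≤ (|φ₁ 0| + A + B) * ((1 + 2 * b ^ 2 + 2 * a ^ 2) * |b - a|) := by
  refine (hφ.abs_sub_le a b).trans ?_
  rw [← mul_assoc]
  refine mul_le_mul_of_nonneg_right ?_ (abs_nonneg _)
  rw [← sq_abs a, ← sq_abs b]
  have hx : 0 ≤ |a| := abs_nonneg _
  have hy : 0 ≤ |b| := abs_nonneg _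
  generalize |a| = x at *
  generalize |b| = y at *
  have k1 : x + y ≤ 1 + 2 * y ^ 2 + 2 * x ^ 2 := by
    nlinarith [sq_nonneg (x - 1 / 4), sq_nonneg (y - 1 / 4)]
  have k2 : (x + y) ^ 2 ≤ 1 + 2 * y ^ 2 + 2 * x ^ 2 := by nlinarith [sq_nonneg (x - y)]
  have k0 : 1 ≤ 1 + 2 * y ^ 2 + 2 * x ^ 2 := by nlinarith [sq_nonneg x, sq_nonneg y]
  have := mul_le_mul_of_nonneg_left k0 (abs_nonneg (φ₁ 0))
  have := mul_le_mul_of_nonneg_left k1 hφ.nonneg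
  have := mul_le_mul_of_nonneg_left k2 hφ.nonneg'
  linarith

theorem abs_integral_sub_le_of_close {X : Ω → ℝ} {f g : ℝ → ℝ} {ε : ℝ}
    (hfg : ∀ x, |f x - g x| ≤ ε) (hf : Integrable (fun ω => f (X ω)) P)
    (hg : Integrable (fun ω => g (X ω)) P) :
    |(∫ ω, f (X ω) ∂P) - ∫ ω, g (X ω) ∂P| ≤ ε := by
  rw [← integral_sub hf hg]
  have := norm_integral_le_of_norm_le_const (μ := P) (C := ε)
    (f := fun ω => f (X ω) - g (X ω)) (ae_of_all _ fun ω => hfg (X ω))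
  simpa using this

/-- The random variables `Fn n` are finite sums in the `d`-th chaos which approximate `F`, and
their kernels `t n` approximate `h`. -/
structure IsChaosApprox (P : Measure Ω) (e : HilbertBasis ℕ ℝ 𝔥) {d : ℕ} (h : TensorPower 𝔥 d)
    (F : Ω → ℝ) (Fn : ℕ → Ω → ℝ) (t : ℕ → TensorPower 𝔥 d) : Prop where
  tendsto_tensor : Tendsto t atTop (𝓝 h)
  kernel : ∀ n, ∃ Q : Ω → ℝ, IsSteinKernel (Fn n) Q P ∧
    ∫ ω, (1 - Q ω) ^ 2 ∂P = (1 - ∫ ω, Fn n ω ^ 2 ∂P) ^ 2 + T₁ e (t n) ^ 2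
  fourth : ∀ n, T₁ e (t n) ^ 2 ≤ ((d : ℝ) - 1) / (3 * d) *
    ((∫ ω, Fn n ω ^ 4 ∂P) - 3 * (∫ ω, Fn n ω ^ 2 ∂P) ^ 2)
  hypercontractive : ∀ n m, ∫ ω, (Fn n ω - Fn m ω) ^ 4 ∂P ≤
    hypercontractiveConst 𝔥 d * ‖t n - t m‖ ^ 4
  memLp_two : MemLp F 2 P
  tendsto_two : Tendsto (fun n => eLpNorm (Fn n - F) 2 P) atTop (𝓝 0)
  tendsto_ae : ∀ᵐ ω ∂P, Tendsto (fun n => Fn n ω) atTop (𝓝 (F ω))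

theorem sum_union_indicator_sub_smul {ι E : Type*} [DecidableEq ι] [AddCommGroup E] [Module ℝ E]
    (u w : Finset ι) (c : ι → ℝ) (f : ι → E) :
    ∑ q ∈ u ∪ w, (((if q ∈ u then 1 else 0) - if q ∈ w then 1 else 0) * c q) • f q =
      ∑ q ∈ u, c q • f q - ∑ q ∈ w, c q • f q := by
  simp only [sub_mul, ite_mul, one_mul, zero_mul, sub_smul, ite_smul, zero_smul,
    Finset.sum_sub_distrib, Finset.sum_ite_mem]
  rw [Finset.union_inter_cancel_left, Finset.union_inter_cancel_right]

/-- A difference of two partial sums is again a finite chaos sum, over the union of the index sets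
and with coefficients corrected by indicators. -/
theorem integral_chaosSum_sub_pow_four_le (e : HilbertBasis ℕ ℝ 𝔥) {G : ℕ → Ω → ℝ}
    (hGm : ∀ i, Measurable (G i)) (hGi : iIndepFun G P)
    (hG : ∀ i, P.map (G i) = gaussianReal 0 1) {d : ℕ} (hd : 1 ≤ d) (c : MultiIndex d → ℝ)
    (u w : Finset (MultiIndex d)) :
    ∫ ω, (chaosSum G c u ω - chaosSum G c w ω) ^ 4 ∂P ≤
      hypercontractiveConst 𝔥 d * ‖tensorSum e c u - tensorSum e c w‖ ^ 4 := by
  classical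
  have h1 := (finite_chaos e hGm hGi hG hd
    (fun q => ((if q ∈ u then 1 else 0) - if q ∈ w then 1 else 0) * c q) (u ∪ w)).2.2
  have h2 : ∀ ω, chaosSum G (fun q => ((if q ∈ u then 1 else 0) - if q ∈ w then 1 else 0) * c q)
      (u ∪ w) ω = chaosSum G c u ω - chaosSum G c w ω := fun ω =>
    sum_union_indicator_sub_smul u w c fun q => hermiteProduct G q.1 ω
  have h3 : tensorSum e (fun q => ((if q ∈ u then 1 else 0) - if q ∈ w then 1 else 0) * c q)
      (u ∪ w) = tensorSum e c u - tensorSum e c w :=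
    sum_union_indicator_sub_smul u w c fun q => symmetrize (multiIndexTensor e q)
  rw [h3] at h1
  simpa only [h2] using h1

theorem exists_isChaosApprox (e : HilbertBasis ℕ ℝ 𝔥) {G : ℕ → Ω → ℝ}
    (hGm : ∀ i, Measurable (G i)) (hGi : iIndepFun G P)
    (hG : ∀ i, P.map (G i) = gaussianReal 0 1) {d : ℕ} (hd : 1 ≤ d) {h : TensorPower 𝔥 d}
    {F : Ω → ℝ} (hF : IsMultipleIntegral P G e h F) :
    ∃ Fn t, IsChaosApprox P e h F Fn t := by
  obtain ⟨hF2, c, hc, hL⟩ := hF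
  obtain ⟨s, hs⟩ := exists_seq_tendsto (atTop : Filter (Finset (MultiIndex d)))
  have hfin := fun (c : MultiIndex d → ℝ) (s : Finset (MultiIndex d)) =>
    finite_chaos e hGm hGi hG hd c s
  have hm : ∀ n, AEStronglyMeasurable (chaosSum G c (s n)) P := fun n => by
    obtain ⟨Q, hQ, _⟩ := (hfin c (s n)).1
    exact hQ.moments.aestronglyMeasurable
  have hL' : Tendsto (fun n => eLpNorm (chaosSum G c (s n) - F) 2 P) atTop (𝓝 0) := by
    refine (hL.comp hs).congr fun n => ?_
    rw [eLpNorm_sub_comm]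
    rfl
  -- A subsequence is taken to have almost sure convergence, for Fatou's lemma and dominated
  -- convergence later.
  obtain ⟨ns, hns, hae⟩ := (tendstoInMeasure_of_tendsto_eLpNorm (by simp) hm
    hF2.aestronglyMeasurable hL').exists_seq_tendsto_ae
  refine ⟨fun n => chaosSum G c (s (ns n)), fun n => tensorSum e c (s (ns n)),
    (hc.comp hs).comp hns.tendsto_atTop, fun n => (hfin c _).1, fun n => (hfin c _).2.1,
    fun n m => integral_chaosSum_sub_pow_four_le e hGm hGi hG hd c _ _, hF2, hL'.comp hns.tendsto_atTop, hae⟩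

/-! ### Passage to the limit -/

namespace IsChaosApprox

variable {e : HilbertBasis ℕ ℝ 𝔥} {d : ℕ} {h : TensorPower 𝔥 d} {F : Ω → ℝ} {Fn : ℕ → Ω → ℝ}
  {t : ℕ → TensorPower 𝔥 d}

theorem moments (H : IsChaosApprox P e h F Fn t) (n : ℕ) : HasAllMoments (Fn n) P := by
  obtain ⟨Q, hQ, _⟩ := H.kernel n
  exact hQ.moments

theorem eLpNorm_four_le (H : IsChaosApprox P e h F Fn t) (n : ℕ) :
    eLpNorm (Fn n - F) 4 P ≤
      ENNReal.ofReal ((hypercontractiveConst 𝔥 d) ^ (4⁻¹ : ℝ) * ‖t n - h‖) := by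
  have h1 : ∀ m, eLpNorm (Fn n - Fn m) 4 P ≤
      ENNReal.ofReal ((hypercontractiveConst 𝔥 d) ^ (4⁻¹ : ℝ) * ‖t n - t m‖) := by
    intro m
    have hX : MemLp (Fn n - Fn m) (4 : ℕ) P := ((H.moments n).sub (H.moments m)) _ (by simp)
    have h2 := hX.eLpNorm_eq_integral_rpow_norm (by simp) (by simp)
    have h3 : (fun ω => ‖(Fn n - Fn m) ω‖ ^ ((4 : ℕ) : ℝ≥0∞).toReal) =
        fun ω => (Fn n ω - Fn m ω) ^ 4 := by
      ext ω
      rw [ENNReal.toReal_natCast, Real.rpow_natCast, Real.norm_eq_abs,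
        Even.pow_abs (by decide)]
      rfl
    rw [h3, ENNReal.toReal_natCast] at h2
    have h4 : ((4 : ℕ) : ℝ≥0∞) = 4 := rfl
    rw [h4] at h2
    rw [h2]
    refine ENNReal.ofReal_le_ofReal ?_
    have hC := hypercontractiveConst_nonneg 𝔥 d
    calc (∫ ω, (Fn n ω - Fn m ω) ^ 4 ∂P) ^ (((4 : ℕ) : ℝ)⁻¹)
        ≤ (hypercontractiveConst 𝔥 d * ‖t n - t m‖ ^ 4) ^ (((4 : ℕ) : ℝ)⁻¹) :=
          Real.rpow_le_rpow (integral_nonneg fun ω => Even.pow_nonneg (by decide) _)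
            (H.hypercontractive n m) (by positivity)
      _ = _ := by
          rw [Real.mul_rpow hC (by positivity), ← Real.rpow_natCast ‖t n - t m‖ 4,
            ← Real.rpow_mul (norm_nonneg _), mul_inv_cancel₀ (by norm_num), Real.rpow_one]
          norm_num
  have hlim : ∀ᵐ ω ∂P, Tendsto (fun m => (Fn n - Fn m) ω) atTop (𝓝 ((Fn n - F) ω)) := by
    filter_upwards [H.tendsto_ae] with ω hω
    exact hω.const_sub _
  -- Fatou's lemma as m → ∞ turns the Cauchy estimate in L⁴ into an estimate for the limit, and so
  -- puts F in L⁴.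
  refine (Lp.eLpNorm_lim_le_liminf_eLpNorm (fun m =>
    ((H.moments n).sub (H.moments m)).aestronglyMeasurable) _ hlim).trans ?_
  refine (liminf_le_liminf (Eventually.of_forall h1)).trans_eq ?_
  refine Tendsto.liminf_eq (ENNReal.tendsto_ofReal ?_)
  exact (H.tendsto_tensor.const_sub (t n)).norm.const_mul _

theorem tendsto_four (H : IsChaosApprox P e h F Fn t) :
    Tendsto (fun n => eLpNorm (Fn n - F) 4 P) atTop (𝓝 0) := by
  refine tendsto_of_tendsto_of_tendsto_of_le_of_le tendsto_const_nhds ?_ (fun _ => zero_le)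
    H.eLpNorm_four_le
  have h1 : Tendsto (fun n => (hypercontractiveConst 𝔥 d) ^ (4⁻¹ : ℝ) * ‖t n - h‖) atTop
      (𝓝 0) := by
    simpa using (tendsto_iff_norm_sub_tendsto_zero.1 H.tendsto_tensor).const_mul
      ((hypercontractiveConst 𝔥 d) ^ (4⁻¹ : ℝ))
  simpa using ENNReal.tendsto_ofReal h1

theorem aestronglyMeasurable (H : IsChaosApprox P e h F Fn t) : AEStronglyMeasurable F P :=
  H.memLp_two.aestronglyMeasurable

theorem memLp_four (H : IsChaosApprox P e h F Fn t) : MemLp F 4 P := by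
  have h1 : MemLp (Fn 0 - F) 4 P :=
    ⟨(H.moments 0).aestronglyMeasurable.sub H.aestronglyMeasurable,
      (H.eLpNorm_four_le 0).trans_lt ENNReal.ofReal_lt_top⟩
  simpa using ((H.moments 0) 4 (by simp)).sub h1

theorem tendsto_integral_four (H : IsChaosApprox P e h F Fn t) :
    Tendsto (fun n => ∫ ω, Fn n ω ^ 4 ∂P) atTop (𝓝 (∫ ω, F ω ^ 4 ∂P)) :=
  tendsto_integral_pow (by norm_num) (by decide) (fun n => H.moments n _ (by simp))
    H.memLp_four H.tendsto_four

theorem tendsto_integral_two (H : IsChaosApprox P e h F Fn t) :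
    Tendsto (fun n => ∫ ω, Fn n ω ^ 2 ∂P) atTop (𝓝 (∫ ω, F ω ^ 2 ∂P)) :=
  tendsto_integral_pow (by norm_num) (by decide) (fun n => H.moments n _ (by simp))
    H.memLp_two H.tendsto_two

theorem tendsto_T₁ (H : IsChaosApprox P e h F Fn t) :
    Tendsto (fun n => T₁ e (t n)) atTop (𝓝 (T₁ e h)) :=
  ((continuous_T₁ e d).tendsto h).comp H.tendsto_tensor

theorem T₁_le_T₂ (H : IsChaosApprox P e h F Fn t) (hd : 1 ≤ d) (hF : ∫ ω, F ω ^ 2 ∂P = 1) :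
    T₁ e h ≤ T₂ P d F := by
  have h1 : T₁ e h ^ 2 ≤ ((d : ℝ) - 1) / (3 * d) * ((∫ ω, F ω ^ 4 ∂P) - 3 * 1 ^ 2) := by
    have h2 := H.tendsto_integral_two
    rw [hF] at h2
    exact le_of_tendsto_of_tendsto' (H.tendsto_T₁.pow 2)
      ((H.tendsto_integral_four.sub ((h2.pow 2).const_mul 3)).const_mul _) H.fourth
  have hd' : (1 : ℝ) ≤ d := by exact_mod_cast hd
  refine Real.le_sqrt_of_sq_le (h1.trans ?_)
  rw [one_pow, mul_one]
  exact mul_le_mul_of_nonneg_left (le_abs_self _)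
    (div_nonneg (by linarith) (by linarith))

/-- The variance defect of the approximations vanishes in the limit, so only T₁ remains of E[(1 -
Q)²]. -/
theorem tendsto_sqrt (H : IsChaosApprox P e h F Fn t) (hF : ∫ ω, F ω ^ 2 ∂P = 1) :
    Tendsto (fun n => √((1 - ∫ ω, Fn n ω ^ 2 ∂P) ^ 2 + T₁ e (t n) ^ 2)) atTop
      (𝓝 (T₁ e h)) := by
  have h1 := H.tendsto_integral_two
  rw [hF] at h1
  have h2 := (((h1.const_sub 1).pow 2).add (H.tendsto_T₁.pow 2)).sqrt
  rwa [sub_self, zero_pow two_ne_zero, zero_add, Real.sqrt_sq (show 0 ≤ T₁ e h from Real.sqrt_nonneg _)] at h2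

theorem abs_integral_sub_le_of_continuous (H : IsChaosApprox P e h F Fn t)
    (hF : ∫ ω, F ω ^ 2 ∂P = 1) {f : ℝ → ℝ} (hf : Continuous f) (hf0 : ∀ x, 0 ≤ f x)
    (hf1 : ∀ x, f x ≤ 1) :
    |(∫ ω, f (F ω) ∂P) - ∫ x, f x ∂gaussianReal 0 1| ≤ 2 * T₁ e h := by
  have h1 : Tendsto (fun n => ∫ ω, f (Fn n ω) ∂P) atTop (𝓝 (∫ ω, f (F ω) ∂P)) := by
    refine tendsto_integral_of_dominated_convergence (fun _ => 1)
      (fun n => hf.comp_aestronglyMeasurable (H.moments n).aestronglyMeasurable)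
      (integrable_const 1) (fun n => ae_of_all _ fun ω => ?_) ?_
    · rw [Real.norm_eq_abs, abs_of_nonneg (hf0 _)]; exact hf1 _
    · filter_upwards [H.tendsto_ae] with ω hω
      exact (hf.tendsto _).comp hω
  refine le_of_tendsto_of_tendsto' (h1.sub_const _).abs ((H.tendsto_sqrt hF).const_mul 2)
    fun n => ?_
  obtain ⟨Q, hQ, hQ2⟩ := H.kernel n
  rw [← hQ2]
  exact WienerChaos.abs_integral_sub_le_of_continuous hQ hf hf0 hf1

variable {φ φ₁ φ₂ : ℝ → ℝ} {A B : ℝ}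

/-- The growth of φ is at most cubic, hence dominated by 1 + F⁴ up to constants. -/
theorem integrable_comp (H : IsChaosApprox P e h F Fn t)
    (hφ : HasSecondDerivGrowth φ φ₁ φ₂ A B) : Integrable (fun ω => φ (F ω)) P := by
  have h4 := integrable_pow_four H.memLp_four
  have hA := hφ.nonneg
  have hB := hφ.nonneg'
  refine Integrable.mono' (((h4.const_mul (|φ₁ 0| + A + B)).add
    (integrable_const (|φ 0| + |φ₁ 0| + A + B))))
    (hφ.continuous_zero.comp_aestronglyMeasurable H.aestronglyMeasurable)
    (ae_of_all _ fun ω => (hφ.le_zero _).trans ?_)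
  simp only [Pi.add_apply]
  have e4 : F ω ^ 4 = |F ω| ^ 4 := (Even.pow_abs (show Even 4 by decide) _).symm
  rw [e4]
  set r := |F ω|
  have hr : 0 ≤ r := abs_nonneg _
  have r1 : r ≤ 1 + r ^ 4 := by nlinarith [sq_nonneg (r ^ 2 - 1), sq_nonneg (r - 1)]
  have r2 : r ^ 2 ≤ 1 + r ^ 4 := by nlinarith [sq_nonneg (r ^ 2 - 1)]
  have r3 : r ^ 3 ≤ 1 + r ^ 4 := by
    nlinarith [sq_nonneg (r ^ 2 - r), sq_nonneg (r ^ 2 - 1), sq_nonneg (r - 1)]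
  have := mul_le_mul_of_nonneg_left r1 (abs_nonneg (φ₁ 0))
  have := mul_le_mul_of_nonneg_left r2 hA
  have := mul_le_mul_of_nonneg_left r3 hB
  nlinarith

theorem abs_integral_comp_sub_le (H : IsChaosApprox P e h F Fn t)
    (hφ : HasSecondDerivGrowth φ φ₁ φ₂ A B) (n : ℕ) :
    |(∫ ω, φ (Fn n ω) ∂P) - ∫ ω, φ (F ω) ∂P| ≤
      (|φ₁ 0| + A + B) * (√(3 + 12 * (∫ ω, Fn n ω ^ 4 ∂P) + 12 * ∫ ω, F ω ^ 4 ∂P) *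
        √(∫ ω, |Fn n ω - F ω| ^ 2 ∂P)) := by
  have hK0 : 0 ≤ |φ₁ 0| + A + B := add_nonneg (add_nonneg (abs_nonneg _) hφ.nonneg) hφ.nonneg'
  have hFn4 : MemLp (Fn n) 4 P := H.moments n 4 (by simp)
  have hW := memLp_two_quadratic hFn4 H.memLp_four
  have hD : MemLp (fun ω => |Fn n ω - F ω|) 2 P := ((H.moments n).memLp_two.sub H.memLp_two).norm
  rw [← integral_sub (hφ.hasAllMoments_zero (H.moments n)).integrable (H.integrable_comp hφ)]
  have hle : |∫ ω, (φ (Fn n ω) - φ (F ω)) ∂P| ≤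
      ∫ ω, (|φ₁ 0| + A + B) * ((1 + 2 * Fn n ω ^ 2 + 2 * F ω ^ 2) * |Fn n ω - F ω|) ∂P :=
    abs_integral_le_integral_abs.trans (integral_mono_ae
      ((hφ.hasAllMoments_zero (H.moments n)).integrable.sub (H.integrable_comp hφ)).abs
      ((hW.integrable_mul hD).const_mul _) (ae_of_all _ fun ω => hφ.abs_sub_le_quadratic _ _))
  refine hle.trans ?_
  rw [integral_const_mul]
  refine mul_le_mul_of_nonneg_left ?_ hK0
  refine (le_abs_self _).trans ((abs_integral_mul_le_sqrt hW hD).trans ?_)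
  exact mul_le_mul_of_nonneg_right
    (Real.sqrt_le_sqrt (integral_quadratic_sq_le hFn4 H.memLp_four)) (Real.sqrt_nonneg _)

/-- Cauchy-Schwarz separates the weight, bounded in L² by convergent fourth moments, from F_n - F,
which tends to 0 in L². -/
theorem tendsto_integral_comp (H : IsChaosApprox P e h F Fn t)
    (hφ : HasSecondDerivGrowth φ φ₁ φ₂ A B) :
    Tendsto (fun n => ∫ ω, φ (Fn n ω) ∂P) atTop (𝓝 (∫ ω, φ (F ω) ∂P)) := by
  have hD0 : Tendsto (fun n => ∫ ω, |Fn n ω - F ω| ^ 2 ∂P) atTop (𝓝 0) := by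
    have := tendsto_integral_pow (X := fun n => Fn n - F) (Y := 0) (p := 2) (P := P) (by norm_num)
      (by decide) (fun n => (H.moments n).memLp_two.sub H.memLp_two) MemLp.zero
      (by simpa using H.tendsto_two)
    simpa using this
  rw [tendsto_iff_norm_sub_tendsto_zero]
  refine squeeze_zero (fun _ => norm_nonneg _) (H.abs_integral_comp_sub_le hφ) ?_
  have h1 := ((((H.tendsto_integral_four.const_mul 12).const_add 3).add_const
    (12 * ∫ ω, F ω ^ 4 ∂P)).sqrt.mul hD0.sqrt).const_mul (|φ₁ 0| + A + B)
  rwa [Real.sqrt_zero, mul_zero, mul_zero] at h1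

theorem abs_integral_sub_le_of_smooth_lipschitz (H : IsChaosApprox P e h F Fn t)
    (hF : ∫ ω, F ω ^ 2 ∂P = 1) (hφ : HasSecondDerivGrowth φ φ₁ φ₂ A B) (h1 : ∀ x, |φ₁ x| ≤ 1) :
    |(∫ ω, φ (F ω) ∂P) - ∫ x, φ x ∂gaussianReal 0 1| ≤ T₁ e h := by
  refine le_of_tendsto_of_tendsto' ((H.tendsto_integral_comp hφ).sub_const _).abs
    (H.tendsto_sqrt hF) fun n => ?_
  obtain ⟨Q, hQ, hQ2⟩ := H.kernel n
  rw [← hQ2]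
  exact abs_integral_sub_le_of_lipschitz hφ h1 hQ

theorem abs_integral_sub_le_of_growth (H : IsChaosApprox P e h F Fn t)
    (hF : ∫ ω, F ω ^ 2 ∂P = 1) (hφ : HasSecondDerivGrowth φ φ₁ φ₂ A B) :
    |(∫ ω, φ (F ω) ∂P) - ∫ x, φ x ∂gaussianReal 0 1| ≤
      2 * √(2 * A ^ 2 + 4 * B ^ 2 * (1 + 1)) * T₁ e h := by
  have h2 := H.tendsto_integral_two
  rw [hF] at h2
  refine le_of_tendsto_of_tendsto' ((H.tendsto_integral_comp hφ).sub_const _).abs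
    (((((h2.const_add 1).const_mul (4 * B ^ 2)).const_add (2 * A ^ 2)).sqrt.const_mul 2).mul
      (H.tendsto_sqrt hF)) fun n => ?_
  obtain ⟨Q, hQ, hQ2⟩ := H.kernel n
  rw [← hQ2]
  exact WienerChaos.abs_integral_sub_le_of_growth hφ hQ

theorem integrable_lipschitz (H : IsChaosApprox P e h F Fn t) {f : ℝ → ℝ}
    (hf : LipschitzWith 1 f) : Integrable (fun ω => f (F ω)) P := by
  refine Integrable.mono' ((H.memLp_two.integrable (by simp)).abs.add (integrable_const |f 0|))
    (hf.continuous.comp_aestronglyMeasurable H.aestronglyMeasurable) (ae_of_all _ fun ω => ?_)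
  have := hf.dist_le_mul (F ω) 0
  simp only [NNReal.coe_one, one_mul, Real.dist_eq, sub_zero] at this
  have := abs_sub_abs_le_abs_sub (f (F ω)) (f 0)
  simp only [Pi.add_apply, Real.norm_eq_abs]
  linarith

/-- The smooth bound is applied to a mollification within ε/2 of `f`; the replacement costs ε/2
under the law of F and ε/2 under the Gaussian law. -/
theorem abs_integral_sub_le_of_lipschitz (H : IsChaosApprox P e h F Fn t)
    (hF : ∫ ω, F ω ^ 2 ∂P = 1) {f : ℝ → ℝ} (hf : LipschitzWith 1 f) :
    |(∫ ω, f (F ω) ∂P) - ∫ x, f x ∂gaussianReal 0 1| ≤ T₁ e h := by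
  refine le_of_forall_pos_le_add fun ε hε => ?_
  obtain ⟨φ, φ₁, φ₂, A, hφ, h1, hfφ⟩ := exists_smooth_approx hf (half_pos hε)
  have hb := H.abs_integral_sub_le_of_smooth_lipschitz hF hφ h1
  have c1 := abs_integral_sub_le_of_close hfφ (H.integrable_comp hφ) (H.integrable_lipschitz hf)
  have iZ : Integrable f (gaussianReal 0 1) := by
    refine Integrable.mono' (hasAllMoments_id_gaussianReal.abs.integrable.add
      (integrable_const |f 0|)) hf.continuous.aestronglyMeasurable (ae_of_all _ fun x => ?_)
    have := hf.dist_le_mul x 0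
    simp only [NNReal.coe_one, one_mul, Real.dist_eq, sub_zero] at this
    have := abs_sub_abs_le_abs_sub (f x) (f 0)
    simp only [Pi.add_apply, Real.norm_eq_abs]
    linarith
  have c2 := abs_integral_sub_le_of_close (X := fun x => x) hfφ
    (hφ.hasAllMoments_zero hasAllMoments_id_gaussianReal).integrable iZ
  rw [abs_le] at *
  constructor <;> linarith [hb.1, hb.2, c1.1, c1.2, c2.1, c2.2]

theorem abs_measureReal_sub_le (H : IsChaosApprox P e h F Fn t) (hF : ∫ ω, F ω ^ 2 ∂P = 1)
    {S : Set ℝ} (hS : MeasurableSet S) :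
    |(P.map F).real S - (gaussianReal 0 1).real S| ≤ 2 * T₁ e h := by
  have hFm : AEMeasurable F P := H.aestronglyMeasurable.aemeasurable
  have : IsProbabilityMeasure (P.map F) := Measure.isProbabilityMeasure_map hFm
  have h1 : ∀ f : ℝ → ℝ, Continuous f → (∀ x, 0 ≤ f x) → (∀ x, f x ≤ 1) →
      |(∫ x, f x ∂P.map F) - ∫ x, f x ∂gaussianReal 0 1| ≤ 2 * T₁ e h := fun f hf hf0 hf1 => by
    rw [integral_map hFm hf.aestronglyMeasurable]
    exact H.abs_integral_sub_le_of_continuous hF hf hf0 hf1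
  have h2 := measureReal_le_of_continuous (M := 2 * T₁ e h) (ρ := P.map F) (γ := gaussianReal 0 1)
    (fun f hf hf0 hf1 => by linarith [(abs_le.1 (h1 f hf hf0 hf1)).2]) hS
  have h3 := measureReal_le_of_continuous (M := 2 * T₁ e h) (ρ := gaussianReal 0 1)
    (γ := P.map F)
    (fun f hf hf0 hf1 => by linarith [(abs_le.1 (h1 f hf hf0 hf1)).1]) hS
  rw [abs_le]
  constructor <;> linarith

end IsChaosApprox

/-- A bounded third derivative makes φ'' Lipschitz, which gives its linear growth. -/
theorem hasSecondDerivGrowth_of_bddAbove {φ : ℝ → ℝ} (h0 : Differentiable ℝ φ)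
    (h1 : Differentiable ℝ (deriv φ)) (h2 : Differentiable ℝ (deriv (deriv φ)))
    (hb : BddAbove (Set.range fun x => |iteratedDeriv 3 φ x|)) :
    HasSecondDerivGrowth φ (deriv φ) (deriv (deriv φ)) |iteratedDeriv 2 φ 0|
      (⨆ x, |iteratedDeriv 3 φ x|) := by
  have e2 : iteratedDeriv 2 φ = deriv (deriv φ) := by
    rw [iteratedDeriv_succ, iteratedDeriv_one]
  have e3 : iteratedDeriv 3 φ = deriv (deriv (deriv φ)) := by
    rw [iteratedDeriv_succ, e2]
  refine ⟨fun x => (h0 x).hasDerivAt, fun x => (h1 x).hasDerivAt, h2.continuous, abs_nonneg _,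
    Real.iSup_nonneg fun _ => abs_nonneg _, fun x => ?_⟩
  have h := convex_univ.norm_image_sub_le_of_norm_hasDerivWithin_le
    (f := deriv (deriv φ)) (f' := iteratedDeriv 3 φ) (C := ⨆ x, |iteratedDeriv 3 φ x|)
    (fun y _ => by rw [e3]; exact (h2 y).hasDerivAt.hasDerivWithinAt)
    (fun y _ => le_ciSup hb y) (Set.mem_univ 0) (Set.mem_univ x)
  rw [sub_zero, Real.norm_eq_abs, Real.norm_eq_abs] at h
  have := abs_sub_abs_le_abs_sub (deriv (deriv φ) x) (deriv (deriv φ) 0)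
  rw [e2]
  linarith

/-- The interpolation constant is far below C_*. With A = |φ''(0)| and B = ‖φ'''‖_∞ the left side is
at most 4A + 6B. For d ≥ 2 one has 5^{3d/2} ≥ 125, so the prefactor of the maximum is at least 4 ·
126 = 504, and its first entry is at least 3A/2 + B/3. -/
theorem le_Cstar {d : ℕ} (hd : 2 ≤ d) (φ : ℝ → ℝ) :
    2 * √(2 * |iteratedDeriv 2 φ 0| ^ 2 + 4 * (⨆ x, |iteratedDeriv 3 φ x|) ^ 2 * (1 + 1)) ≤
      Cstar d φ := by
  set A := |iteratedDeriv 2 φ 0| with hA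
  set B := ⨆ x, |iteratedDeriv 3 φ x| with hB
  have hA0 : 0 ≤ A := abs_nonneg _
  have hB0 : 0 ≤ B := Real.iSup_nonneg fun _ => abs_nonneg _
  have k1 : √(2 * A ^ 2 + 4 * B ^ 2 * (1 + 1)) ≤ 2 * A + 3 * B := by
    rw [Real.sqrt_le_left (by positivity)]
    nlinarith [mul_nonneg hA0 hB0, sq_nonneg A, sq_nonneg B]
  have k2 : (1 : ℝ) ≤ 2 * √2 / √Real.pi := by
    rw [le_div_iff₀ (Real.sqrt_pos.2 Real.pi_pos), one_mul,
      Real.sqrt_le_left (by positivity), mul_pow, Real.sq_sqrt (by norm_num)]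
    linarith [Real.pi_le_four]
  have k3 : (1 : ℝ) ≤ √2 := by rw [Real.one_le_sqrt]; norm_num
  have k4 : (125 : ℝ) ≤ 5 ^ (3 * (d : ℝ) / 2) := by
    have hd' : (2 : ℝ) ≤ d := by exact_mod_cast hd
    calc (125 : ℝ) = 5 ^ (3 : ℝ) := by norm_num
      _ ≤ _ := Real.rpow_le_rpow_of_exponent_le (by norm_num) (by linarith)
  have k5 : 3 / 2 * A + B / 3 * 1 ≤
      max (3 / 2 * A + B / 3 * (2 * √2 / √Real.pi)) (2 * |deriv φ 0| + 1 / 3 * B) :=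
    le_trans (by gcongr) (le_max_left _ _)
  have k6 : (504 : ℝ) ≤ 4 * √2 * (1 + 5 ^ (3 * (d : ℝ) / 2)) := by nlinarith
  have k7 : 504 * (3 / 2 * A + B / 3 * 1) ≤ Cstar d φ := by
    rw [Cstar]
    exact mul_le_mul k6 k5 (by positivity) (by positivity)
  linarith

end Limit

end WienerChaos

end

/-! ### The fourth moment bounds -/

theorem theorem3p1
    {𝔥 : Type*} [NormedAddCommGroup 𝔥] [InnerProductSpace ℝ 𝔥] [CompleteSpace 𝔥]
    (e : HilbertBasis ℕ ℝ 𝔥)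
    {Ω : Type*} [MeasurableSpace Ω] (P : Measure Ω) [IsProbabilityMeasure P]
    (G : ℕ → Ω → ℝ) (hGm : ∀ i, Measurable (G i)) (hGi : iIndepFun G P)
    (hG : ∀ i, P.map (G i) = gaussianReal 0 1)
    (d : ℕ) (hd : 2 ≤ d)
    (h : WienerChaos.TensorPower 𝔥 d) (hh : h ∈ WienerChaos.symmetricPower 𝔥 d)
    (F : Ω → ℝ) (hF : WienerChaos.IsMultipleIntegral P G e h F)
    (hF2 : ∫ ω, F ω ^ 2 ∂P = 1)
    {Ω' : Type*} [MeasurableSpace Ω'] (P' : Measure Ω') [IsProbabilityMeasure P']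
    (Z : Ω' → ℝ) (hZm : Measurable Z) (hZ : P'.map Z = gaussianReal 0 1) :
    Integrable (fun ω => F ω ^ 4) P ∧
    WienerChaos.T₁ e h ≤ WienerChaos.T₂ P d F ∧
    WienerChaos.dTV P F P' Z ≤ ENNReal.ofReal (2 * WienerChaos.T₁ e h) ∧
    WienerChaos.dW P F P' Z ≤ ENNReal.ofReal (WienerChaos.T₁ e h) ∧
    ∀ φ : ℝ → ℝ, Differentiable ℝ φ → Differentiable ℝ (deriv φ) →
      Differentiable ℝ (deriv (deriv φ)) →
      BddAbove (Set.range fun x => |iteratedDeriv 3 φ x|) →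
      Integrable (fun ω => φ (F ω)) P ∧ Integrable (fun ω => φ (Z ω)) P' ∧
      |(∫ ω, φ (F ω) ∂P) - ∫ ω, φ (Z ω) ∂P'| ≤
        WienerChaos.Cstar d φ * WienerChaos.T₁ e h := by
  obtain ⟨Fn, t, H⟩ := WienerChaos.exists_isChaosApprox e hGm hGi hG (by omega) hF
  have hFm : AEMeasurable F P := H.aestronglyMeasurable.aemeasurable
  have hZint : ∀ f : ℝ → ℝ, Continuous f →
      ∫ ω, f (Z ω) ∂P' = ∫ x, f x ∂gaussianReal 0 1 := fun f hf => by
    rw [← hZ, integral_map hZm.aemeasurable hf.aestronglyMeasurable]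
  refine ⟨WienerChaos.integrable_pow_four H.memLp_four, H.T₁_le_T₂ (by omega) hF2,
    iSup₂_le ?_, iSup₂_le ?_, ?_⟩
  · rintro _ ⟨S, hS, rfl⟩
    refine ENNReal.ofReal_le_ofReal ?_
    have h1 : ∫ ω, S.indicator 1 (F ω) ∂P = (P.map F).real S := by
      rw [← integral_map hFm (measurable_one.indicator hS).aestronglyMeasurable,
        integral_indicator_one hS]
    have h2 : ∫ ω, S.indicator 1 (Z ω) ∂P' = (gaussianReal 0 1).real S := by
      rw [← integral_map hZm.aemeasurable (measurable_one.indicator hS).aestronglyMeasurable,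
        integral_indicator_one hS, hZ]
    rw [h1, h2]
    exact H.abs_measureReal_sub_le hF2 hS
  · intro f hf
    refine ENNReal.ofReal_le_ofReal ?_
    rw [hZint f hf.continuous]
    exact H.abs_integral_sub_le_of_lipschitz hF2 hf
  · intro φ h0 h1 h2 hb
    have hφ := WienerChaos.hasSecondDerivGrowth_of_bddAbove h0 h1 h2 hb
    refine ⟨H.integrable_comp hφ, ?_, ?_⟩
    · have h3 := (hφ.hasAllMoments_zero WienerChaos.hasAllMoments_id_gaussianReal).integrable
      rw [← hZ] at h3
      exact h3.comp_measurable hZm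
    · rw [hZint φ hφ.continuous_zero]
      exact (H.abs_integral_sub_le_of_growth hF2 hφ).trans
        (mul_le_mul_of_nonneg_right (WienerChaos.le_Cstar hd φ) (Real.sqrt_nonneg _))
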